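/- Let $V:\mathbb R^d\to\mathbb R$ be continuously differentiable with $\int e^{-V}\,dx<\infty$, and let $\pi\propto e^{-V}$ be the corresponding probability measure on $\mathbb R^d$. Suppose that $\pi$ satisfies a Poincaré inequality with constant $C_P>0$, that is, $\operatorname{Var}_\pi f\le C_P\,\mathbb E_\pi[\|\nabla f\|^2]$ for all locally Lipschitz $f\in L^2(\pi)$. Let $(\mu_t)_{t\ge 0}$ be a Wasserstein gradient flow of the chi-squared divergence $\chi^2(\mu\|\pi)=\int(\frac{d\mu}{d\pi}-1)^2\,d\pi$ (with value $+\infty$ if $\mu\not\ll\pi$), that is, a weak solution of $$\partial_t\mu_t=2\operatorname{div}\Bigl(\mu_t\nabla\frac{d\mu_t}{d\pi}\Bigr)$$ in the following sense: every $\mu_t$ is a probability measure with density $\rho_t=\frac{d\mu_t}{d\pi}$; for almost every $t>0$ the function $\rho_t$ has a weak gradient $\nabla\rho_t$; for every $T>0$ $$\int_0^T\mathbb E_\pi[\|\nabla\rho_t\|^2]\,dt<\infty\qquad\text{and}\qquad\int_0^T\mathbb E_{\mu_t}[\|\nabla\rho_t\|^2]\,dt<\infty;$$ and for every $\varphi\in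 C_c^\infty(\mathbb R^d)$ and every $t\ge0$ $$\int\varphi\,d\mu_t-\int\varphi\,d\mu_0=-2\int_0^t\int\langle\nabla\rho_s,\nabla\varphi\rangle\,d\mu_s\,ds.$$ Assume that $\chi^2(\mu_0\|\pi)<\infty$. Then $$\mathrm{KL}(\mu_t\|\pi)\le \mathrm{KL}(\mu_0\|\pi)\,e^{-2t/C_P}\qquad\text{for all }t\ge0,$$ and moreover $$\mathrm{KL}(\mu_t\|\pi)\le\min\{\mathrm{KL}(\mu_0\|\pi),2\}\,e^{-2t/C_P}\qquad\text{for all }t\ge C_P/2.$$ -/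

import Mathlib

open MeasureTheory ProbabilityTheory InformationTheory Set
open scoped ENNReal ContDiff

noncomputable section

namespace ChiSquaredFlow

/-- The probability measure `π ∝ exp (-V)` on `ℝ^d` (a probability measure as soon as
`exp (-V)` is Lebesgue integrable). -/
def gibbs {d : ℕ} (V : EuclideanSpace ℝ (Fin d) → ℝ) : Measure (EuclideanSpace ℝ (Fin d)) :=
  (volume : Measure (EuclideanSpace ℝ (Fin d))).tilted (fun x => -V x)

/-- The chi-squared divergence `χ²(μ ‖ π) = ∫ (dμ/dπ - 1)² dπ`, equal to `∞` unless `μ ≪ π`. -/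
def chiSqDiv {d : ℕ} (μ π : Measure (EuclideanSpace ℝ (Fin d))) : ℝ≥0∞ :=
  open Classical in
  if μ ≪ π then ∫⁻ x, ENNReal.ofReal (((μ.rnDeriv π x).toReal - 1) ^ 2) ∂π else ⊤

/-- The Poincaré inequality with constant `C`: `Var_π f ≤ C E_π ‖∇f‖²` for all locally
Lipschitz `f ∈ L²(π)`. Both sides are computed in `[0, ∞]`; the gradient exists almost
everywhere by Rademacher's theorem. -/
def PoincareInequality {d : ℕ} (π : Measure (EuclideanSpace ℝ (Fin d))) (C : ℝ) : Prop :=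
  ∀ f : EuclideanSpace ℝ (Fin d) → ℝ, LocallyLipschitz f → MemLp f 2 π →
    evariance f π ≤ ENNReal.ofReal C * ∫⁻ x, ‖gradient f x‖ₑ ^ 2 ∂π

/-- `g` is the weak (distributional) gradient of `f` on `ℝ^d`. -/
structure HasWeakGradient {d : ℕ} (f : EuclideanSpace ℝ (Fin d) → ℝ)
    (g : EuclideanSpace ℝ (Fin d) → EuclideanSpace ℝ (Fin d)) : Prop where
  locallyIntegrable_fun : LocallyIntegrable f volume
  locallyIntegrable_grad : LocallyIntegrable g volume
  integral_eq : ∀ φ : EuclideanSpace ℝ (Fin d) → ℝ, ContDiff ℝ ∞ φ → HasCompactSupport φ →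
    ∫ x, f x • gradient φ x = -∫ x, φ x • g x

/-- The curve `(μ_t)_{t ≥ 0}` is a weak solution of `∂_t μ_t = 2 div (μ_t ∇ (dμ_t/dπ))`, where
`ρ t` is the density `dμ_t/dπ` and `g t` its weak gradient. -/
structure IsWeakSolution {d : ℕ} (π : Measure (EuclideanSpace ℝ (Fin d)))
    (μ : ℝ → Measure (EuclideanSpace ℝ (Fin d)))
    (ρ : ℝ → EuclideanSpace ℝ (Fin d) → ℝ)
    (g : ℝ → EuclideanSpace ℝ (Fin d) → EuclideanSpace ℝ (Fin d)) : Prop where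
  isProbabilityMeasure : ∀ t, 0 ≤ t → IsProbabilityMeasure (μ t)
  measurable_density : Measurable (fun p : ℝ × EuclideanSpace ℝ (Fin d) => ρ p.1 p.2)
  measurable_grad : Measurable (fun p : ℝ × EuclideanSpace ℝ (Fin d) => g p.1 p.2)
  density_nonneg : ∀ t x, 0 ≤ ρ t x
  density_eq : ∀ t, 0 ≤ t → μ t = π.withDensity (fun x => ENNReal.ofReal (ρ t x))
  hasWeakGradient : ∀ᵐ t ∂(volume.restrict (Ioi (0 : ℝ))), HasWeakGradient (ρ t) (g t)
  /-- The density has locally finite Dirichlet energy: `∇ρ ∈ L²([0, T]; L²(π))`. -/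
  dirichlet_energy_lt_top : ∀ T : ℝ, ∫⁻ t in Ioc 0 T, ∫⁻ x, ‖g t x‖ₑ ^ 2 ∂π < ⊤
  /-- The velocity field `-2∇ρ_t` has locally finite action, as for every curve that is
  absolutely continuous of order 2 in the 2-Wasserstein space. -/
  action_lt_top : ∀ T : ℝ, ∫⁻ t in Ioc 0 T, ∫⁻ x, ‖g t x‖ₑ ^ 2 ∂(μ t) < ⊤
  /-- The equation, tested against smooth compactly supported functions and integrated in
  time. It contains the initial condition. -/
  integral_eq : ∀ φ : EuclideanSpace ℝ (Fin d) → ℝ, ContDiff ℝ ∞ φ → HasCompactSupport φ →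
    ∀ t, 0 ≤ t →
      ∫ x, φ x ∂(μ t) - ∫ x, φ x ∂(μ 0)
        = -2 * ∫ s in (0 : ℝ)..t, ∫ x, inner ℝ (g s x) (gradient φ x) ∂(μ s)

/-- The curve `(μ_t)_{t ≥ 0}` is a Wasserstein gradient flow of `χ²(· ‖ π)`. -/
def IsChiSquaredFlow {d : ℕ} (π : Measure (EuclideanSpace ℝ (Fin d)))
    (μ : ℝ → Measure (EuclideanSpace ℝ (Fin d))) : Prop :=
  ∃ (ρ : ℝ → EuclideanSpace ℝ (Fin d) → ℝ)
    (g : ℝ → EuclideanSpace ℝ (Fin d) → EuclideanSpace ℝ (Fin d)), IsWeakSolution π μ ρ g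

end ChiSquaredFlow

end

/-! Write `ρ` for the density of `μ_t` with respect to `π`. Formally the entropy `y(t) = KL(μ_t ‖
π)` satisfies `y' = -2 ∫ ⟨∇ log ρ, ∇ρ⟩ dμ_t = -2 E_π ‖∇ρ‖²`. The Poincaré inequality for `ρ` gives
`χ² ≤ C E_π ‖∇ρ‖²`, and Jensen's inequality gives `exp y - 1 ≤ χ²`, so `y' ≤ -(2/C) (exp y - 1)`.
Since `exp y - 1 ≥ y`, this yields the first bound. It also gives `(1 - exp (-y))' ≤ -(2/C) (1 - exp
(-y))`, so `1 - exp (-y(t)) ≤ exp (-2t/C)` whatever the initial entropy. For `t ≥ C/2` the right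
side `z` is at most `1/2`, and then `1 - exp (-y) ≤ z` forces `y ≤ 2z`. This part is
`exp_relEntropy_sub_one_le`, `entropy_decay` and `le_two_mul_of_one_sub_exp_neg_le`.

The analytic work is the entropy balance `relEntropy_add` for weak solutions. The measure is
mollified in space, which turns the equation into an integral equation in time at each point. The
chain rule is applied to a regularised entropy `ent a` with bounded derivative, the result is
integrated against a cutoff, and the mollification is removed (`entropy_sub`). Then cutoff and
regularisation are removed together: the cutoff gradient is of order `1/n`, the derivative of the
entropy at most `log (n + 1)`.

On `{ρ = 0}` no information about `∇ρ` is used. The balance produces the energy on `{ρ ≠ 0}` only,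
and `PoincareInequality.lintegral_sub_one_sq_le` is proved with that same smaller energy, through
truncations that are flat at `0`. It also supplies the square integrability of `ρ` in space and
time. -/

namespace ChiSquaredFlow

open Filter Topology Convolution

/-! ### Convergence of integrals, absolutely continuous chain rule, Cauchy–Schwarz. -/

/-- Dominated convergence with a converging sequence of dominating functions. -/
theorem tendsto_integral_of_tendsto_dominating {α : Type*} [MeasurableSpace α] {μ : Measure α}
    {F H : ℕ → α → ℝ} {f h : α → ℝ} (hF : ∀ k, AEStronglyMeasurable (F k) μ)
    (hH : ∀ k, Integrable (H k) μ) (hh : Integrable h μ) (hle : ∀ k, ∀ᵐ x ∂μ, |F k x| ≤ H k x)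
    (hFl : ∀ᵐ x ∂μ, Tendsto (fun k => F k x) atTop (𝓝 (f x)))
    (hHl : ∀ᵐ x ∂μ, Tendsto (fun k => H k x) atTop (𝓝 (h x)))
    (hint : Tendsto (fun k => ∫ x, H k x ∂μ) atTop (𝓝 (∫ x, h x ∂μ))) :
    Tendsto (fun k => ∫ x, F k x ∂μ) atTop (𝓝 (∫ x, f x ∂μ)) := by
  have hle' : ∀ᵐ x ∂μ, ∀ k, |F k x| ≤ H k x := ae_all_iff.2 hle
  have hfh : ∀ᵐ x ∂μ, |f x| ≤ h x := by
    filter_upwards [hFl, hHl, hle'] with x h1 h2 h3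
    exact le_of_tendsto_of_tendsto' h1.abs h2 h3
  have hHnn : ∀ k, ∀ᵐ x ∂μ, 0 ≤ H k x := fun k => by
    filter_upwards [hle k] with x hx using (abs_nonneg _).trans hx
  have hFi : ∀ k, Integrable (F k) μ := fun k => (hH k).mono' (hF k) (by simpa using hle k)
  -- As in Scheffé's lemma: `(h - H k)⁺` is dominated by `|h|` because `H k ≥ 0`. Together with
  -- convergence of the integrals this also controls the opposite part `(H k - h)⁺`.
  have hpos : Tendsto (fun k => ∫ x, max (h x - H k x) 0 ∂μ) atTop (𝓝 0) := by
    have : Tendsto (fun k => ∫ x, max (h x - H k x) 0 ∂μ) atTop (𝓝 (∫ x, (0 : ℝ) ∂μ)) := by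
      refine tendsto_integral_of_dominated_convergence (fun x => |h x|)
        (fun k => ((hh.sub (hH k)).pos_part).aestronglyMeasurable) hh.abs (fun k => ?_) ?_
      · filter_upwards [hHnn k] with x hx
        rw [Real.norm_eq_abs, abs_of_nonneg (le_max_right _ _)]
        exact max_le (by linarith [le_abs_self (h x)]) (abs_nonneg _)
      · filter_upwards [hHl] with x hx
        simpa using (tendsto_const_nhds (x := h x)).sub hx |>.max (tendsto_const_nhds (x := (0 : ℝ)))
    simpa using this
  have herr : Tendsto (fun k => ∫ x, max (H k x - h x) 0 ∂μ) atTop (𝓝 0) := by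
    have e : ∀ k, ∫ x, max (H k x - h x) 0 ∂μ
        = (∫ x, H k x ∂μ - ∫ x, h x ∂μ) + ∫ x, max (h x - H k x) 0 ∂μ := fun k => by
      have i1 : Integrable (fun x => max (h x - H k x) 0) μ := (hh.sub (hH k)).pos_part
      have i2 : Integrable (fun x => H k x - h x) μ := (hH k).sub hh
      rw [← integral_sub (hH k) hh, ← integral_add i2 i1]
      refine integral_congr_ae (ae_of_all _ fun x => ?_)
      dsimp only
      rcases le_total (H k x) (h x) with c | c
      · rw [max_eq_right (by linarith), max_eq_left (by linarith)]; ring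
      · rw [max_eq_left (by linarith), max_eq_right (by linarith)]; ring
    simp_rw [e]
    simpa using (hint.sub_const (∫ x, h x ∂μ)).add hpos
  -- Clamping `F k` to `[-|h|, |h|]` gives a sequence to which ordinary dominated convergence
  -- applies, and changes `F k` by at most `(H k - h)⁺`.
  set c : ℕ → α → ℝ := fun k x => max (-|h x|) (min |h x| (F k x)) with hc
  have hcm : ∀ k, AEStronglyMeasurable (c k) μ := fun k =>
    (hh.abs.neg.aestronglyMeasurable).sup (hh.abs.aestronglyMeasurable.inf (hF k))
  have hcb : ∀ k x, |c k x| ≤ |h x| := fun k x =>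
    abs_le.2 ⟨le_max_left _ _, max_le (by linarith [abs_nonneg (h x)]) (min_le_left _ _)⟩
  have hci : ∀ k, Integrable (c k) μ := fun k =>
    hh.abs.mono' (hcm k) (ae_of_all _ (by simpa using hcb k))
  have hcl : Tendsto (fun k => ∫ x, c k x ∂μ) atTop (𝓝 (∫ x, f x ∂μ)) := by
    refine tendsto_integral_of_dominated_convergence (fun x => |h x|) hcm hh.abs
      (fun k => ae_of_all _ (by simpa using hcb k)) ?_
    filter_upwards [hFl, hfh] with x h1 h2
    have := (tendsto_const_nhds (x := -|h x|)).max ((tendsto_const_nhds (x := |h x|)).min h1)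
    have h3 := abs_le.1 (h2.trans (le_abs_self _))
    rwa [min_eq_right h3.2, max_eq_right h3.1] at this
  have hd : ∀ k, |∫ x, F k x ∂μ - ∫ x, c k x ∂μ| ≤ ∫ x, max (H k x - h x) 0 ∂μ := fun k => by
    rw [← integral_sub (hFi k) (hci k)]
    refine (abs_integral_le_integral_abs).trans (integral_mono_ae ((hFi k).sub (hci k)).abs
      ((hH k).sub hh).pos_part ?_)
    filter_upwards [hle k, hfh] with x h1 h2
    have h3 := (abs_nonneg _).trans h2
    have h4 := abs_le.1 h1
    simp only [hc, abs_of_nonneg h3]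
    rcases le_total (F k x) (h x) with c1 | c1
    · rw [min_eq_right c1]
      rcases le_total (-h x) (F k x) with c2 | c2
      · rw [max_eq_right c2]; simp
      · rw [max_eq_left c2, abs_of_nonpos (by linarith)]
        exact le_max_of_le_left (by linarith)
    · rw [min_eq_left c1, max_eq_right (by linarith), abs_of_nonneg (by linarith)]
      exact le_max_of_le_left (by linarith)
  have hz : Tendsto (fun k => ∫ x, F k x ∂μ - ∫ x, c k x ∂μ) atTop (𝓝 0) :=
    squeeze_zero_norm (fun k => by simpa using hd k) herr
  simpa using hz.add hcl

/-- Chain rule, in integrated form, for a primitive of an integrable function. -/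
theorem integral_deriv_comp_primitive {T : ℝ} (hT : 0 ≤ T) {b h U U' : ℝ → ℝ} {K : ℝ} {S : Set ℝ}
    (hS : Convex ℝ S) (hb : IntervalIntegrable b volume 0 T)
    (hh : ∀ t ∈ Icc 0 T, h t = h 0 + ∫ r in (0 : ℝ)..t, b r) (hhS : ∀ t ∈ Icc 0 T, h t ∈ S)
    (hU : ∀ r ∈ S, HasDerivAt U (U' r) r) (hK : ∀ r ∈ S, |U' r| ≤ K) :
    U (h T) - U (h 0) = ∫ r in (0 : ℝ)..T, U' (h r) * b r := by
  have h0 : (0 : ℝ) ∈ uIcc 0 T := by simp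
  have hI : uIcc 0 T = Icc 0 T := uIcc_of_le hT
  set H : ℝ → ℝ := fun t => h 0 + ∫ r in (0 : ℝ)..t, b r with hH
  have hHac : AbsolutelyContinuousOnInterval H 0 T := by
    have h1 := hb.absolutelyContinuousOnInterval_intervalIntegral h0
    have h2 : AbsolutelyContinuousOnInterval (fun _ : ℝ => h 0) 0 T :=
      (LipschitzOnWith.of_dist_le_mul (K := 0) (fun x _ y _ => by
        simp)).absolutelyContinuousOnInterval
    exact h2.add h1
  have hHS : ∀ t ∈ Icc 0 T, H t ∈ S := fun t ht => by
    have := hhS t ht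
    rwa [hh t ht] at this
  have hlip : ∀ x ∈ S, ∀ y ∈ S, |U x - U y| ≤ K * |x - y| := fun x hx y hy => by
    simpa [Real.norm_eq_abs] using Convex.norm_image_sub_le_of_norm_hasDerivWithin_le
      (fun r hr => (hU r hr).hasDerivWithinAt) (by simpa using hK) hS hy hx
  have hK0 : 0 ≤ K := (abs_nonneg _).trans (hK _ (hhS 0 ⟨le_rfl, hT⟩))
  -- A Lipschitz function of an absolutely continuous one is absolutely continuous, so the
  -- fundamental theorem of calculus applies. The constant `K + 1` replaces `K` to be a nonzero
  -- divisor.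
  have hac : AbsolutelyContinuousOnInterval (U ∘ H) 0 T := by
    rw [absolutelyContinuousOnInterval_iff] at hHac ⊢
    intro ε hε
    obtain ⟨δ, hδ, hd⟩ := hHac (ε / (K + 1)) (by positivity)
    refine ⟨δ, hδ, fun E hE hlt => ?_⟩
    have h1 := hd E hE hlt
    have h2 : ∑ i ∈ Finset.range E.1, dist ((U ∘ H) (E.2 i).1) ((U ∘ H) (E.2 i).2)
        ≤ ∑ i ∈ Finset.range E.1, (K + 1) * dist (H (E.2 i).1) (H (E.2 i).2) := by
      refine Finset.sum_le_sum fun i hi => ?_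
      have h3 := hE.1 i hi
      rw [hI] at h3
      have h4 := hlip _ (hHS _ h3.1) _ (hHS _ h3.2)
      simp only [Function.comp, Real.dist_eq]
      nlinarith [abs_nonneg (H (E.2 i).1 - H (E.2 i).2)]
    rw [← Finset.mul_sum] at h2
    rw [lt_div_iff₀ (by positivity)] at h1
    linarith
  have hfin := hac.integral_deriv_eq_sub
  have e0 : H 0 = h 0 := by simp [hH]
  have eT : H T = h T := (hh T ⟨hT, le_rfl⟩).symm
  simp only [Function.comp, e0, eT] at hfin
  rw [← hfin]
  refine intervalIntegral.integral_congr_ae ?_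
  filter_upwards [hb.ae_hasDerivAt_integral] with x hx hx2
  have hx3 : x ∈ uIcc 0 T := uIoc_subset_uIcc hx2
  have h1 : HasDerivAt H (b x) x := (hx hx3 0 h0).const_add _
  have h2 := (hU (H x) (hHS x (hI ▸ hx3))).comp x h1
  rw [h2.deriv, hh x (hI ▸ hx3)]

/-- Cauchy–Schwarz for a weighted integral. -/
theorem sq_integral_mul_le {α : Type*} [MeasurableSpace α] {μ : Measure α} {p a : α → ℝ}
    (hp0 : ∀ x, 0 ≤ p x) (hp : Integrable p μ) (hpa : Integrable (fun x => p x * a x) μ)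
    (hpa2 : Integrable (fun x => p x * a x ^ 2) μ) :
    (∫ x, p x * a x ∂μ) ^ 2 ≤ (∫ x, p x ∂μ) * ∫ x, p x * a x ^ 2 ∂μ := by
  -- The integral of `p (a - l)²` is a nonnegative quadratic in `l`, so its discriminant is
  -- nonpositive.
  have key : ∀ l : ℝ, 0 ≤ (∫ x, p x ∂μ) * (l * l) + (-2 * ∫ x, p x * a x ∂μ) * l
      + ∫ x, p x * a x ^ 2 ∂μ := fun l => by
    have : 0 ≤ ∫ x, p x * (a x - l) ^ 2 ∂μ :=
      integral_nonneg fun x => mul_nonneg (hp0 x) (sq_nonneg _)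
    have e : ∫ x, p x * (a x - l) ^ 2 ∂μ
        = ∫ x, (p x * (l * l) + (-2 * (p x * a x)) * l + p x * a x ^ 2) ∂μ :=
      integral_congr_ae (ae_of_all _ fun x => by dsimp only; ring)
    rw [e, integral_add (by fun_prop) hpa2,
      integral_add (by fun_prop) (by fun_prop), integral_mul_const, integral_mul_const,
      integral_const_mul] at this
    exact this
  have := discrim_le_zero key
  rw [discrim] at this
  nlinarith

/-- Fatou gives the lower bound and domination by the limit itself the upper one, so the limit
integral may be infinite and no monotonicity is needed. -/
theorem tendsto_lintegral_of_le_of_tendsto {α : Type*} [MeasurableSpace α] {μ : Measure α}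
    {F : ℕ → α → ℝ≥0∞} {f : α → ℝ≥0∞} (hF : ∀ k, AEMeasurable (F k) μ)
    (hle : ∀ k, ∀ᵐ x ∂μ, F k x ≤ f x)
    (hl : ∀ᵐ x ∂μ, Tendsto (fun k => F k x) atTop (𝓝 (f x))) :
    Tendsto (fun k => ∫⁻ x, F k x ∂μ) atTop (𝓝 (∫⁻ x, f x ∂μ)) := by
  refine tendsto_of_le_liminf_of_limsup_le ?_ ?_
  · calc ∫⁻ x, f x ∂μ = ∫⁻ x, liminf (fun k => F k x) atTop ∂μ :=
        lintegral_congr_ae (by filter_upwards [hl] with x hx using hx.liminf_eq.symm)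
      _ ≤ _ := lintegral_liminf_le' hF
  · refine limsup_le_of_le (by isBoundedDefault) (Eventually.of_forall fun k => ?_)
    exact lintegral_mono_ae (hle k)

/-! ### Mollification on Euclidean space. -/

section

abbrev Space (d : ℕ) := EuclideanSpace ℝ (Fin d)

/-- A sequence of bump functions shrinking to the origin. -/
noncomputable def bump (d k : ℕ) : ContDiffBump (0 : Space d) where
  rIn := 1 / (k + 2)
  rOut := 2 / (k + 2)
  rIn_pos := by positivity
  rIn_lt_rOut := by gcongr; norm_num

/-- The standard mollifying kernels. -/
noncomputable def ker (d k : ℕ) : Space d → ℝ := (bump d k).normed volume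

/-- Mollification by `ker d k`. -/
noncomputable def moll {d : ℕ} {F : Type*} [NormedAddCommGroup F] [NormedSpace ℝ F] (k : ℕ)
    (f : Space d → F) (x : Space d) : F := ∫ y, ker d k (x - y) • f y

theorem locallyIntegrable_norm {d : ℕ} {F : Type*} [NormedAddCommGroup F] {f : Space d → F}
    (hf : LocallyIntegrable f volume) : LocallyIntegrable (fun x => ‖f x‖) volume :=
  fun x => (hf x).norm

variable {d : ℕ} {F : Type*} [NormedAddCommGroup F] [NormedSpace ℝ F]

theorem ker_nonneg (k : ℕ) (x : Space d) : 0 ≤ ker d k x := (bump d k).nonneg_normed x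

theorem contDiff_ker {n : ℕ∞} (k : ℕ) : ContDiff ℝ n (ker d k) := (bump d k).contDiff_normed

theorem continuous_ker (k : ℕ) : Continuous (ker d k) := (bump d k).continuous_normed

theorem hasCompactSupport_ker (k : ℕ) : HasCompactSupport (ker d k) :=
  (bump d k).hasCompactSupport_normed

theorem integral_ker (k : ℕ) : ∫ x, ker d k x = 1 := (bump d k).integral_normed

theorem ker_neg (k : ℕ) (x : Space d) : ker d k (-x) = ker d k x := (bump d k).normed_neg x

/-- The shift by `2` in the radii serves this bound: mollification enlarges supports by at most `1`,
uniformly in `k`. -/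
theorem bump_rOut_le (k : ℕ) : (bump d k).rOut ≤ 1 := by
  change (2 : ℝ) / (k + 2) ≤ 1
  rw [div_le_one (by positivity)]
  linarith [(Nat.cast_nonneg k : (0 : ℝ) ≤ k)]

theorem ker_eq_zero (k : ℕ) {x : Space d} (hx : 1 ≤ ‖x‖) : ker d k x = 0 := by
  by_contra h
  have : x ∈ Function.support (ker d k) := h
  rw [ker, (bump d k).support_normed_eq, mem_ball_zero_iff] at this
  linarith [bump_rOut_le (d := d) k]

theorem tendsto_bump_rOut : Tendsto (fun k => (bump d k).rOut) atTop (𝓝 0) := by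
  change Tendsto (fun k : ℕ => (2 : ℝ) / (k + 2)) atTop (𝓝 0)
  exact tendsto_const_nhds.div_atTop
    (tendsto_atTop_add_const_right _ _ tendsto_natCast_atTop_atTop)

theorem moll_eq_convolution (k : ℕ) (f : Space d → F) :
    moll k f = (ker d k) ⋆[ContinuousLinearMap.lsmul ℝ ℝ, volume] f := by
  ext x; rw [convolution_lsmul_swap]; rfl

theorem hasCompactSupport_comp_sub {G : Type*} [Zero G] {f : Space d → G} (hf : HasCompactSupport f)
    (x : Space d) : HasCompactSupport (fun y => f (x - y)) :=
  hf.comp_homeomorph (Homeomorph.subLeft x)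

theorem integrable_ker_smul (k : ℕ) {f : Space d → F} (hf : LocallyIntegrable f volume)
    (x : Space d) : Integrable (fun y => ker d k (x - y) • f y) volume :=
  hf.integrable_smul_left_of_hasCompactSupport
    ((continuous_ker k).comp (by fun_prop)) (hasCompactSupport_comp_sub (hasCompactSupport_ker k) x)

theorem integrable_ker_sub (k : ℕ) (x : Space d) :
    Integrable (fun y => ker d k (x - y)) volume :=
  ((continuous_ker k).comp (by fun_prop)).integrable_of_hasCompactSupport
    (hasCompactSupport_comp_sub (hasCompactSupport_ker k) x)

theorem integral_ker_sub (k : ℕ) (x : Space d) : ∫ y, ker d k (x - y) = 1 := by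
  rw [integral_sub_left_eq_self (ker d k)]; exact integral_ker k

theorem ae_tendsto_moll [CompleteSpace F] {f : Space d → F} (hf : LocallyIntegrable f volume) :
    ∀ᵐ x, Tendsto (fun k => moll k f x) atTop (𝓝 (f x)) := by
  simp_rw [moll_eq_convolution]
  -- The ratio of outer to inner radius is `2` for every `k`, as Lebesgue differentiation requires.
  refine ContDiffBump.ae_convolution_tendsto_right_of_locallyIntegrable (K := 2)
    tendsto_bump_rOut (Eventually.of_forall fun k => ?_) hf
  change (2 : ℝ) / (k + 2) ≤ 2 * (1 / (k + 2))
  exact le_of_eq (by ring)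

theorem tendsto_moll_of_continuous [CompleteSpace F] {f : Space d → F} (hf : Continuous f)
    (x : Space d) : Tendsto (fun k => moll k f x) atTop (𝓝 (f x)) := by
  simp_rw [moll_eq_convolution]
  exact ContDiffBump.convolution_tendsto_right_of_continuous tendsto_bump_rOut hf x

theorem contDiff_moll {n : ℕ∞} (k : ℕ) {f : Space d → F} (hf : LocallyIntegrable f volume) :
    ContDiff ℝ n (moll k f) := by
  rw [moll_eq_convolution]
  exact (hasCompactSupport_ker k).contDiff_convolution_left _ (contDiff_ker k) hf

theorem continuous_moll (k : ℕ) {f : Space d → F} (hf : LocallyIntegrable f volume) :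
    Continuous (moll k f) := (contDiff_moll (n := 0) k hf).continuous

theorem moll_nonneg (k : ℕ) {f : Space d → ℝ} (hf : ∀ x, 0 ≤ f x) (x : Space d) :
    0 ≤ moll k f x :=
  integral_nonneg fun y => mul_nonneg (ker_nonneg _ _) (hf y)

theorem norm_moll_le_of_norm_le {f : Space d → F} {c : ℝ} (hf : ∀ x, ‖f x‖ ≤ c) (k : ℕ)
    (x : Space d) : ‖moll k f x‖ ≤ c := by
  have h := norm_integral_le_of_norm_le ((integrable_ker_sub k x).mul_const c)
    (f := fun y => ker d k (x - y) • f y) (ae_of_all _ fun y => by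
      rw [norm_smul, Real.norm_of_nonneg (ker_nonneg _ _)]
      exact mul_le_mul_of_nonneg_left (hf y) (ker_nonneg _ _))
  rwa [integral_mul_const, integral_ker_sub, one_mul] at h

theorem norm_moll_le (k : ℕ) (f : Space d → F) (x : Space d) :
    ‖moll k f x‖ ≤ moll k (fun y => ‖f y‖) x := by
  refine (norm_integral_le_integral_norm _).trans (le_of_eq ?_)
  refine integral_congr_ae (ae_of_all _ fun y => ?_)
  simp only [norm_smul, Real.norm_of_nonneg (ker_nonneg _ _), smul_eq_mul]

theorem moll_mono (k : ℕ) {f g : Space d → ℝ} (hf : LocallyIntegrable f volume)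
    (hg : LocallyIntegrable g volume) (h : ∀ x, f x ≤ g x) (x : Space d) :
    moll k f x ≤ moll k g x :=
  integral_mono (integrable_ker_smul k hf x) (integrable_ker_smul k hg x)
    fun y => mul_le_mul_of_nonneg_left (h y) (ker_nonneg _ _)

theorem moll_add (k : ℕ) {f g : Space d → F} (hf : LocallyIntegrable f volume)
    (hg : LocallyIntegrable g volume) (x : Space d) :
    moll k (fun y => f y + g y) x = moll k f x + moll k g x := by
  simp only [moll, smul_add]
  exact integral_add (integrable_ker_smul k hf x) (integrable_ker_smul k hg x)

/-- Cauchy–Schwarz for mollifications: `|(a g) * η|² ≤ (a * η) (a |g|² * η)`. -/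
theorem sq_norm_moll_smul_le (k : ℕ) {a : Space d → ℝ} {g : Space d → F} (ha0 : ∀ x, 0 ≤ a x)
    (ha : LocallyIntegrable a volume) (hag : LocallyIntegrable (fun x => a x • g x) volume)
    (hag2 : LocallyIntegrable (fun x => a x * ‖g x‖ ^ 2) volume) (x : Space d) :
    ‖moll k (fun y => a y • g y) x‖ ^ 2 ≤ moll k a x * moll k (fun y => a y * ‖g y‖ ^ 2) x := by
  have h1 := norm_moll_le k (fun y => a y • g y) x
  have e1 : (fun y => ‖a y • g y‖) = fun y => a y * ‖g y‖ := by
    ext y; rw [norm_smul, Real.norm_of_nonneg (ha0 y)]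
  have i1 := integrable_ker_smul k (locallyIntegrable_norm hag) x
  have i2 := integrable_ker_smul k hag2 x
  simp only [e1] at h1
  simp only [fun y => congrFun e1 y] at i1
  have h2 := sq_integral_mul_le (μ := (volume : Measure (Space d)))
    (p := fun y => ker d k (x - y) * a y)
    (a := fun y => ‖g y‖) (fun y => mul_nonneg (ker_nonneg _ _) (ha0 y))
    (integrable_ker_smul k ha x) (by simpa [mul_assoc] using i1) (by simpa [mul_assoc] using i2)
  simp only [mul_assoc] at h2
  exact (pow_le_pow_left₀ (norm_nonneg _) h1 2).trans h2

theorem sq_norm_moll_le (k : ℕ) {g : Space d → F} (hg : LocallyIntegrable g volume)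
    (hg2 : LocallyIntegrable (fun x => ‖g x‖ ^ 2) volume) (x : Space d) :
    ‖moll k g x‖ ^ 2 ≤ moll k (fun y => ‖g y‖ ^ 2) x := by
  have := sq_norm_moll_smul_le k (a := fun _ => 1) (g := g) (fun _ => zero_le_one)
    (locallyIntegrable_const _) (by simpa using hg) (by simpa using hg2) x
  have e : moll k (fun _ : Space d => (1 : ℝ)) x = 1 := by simp [moll, integral_ker_sub]
  simpa [e] using this

/-- When `χ` vanishes outside a ball of radius `R`, only the values of `f` in the ball of radius `R
+ 1` matter. Truncating `f` there leaves a bounded kernel times a product of integrable functions.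
-/
theorem integrable_mul_ker_mul (k : ℕ) {χ : Space d → ℝ} (hχ : Continuous χ)
    (hχs : HasCompactSupport χ) {f : Space d → ℝ} (hf : LocallyIntegrable f volume) :
    Integrable (fun p : Space d × Space d => χ p.1 * (ker d k (p.1 - p.2) * f p.2))
      (volume.prod volume) := by
  obtain ⟨R, hR⟩ := hχs.isCompact.isBounded.subset_closedBall (0 : Space d)
  obtain ⟨c, hc⟩ := (continuous_ker (d := d) k).bounded_above_of_compact_support
    (hasCompactSupport_ker k)
  have hfi : Integrable ((Metric.closedBall (0 : Space d) (R + 1)).indicator f) volume :=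
    (integrable_indicator_iff measurableSet_closedBall).2
      (hf.integrableOn_isCompact (isCompact_closedBall _ _))
  have h0 : Integrable (fun p : Space d × Space d =>
      ker d k (p.1 - p.2) * (χ p.1 * (Metric.closedBall (0 : Space d) (R + 1)).indicator f p.2))
      (volume.prod volume) :=
    ((hχ.integrable_of_hasCompactSupport hχs).mul_prod hfi).bdd_mul
      ((continuous_ker k).comp (by fun_prop)).aestronglyMeasurable (ae_of_all _ fun p => hc _)
  refine h0.congr (ae_of_all _ fun p => ?_)
  dsimp only
  by_cases h1 : χ p.1 = 0
  · simp [h1]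
  by_cases h2 : 1 ≤ ‖p.1 - p.2‖
  · simp [ker_eq_zero k h2]
  · have h3 : p.1 ∈ Metric.closedBall (0 : Space d) R := hR (subset_tsupport _ h1)
    have h4 : p.2 ∈ Metric.closedBall (0 : Space d) (R + 1) := by
      rw [mem_closedBall_zero_iff] at h3 ⊢
      have : ‖p.2‖ ≤ ‖p.1‖ + ‖p.1 - p.2‖ := by
        have := norm_sub_le p.1 (p.1 - p.2)
        simpa using this
      linarith [not_le.1 h2]
    rw [indicator_of_mem h4]
    ring

/-- Mollification is self-adjoint, because the kernel is even. -/
theorem integral_mul_moll (k : ℕ) {χ : Space d → ℝ} (hχ : Continuous χ)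
    (hχs : HasCompactSupport χ) {f : Space d → ℝ} (hf : LocallyIntegrable f volume) :
    ∫ x, χ x * moll k f x = ∫ y, moll k χ y * f y := by
  have h := integral_integral_swap (μ := (volume : Measure (Space d)))
    (ν := (volume : Measure (Space d)))
    (f := fun x y => χ x * (ker d k (x - y) * f y)) (integrable_mul_ker_mul k hχ hχs hf)
  simp only [integral_const_mul] at h
  simp only [moll, smul_eq_mul]
  rw [h]
  refine integral_congr_ae (ae_of_all _ fun y => ?_)
  dsimp only
  rw [← integral_mul_const]
  refine integral_congr_ae (ae_of_all _ fun x => ?_)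
  dsimp only
  rw [← ker_neg, neg_sub]; ring

theorem integrable_mul_moll (k : ℕ) {χ : Space d → ℝ} (hχ : Continuous χ)
    (hχs : HasCompactSupport χ) {f : Space d → ℝ} (hf : LocallyIntegrable f volume) :
    Integrable (fun x => χ x * moll k f x) volume :=
  (hχ.mul (continuous_moll k hf)).integrable_of_hasCompactSupport hχs.mul_right

theorem moll_eq_zero (k : ℕ) {f : Space d → F} {R : ℝ}
    (hf : ∀ x, R < ‖x‖ → f x = 0) {x : Space d} (hx : R + 1 < ‖x‖) : moll k f x = 0 := by
  refine integral_eq_zero_of_ae (ae_of_all _ fun y => ?_)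
  dsimp only
  by_cases h2 : 1 ≤ ‖x - y‖
  · simp [ker_eq_zero k h2]
  · have : ‖x‖ ≤ ‖x - y‖ + ‖y‖ := by simpa using norm_add_le (x - y) y
    rw [hf y (by linarith), smul_zero]; rfl

theorem norm_moll_le_indicator (k : ℕ) {f : Space d → F} {R c : ℝ} (hR : ∀ x, R < ‖x‖ → f x = 0)
    (hc : ∀ x, ‖f x‖ ≤ c) (x : Space d) :
    ‖moll k f x‖ ≤ (Metric.closedBall (0 : Space d) (R + 1)).indicator (fun _ => c) x := by
  by_cases h : x ∈ Metric.closedBall (0 : Space d) (R + 1)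
  · rw [indicator_of_mem h]; exact norm_moll_le_of_norm_le hc k x
  · rw [indicator_of_notMem h, moll_eq_zero k hR (by simpa using h), norm_zero]

theorem integral_mul_moll_le (k : ℕ) {χ : Space d → ℝ} (hχ : Continuous χ) {R c : ℝ}
    (hR : ∀ x, R < ‖x‖ → χ x = 0) (hc : ∀ x, ‖χ x‖ ≤ c) {f : Space d → ℝ}
    (hf : LocallyIntegrable f volume) (hf0 : ∀ x, 0 ≤ f x) :
    ∫ x, χ x * moll k f x ≤ c * ∫ x in Metric.closedBall (0 : Space d) (R + 1), f x := by
  have hχs : HasCompactSupport χ := HasCompactSupport.of_support_subset_isCompact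
    (isCompact_closedBall (0 : Space d) R) fun x hx => by
      by_contra h; exact hx (hR x (by simpa using h))
  have hfi := hf.integrableOn_isCompact (isCompact_closedBall (0 : Space d) (R + 1))
  rw [integral_mul_moll k hχ hχs hf, ← integral_const_mul,
    ← integral_indicator measurableSet_closedBall]
  have hle : ∀ y, ‖moll k χ y * f y‖
      ≤ (Metric.closedBall (0 : Space d) (R + 1)).indicator (fun y => c * f y) y := fun y => by
    have := norm_moll_le_indicator k hR hc y
    rw [norm_mul, Real.norm_of_nonneg (hf0 y)]
    refine (mul_le_mul_of_nonneg_right this (hf0 y)).trans (le_of_eq ?_)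
    by_cases h : y ∈ Metric.closedBall (0 : Space d) (R + 1)
    · simp [indicator_of_mem h]
    · simp [indicator_of_notMem h]
  have hi : Integrable ((Metric.closedBall (0 : Space d) (R + 1)).indicator fun y => c * f y)
      volume := (integrable_indicator_iff measurableSet_closedBall).2 (hfi.const_mul c)
  refine (le_abs_self _).trans ((norm_integral_le_of_norm_le hi (ae_of_all _ hle)))

/-- The mollification is moved onto the continuous `χ`, where it converges pointwise with a uniform
bound and support in a fixed ball. -/
theorem tendsto_integral_mul_moll {χ : Space d → ℝ} (hχ : Continuous χ)
    (hχs : HasCompactSupport χ) {f : Space d → ℝ} (hf : LocallyIntegrable f volume) :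
    Tendsto (fun k => ∫ x, χ x * moll k f x) atTop (𝓝 (∫ x, χ x * f x)) := by
  obtain ⟨R, hR⟩ := hχs.isCompact.isBounded.subset_closedBall (0 : Space d)
  have hR' : ∀ x, R < ‖x‖ → χ x = 0 := fun x hx => by
    by_contra h
    have := hR (subset_tsupport _ h)
    rw [mem_closedBall_zero_iff] at this
    linarith
  obtain ⟨c, hc⟩ := hχ.bounded_above_of_compact_support hχs
  simp_rw [fun k => integral_mul_moll k hχ hχs hf]
  refine tendsto_integral_of_dominated_convergence
    ((Metric.closedBall (0 : Space d) (R + 1)).indicator fun y => c * ‖f y‖)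
    (fun k => (continuous_moll k hχ.locallyIntegrable).aestronglyMeasurable.mul
      hf.aestronglyMeasurable) ?_ (fun k => ae_of_all _ fun y => ?_) (ae_of_all _ fun y => ?_)
  · exact (integrable_indicator_iff measurableSet_closedBall).2
      ((hf.integrableOn_isCompact (isCompact_closedBall _ _)).norm.const_mul c)
  · have := norm_moll_le_indicator k hR' hc y
    rw [norm_mul]
    refine (mul_le_mul_of_nonneg_right this (norm_nonneg _)).trans (le_of_eq ?_)
    by_cases h : y ∈ Metric.closedBall (0 : Space d) (R + 1)
    · simp [indicator_of_mem h]
    · simp [indicator_of_notMem h]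
  · exact (tendsto_moll_of_continuous hχ y).mul_const _

/-- Dominated convergence with mollified dominating functions. -/
theorem tendsto_integral_of_le_moll {χ : Space d → ℝ} (hχ : Continuous χ)
    (hχs : HasCompactSupport χ) {H : Space d → ℝ} (hH : LocallyIntegrable H volume)
    {f : ℕ → Space d → ℝ} {f₀ : Space d → ℝ} (hf : ∀ k, AEStronglyMeasurable (f k) volume)
    (hle : ∀ k x, |f k x| ≤ χ x * moll k H x)
    (hl : ∀ᵐ x, Tendsto (fun k => f k x) atTop (𝓝 (f₀ x))) :
    Tendsto (fun k => ∫ x, f k x) atTop (𝓝 (∫ x, f₀ x)) := by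
  refine tendsto_integral_of_tendsto_dominating hf (fun k => integrable_mul_moll k hχ hχs hH)
    (h := fun x => χ x * H x)
    (hH.integrable_smul_left_of_hasCompactSupport hχ hχs)
    (fun k => ae_of_all _ (hle k)) hl ?_ (tendsto_integral_mul_moll hχ hχs hH)
  filter_upwards [ae_tendsto_moll hH] with x hx using hx.const_mul _

end

/-! ### Gradients, weak gradients and cutoff functions. -/

section

variable {d : ℕ}

theorem locallyIntegrable_continuous_smul {F : Type*} [NormedAddCommGroup F] [NormedSpace ℝ F]
    {c : Space d → ℝ} (hc : Continuous c) {f : Space d → F} (hf : LocallyIntegrable f volume) :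
    LocallyIntegrable (fun x => c x • f x) volume :=
  locallyIntegrable_iff.2 fun _ hK =>
    (hf.integrableOn_isCompact hK).continuousOn_smul hc.continuousOn hK

theorem locallyIntegrable_smul_continuous {F : Type*} [NormedAddCommGroup F] [NormedSpace ℝ F]
    {c : Space d → F} (hc : Continuous c) {f : Space d → ℝ} (hf : LocallyIntegrable f volume) :
    LocallyIntegrable (fun x => f x • c x) volume :=
  locallyIntegrable_iff.2 fun _ hK =>
    (hf.integrableOn_isCompact hK).smul_continuousOn hc.continuousOn hK

theorem continuous_gradient {f : Space d → ℝ} (hf : ContDiff ℝ 1 f) : Continuous (gradient f) :=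
  (InnerProductSpace.toDual ℝ (Space d)).symm.continuous.comp (hf.continuous_fderiv one_ne_zero)

theorem hasGradientAt_of_contDiff {f : Space d → ℝ} (hf : ContDiff ℝ 1 f) (x : Space d) :
    HasGradientAt f (gradient f x) x := (hf.differentiable one_ne_zero x).hasGradientAt

theorem hasCompactSupport_gradient {f : Space d → ℝ} (hf : HasCompactSupport f) :
    HasCompactSupport (gradient f) :=
  (hf.fderiv ℝ).comp_left (g := (InnerProductSpace.toDual ℝ (Space d)).symm) (map_zero _)

theorem hasCompactSupport_smul_gradient {a f : Space d → ℝ} (hf : HasCompactSupport f) :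
    HasCompactSupport (fun x => a x • gradient f x) :=
  HasCompactSupport.smul_left (f := a) (hasCompactSupport_gradient hf)

theorem hasGradientAt_mul {f g : Space d → ℝ} {f' g' x : Space d} (hf : HasGradientAt f f' x)
    (hg : HasGradientAt g g' x) :
    HasGradientAt (fun y => f y * g y) (f x • g' + g x • f') x := by
  rw [hasGradientAt_iff_hasFDerivAt] at *
  exact (hf.mul hg).congr_fderiv (by ext v; simp)

theorem hasGradientAt_comp {f : Space d → ℝ} {f' x : Space d} {U : ℝ → ℝ} {u : ℝ}
    (hU : HasDerivAt U u (f x)) (hf : HasGradientAt f f' x) :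
    HasGradientAt (fun y => U (f y)) (u • f') x := by
  rw [hasGradientAt_iff_hasFDerivAt] at *
  exact (hU.comp_hasFDerivAt x hf).congr_fderiv (by ext v; simp)

theorem hasGradientAt_comp_sub {f : Space d → ℝ} (hf : ContDiff ℝ 1 f) (x y : Space d) :
    HasGradientAt (fun z => f (x - z)) (-gradient f (x - y)) y := by
  have h := hasGradientAt_of_contDiff hf (x - y)
  rw [hasGradientAt_iff_hasFDerivAt] at *
  have h2 := h.comp y ((hasFDerivAt_id y).const_sub x)
  refine h2.congr_fderiv ?_
  ext v; simp

theorem integral_smul_gradient {f φ : Space d → ℝ} (hf : ContDiff ℝ 1 f) (hφ : ContDiff ℝ 1 φ)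
    (hφs : HasCompactSupport φ) :
    ∫ x, f x • gradient φ x = -∫ x, φ x • gradient f x := by
  have i1 : Integrable (fun x => f x • gradient φ x) volume :=
    (hf.continuous.smul (continuous_gradient hφ)).integrable_of_hasCompactSupport
      (hasCompactSupport_smul_gradient hφs)
  have i2 : Integrable (fun x => φ x • gradient f x) volume :=
    (hφ.continuous.smul (continuous_gradient hf)).integrable_of_hasCompactSupport hφs.smul_right
  -- Pairing with a fixed vector reduces to the scalar integration by parts in direction `v`.
  refine ext_inner_left ℝ fun v => ?_
  rw [inner_neg_right, ← integral_inner i1, ← integral_inner i2]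
  have j1 := i1.const_inner (𝕜 := ℝ) v
  have j2 := i2.const_inner (𝕜 := ℝ) v
  have j3 : Integrable (fun x => f x * φ x) volume :=
    (hf.continuous.mul hφ.continuous).integrable_of_hasCompactSupport hφs.mul_left
  simp only [inner_smul_right, inner_gradient_right, conj_trivial] at j1 j2 ⊢
  rw [integral_mul_fderiv_eq_neg_fderiv_mul_of_integrable (by simpa [mul_comm] using j2) j1 j3
    (fun x _ => hf.differentiable one_ne_zero x) (fun x _ => hφ.differentiable one_ne_zero x)]
  simp_rw [mul_comm (φ _)]

theorem hasGradientAt_moll (k : ℕ) {f : Space d → ℝ} (hf : LocallyIntegrable f volume)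
    (x : Space d) :
    HasGradientAt (moll k f) (∫ y, f y • gradient (ker d k) (x - y)) x := by
  have h := (hasCompactSupport_ker (d := d) k).hasFDerivAt_convolution_left
    (ContinuousLinearMap.lsmul ℝ ℝ) (contDiff_ker (n := 1) k) hf x
  rw [← moll_eq_convolution] at h
  rw [hasGradientAt_iff_hasFDerivAt]
  refine h.congr_fderiv ?_
  have hi : Integrable (fun y => f y • gradient (ker d k) (x - y)) volume :=
    hf.integrable_smul_right_of_hasCompactSupport
      ((continuous_gradient (contDiff_ker (n := 1) k)).comp (by fun_prop))
      (hasCompactSupport_comp_sub (hasCompactSupport_gradient (hasCompactSupport_ker k)) x)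
  have hi2 := ((hasCompactSupport_ker (d := d) k).fderiv ℝ).convolutionExists_left
    (ContinuousLinearMap.precompL (Space d) (ContinuousLinearMap.lsmul ℝ ℝ))
    ((contDiff_ker (n := 1) k).continuous_fderiv one_ne_zero) hf x
  ext v
  rw [convolution_eq_swap, ContinuousLinearMap.integral_apply hi2.integrable_swap,
    InnerProductSpace.toDual_apply_apply, real_inner_comm, ← integral_inner hi]
  refine integral_congr_ae (ae_of_all _ fun y => ?_)
  simp [inner_smul_right, inner_gradient_right, mul_comm]

theorem ContDiff.hasWeakGradient {f : Space d → ℝ} (hf : ContDiff ℝ 1 f) :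
    HasWeakGradient f (gradient f) :=
  ⟨hf.continuous.locallyIntegrable, (continuous_gradient hf).locallyIntegrable,
    fun _ hφ hφs => integral_smul_gradient hf (hφ.of_le (by simp)) hφs⟩

/-- Mollification commutes with weak differentiation. -/
theorem HasWeakGradient.hasGradientAt_moll {f : Space d → ℝ} {g : Space d → Space d}
    (h : HasWeakGradient f g) (k : ℕ) (x : Space d) :
    HasGradientAt (moll k f) (moll k g x) x := by
  have h1 := ChiSquaredFlow.hasGradientAt_moll k h.locallyIntegrable_fun x
  -- The translated and reflected kernel serves as test function; the sign from the reflection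
  -- cancels the sign in the weak formulation.
  have h2 := h.integral_eq (fun y => ker d k (x - y))
    ((contDiff_ker (n := ⊤) k).comp (by fun_prop))
    (hasCompactSupport_comp_sub (hasCompactSupport_ker k) x)
  have e : ∀ y, gradient (fun y => ker d k (x - y)) y = -gradient (ker d k) (x - y) := fun y =>
    (hasGradientAt_comp_sub (contDiff_ker (n := 1) k) x y).gradient
  simp only [e, smul_neg, integral_neg, neg_inj] at h2
  rw [h2] at h1
  exact h1

theorem contDiff_one_moll (k : ℕ) {f : Space d → ℝ} (hf : LocallyIntegrable f volume) :
    ContDiff ℝ 1 (moll k f) := contDiff_moll (n := 1) k hf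

theorem exists_eq_zero_of_hasCompactSupport {F : Type*} [Zero F] {f : Space d → F}
    (hf : HasCompactSupport f) : ∃ R, ∀ x, R < ‖x‖ → f x = 0 := by
  obtain ⟨R, hR⟩ := hf.isCompact.isBounded.subset_closedBall (0 : Space d)
  refine ⟨R, fun x hx => ?_⟩
  by_contra h
  have := hR (subset_tsupport _ h)
  rw [mem_closedBall_zero_iff] at this
  linarith

theorem hasCompactSupport_of_eq_zero {F : Type*} [Zero F] {f : Space d → F} {R : ℝ}
    (hf : ∀ x, R < ‖x‖ → f x = 0) : HasCompactSupport f :=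
  HasCompactSupport.of_support_subset_isCompact (isCompact_closedBall (0 : Space d) R)
    fun x hx => by by_contra h; exact hx (hf x (by simpa using h))

theorem tendsto_integral_smul_moll {F : Type*} [NormedAddCommGroup F] [NormedSpace ℝ F]
    [CompleteSpace F] {f : Space d → ℝ} (hf : LocallyIntegrable f volume)
    {q : Space d → F} (hq : Continuous q) (hqs : HasCompactSupport q) :
    Tendsto (fun k => ∫ x, f x • moll k q x) atTop (𝓝 (∫ x, f x • q x)) := by
  obtain ⟨R, hR⟩ := exists_eq_zero_of_hasCompactSupport hqs
  obtain ⟨c, hc⟩ := hq.bounded_above_of_compact_support hqs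
  refine tendsto_integral_of_dominated_convergence
    ((Metric.closedBall (0 : Space d) (R + 1)).indicator fun y => ‖f y‖ * c)
    (fun k => hf.aestronglyMeasurable.smul
      (continuous_moll k hq.locallyIntegrable).aestronglyMeasurable) ?_
      (fun k => ae_of_all _ fun y => ?_) (ae_of_all _ fun y => ?_)
  · exact (integrable_indicator_iff measurableSet_closedBall).2
      ((hf.integrableOn_isCompact (isCompact_closedBall _ _)).norm.mul_const c)
  · rw [norm_smul]
    refine (mul_le_mul_of_nonneg_left (norm_moll_le_indicator k hR hc y) (norm_nonneg _)).trans
      (le_of_eq ?_)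
    by_cases h : y ∈ Metric.closedBall (0 : Space d) (R + 1)
    · simp [indicator_of_mem h]
    · simp [indicator_of_notMem h]
  · exact (tendsto_moll_of_continuous hq y).const_smul _

theorem tendsto_integral_moll_smul {F : Type*} [NormedAddCommGroup F] [NormedSpace ℝ F]
    {f : Space d → F} (hf : LocallyIntegrable f volume)
    {q : Space d → ℝ} (hq : Continuous q) (hqs : HasCompactSupport q) :
    Tendsto (fun k => ∫ x, moll k q x • f x) atTop (𝓝 (∫ x, q x • f x)) := by
  obtain ⟨R, hR⟩ := exists_eq_zero_of_hasCompactSupport hqs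
  obtain ⟨c, hc⟩ := hq.bounded_above_of_compact_support hqs
  refine tendsto_integral_of_dominated_convergence
    ((Metric.closedBall (0 : Space d) (R + 1)).indicator fun y => c * ‖f y‖)
    (fun k => (continuous_moll k hq.locallyIntegrable).aestronglyMeasurable.smul
      hf.aestronglyMeasurable) ?_
      (fun k => ae_of_all _ fun y => ?_) (ae_of_all _ fun y => ?_)
  · exact (integrable_indicator_iff measurableSet_closedBall).2
      ((hf.integrableOn_isCompact (isCompact_closedBall _ _)).norm.const_mul c)
  · rw [norm_smul]
    refine (mul_le_mul_of_nonneg_right (norm_moll_le_indicator k hR hc y) (norm_nonneg _)).trans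
      (le_of_eq ?_)
    by_cases h : y ∈ Metric.closedBall (0 : Space d) (R + 1)
    · simp [indicator_of_mem h]
    · simp [indicator_of_notMem h]
  · exact (tendsto_moll_of_continuous hq y).smul_const _

/-- A weak gradient may be tested against compactly supported functions of class `C¹`. -/
theorem HasWeakGradient.integral_eq_of_contDiff_one {f : Space d → ℝ} {g : Space d → Space d}
    (h : HasWeakGradient f g) {φ : Space d → ℝ} (hφ : ContDiff ℝ 1 φ)
    (hφs : HasCompactSupport φ) :
    ∫ x, f x • gradient φ x = -∫ x, φ x • g x := by
  obtain ⟨R, hR⟩ := exists_eq_zero_of_hasCompactSupport hφs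
  -- A mollified `C¹` function is an admissible smooth test function, and its gradient is the
  -- mollified gradient.
  have hk : ∀ k, ∫ x, f x • moll k (gradient φ) x = -∫ x, moll k φ x • g x := fun k => by
    rw [← h.integral_eq (moll k φ) (contDiff_moll (n := ⊤) k hφ.continuous.locallyIntegrable)
      (hasCompactSupport_of_eq_zero fun x hx => moll_eq_zero k hR hx)]
    refine integral_congr_ae (ae_of_all _ fun x => ?_)
    dsimp only
    rw [((ContDiff.hasWeakGradient hφ).hasGradientAt_moll k x).gradient]
  refine tendsto_nhds_unique (tendsto_integral_smul_moll h.locallyIntegrable_fun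
    (continuous_gradient hφ) (hasCompactSupport_gradient hφs)) ?_
  simp_rw [hk]
  exact (tendsto_integral_moll_smul h.locallyIntegrable_grad hφ.continuous hφs).neg

/-- Leibniz rule for a weakly differentiable function and a `C¹` function. -/
theorem HasWeakGradient.mul_contDiff_one {f : Space d → ℝ} {g : Space d → Space d}
    (h : HasWeakGradient f g) {w : Space d → ℝ} (hw : ContDiff ℝ 1 w) :
    HasWeakGradient (fun x => w x * f x) (fun x => w x • g x + f x • gradient w x) := by
  have l1 : LocallyIntegrable (fun x => w x * f x) volume :=
    locallyIntegrable_continuous_smul hw.continuous h.locallyIntegrable_fun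
  have l2 := locallyIntegrable_continuous_smul hw.continuous h.locallyIntegrable_grad
  have l3 := locallyIntegrable_smul_continuous (continuous_gradient hw) h.locallyIntegrable_fun
  refine ⟨l1, l2.add l3, fun φ hφ hφs => ?_⟩
  have hφ1 : ContDiff ℝ 1 φ := hφ.of_le (by simp)
  have hq : ContDiff ℝ 1 (fun x => w x * φ x) := hw.mul hφ1
  have hqs : HasCompactSupport (fun x => w x * φ x) := hφs.mul_left
  -- The test function is `w φ`. As `w` is only `C¹`, smooth test functions would not suffice here.
  have h1 := h.integral_eq_of_contDiff_one hq hqs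
  have e : ∀ x, gradient (fun x => w x * φ x) x = w x • gradient φ x + φ x • gradient w x :=
    fun x => (hasGradientAt_mul (hasGradientAt_of_contDiff hw x)
      (hasGradientAt_of_contDiff hφ1 x)).gradient
  have c1 : Continuous (fun x => w x • gradient φ x) :=
    hw.continuous.smul (continuous_gradient hφ1)
  have c2 : HasCompactSupport (fun x => w x • gradient φ x) :=
    hasCompactSupport_smul_gradient hφs
  have i1 : Integrable (fun x => f x • (w x • gradient φ x)) volume :=
    h.locallyIntegrable_fun.integrable_smul_right_of_hasCompactSupport c1 c2
  have i2 : Integrable (fun x => f x • (φ x • gradient w x)) volume :=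
    h.locallyIntegrable_fun.integrable_smul_right_of_hasCompactSupport
      (hφ.continuous.smul (continuous_gradient hw)) hφs.smul_right
  have i3 : Integrable (fun x => (w x * φ x) • g x) volume :=
    h.locallyIntegrable_grad.integrable_smul_left_of_hasCompactSupport hq.continuous hqs
  have e1 : ∫ x, f x • gradient (fun x => w x * φ x) x
      = ∫ x, (f x • (w x • gradient φ x) + f x • (φ x • gradient w x)) :=
    integral_congr_ae (ae_of_all _ fun x => by dsimp only; rw [e, smul_add])
  have e2 : ∫ x, φ x • (w x • g x + f x • gradient w x)
      = ∫ x, ((w x * φ x) • g x + f x • (φ x • gradient w x)) :=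
    integral_congr_ae (ae_of_all _ fun x => by
      dsimp only
      rw [smul_add, smul_smul, mul_comm (φ x) (w x), smul_comm (φ x) (f x)])
  have e3 : ∫ x, (w x * f x) • gradient φ x = ∫ x, f x • (w x • gradient φ x) :=
    integral_congr_ae (ae_of_all _ fun x => by dsimp only; rw [smul_smul, mul_comm (w x)])
  rw [e1, integral_add i1 i2] at h1
  rw [e2, e3, integral_add i3 i2, neg_add, ← h1, add_neg_cancel_right]

/-- Smooth cutoff functions exhausting the space, with gradients of order `1 / n`. -/
theorem exists_cutoff (d : ℕ) : ∃ (φ : ℕ → Space d → ℝ) (c : ℝ), (∀ n, ContDiff ℝ ∞ (φ n)) ∧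
    (∀ n, HasCompactSupport (φ n)) ∧ (∀ n x, 0 ≤ φ n x) ∧ (∀ n x, φ n x ≤ 1) ∧
    (∀ x, Tendsto (fun n => φ n x) atTop (𝓝 1)) ∧
    ∀ n x, ‖gradient (φ n) x‖ ≤ c / (n + 1) := by
  let χ : ContDiffBump (0 : Space d) := ⟨1, 2, one_pos, one_lt_two⟩
  have hχ1 : ContDiff ℝ 1 χ := χ.contDiff
  obtain ⟨c, hc⟩ := (continuous_gradient hχ1).bounded_above_of_compact_support
    (hasCompactSupport_gradient χ.hasCompactSupport)
  have hn : ∀ n : ℕ, ((n : ℝ) + 1)⁻¹ ≠ 0 := fun n => by positivity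
  -- All cutoffs are dilates of one bump function, so the chain rule gives the factor `1 / (n + 1)`
  -- in the gradient.
  refine ⟨fun n x => χ (((n : ℝ) + 1)⁻¹ • x), c, fun n => ?_, fun n => ?_, fun n x => χ.nonneg,
    fun n x => χ.le_one, fun x => ?_, fun n x => ?_⟩
  · exact χ.contDiff.comp (by fun_prop)
  · exact χ.hasCompactSupport.comp_smul (hn n)
  · have h1 : Tendsto (fun n : ℕ => ((n : ℝ) + 1)⁻¹ • x) atTop (𝓝 ((0 : ℝ) • x)) :=
      (tendsto_one_div_add_atTop_nhds_zero_nat.congr fun n => one_div _).smul_const x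
    have h2 := (χ.continuous.tendsto _).comp h1
    rw [zero_smul, χ.one_of_mem_closedBall (by simp [χ.rIn_pos.le])] at h2
    exact h2
  · have h := hasGradientAt_of_contDiff hχ1 (((n : ℝ) + 1)⁻¹ • x)
    have h2 : HasGradientAt (fun y => χ (((n : ℝ) + 1)⁻¹ • y))
        (((n : ℝ) + 1)⁻¹ • gradient χ (((n : ℝ) + 1)⁻¹ • x)) x := by
      rw [hasGradientAt_iff_hasFDerivAt] at h ⊢
      have h3 : HasFDerivAt (fun y : Space d => ((n : ℝ) + 1)⁻¹ • y)
          (((n : ℝ) + 1)⁻¹ • ContinuousLinearMap.id ℝ (Space d)) x :=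
        HasFDerivAt.fun_const_smul (hasFDerivAt_id x) _
      refine (h.comp x h3).congr_fderiv ?_
      ext v; simp
    rw [h2.gradient, norm_smul, Real.norm_of_nonneg (by positivity), div_eq_inv_mul]
    exact mul_le_mul_of_nonneg_left (hc _) (by positivity)

end

/-! ### Weighted measures and the Poincaré inequality for truncated Sobolev functions. -/

section

/-- The measure with Lebesgue density `w`. -/
noncomputable def weighted {d : ℕ} (w : Space d → ℝ) : Measure (Space d) :=
  volume.withDensity fun x => ENNReal.ofReal (w x)

variable {d : ℕ} {w : Space d → ℝ}

theorem lintegral_weighted (hw : Continuous w) (f : Space d → ℝ≥0∞) :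
    ∫⁻ x, f x ∂(weighted w) = ∫⁻ x, ENNReal.ofReal (w x) * f x := by
  rw [weighted, lintegral_withDensity_eq_lintegral_mul_non_measurable _
    hw.measurable.ennreal_ofReal (ae_of_all _ fun x => ENNReal.ofReal_lt_top)]
  rfl

theorem weighted_eq_withDensity_toNNReal :
    weighted w = volume.withDensity fun x => ((w x).toNNReal : ℝ≥0∞) := rfl

theorem integral_weighted {F : Type*} [NormedAddCommGroup F] [NormedSpace ℝ F]
    (hw : Continuous w) (hpos : ∀ x, 0 < w x) (f : Space d → F) :
    ∫ x, f x ∂(weighted w) = ∫ x, w x • f x := by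
  rw [weighted_eq_withDensity_toNNReal,
    integral_withDensity_eq_integral_smul hw.measurable.real_toNNReal]
  refine integral_congr_ae (ae_of_all _ fun x => ?_)
  simp only [NNReal.smul_def, Real.coe_toNNReal _ (hpos x).le]

theorem integrable_weighted_iff {F : Type*} [NormedAddCommGroup F] [NormedSpace ℝ F]
    (hw : Continuous w) (hpos : ∀ x, 0 < w x) (f : Space d → F) :
    Integrable f (weighted w) ↔ Integrable (fun x => w x • f x) volume := by
  rw [weighted_eq_withDensity_toNNReal,
    integrable_withDensity_iff_integrable_smul hw.measurable.real_toNNReal]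
  simp only [NNReal.smul_def, Real.coe_toNNReal _ (hpos _).le]

theorem weighted_absolutelyContinuous : weighted w ≪ (volume : Measure (Space d)) :=
  withDensity_absolutelyContinuous _ _

/-- The reciprocal of a positive continuous weight is locally bounded. -/
theorem locallyIntegrable_of_integrable_weighted {F : Type*} [NormedAddCommGroup F]
    [NormedSpace ℝ F] (hw : Continuous w) (hpos : ∀ x, 0 < w x) {f : Space d → F}
    (hf : Integrable f (weighted w)) : LocallyIntegrable f volume := by
  have h := locallyIntegrable_continuous_smul (hw.inv₀ fun x => (hpos x).ne')
    ((integrable_weighted_iff hw hpos f).1 hf).locallyIntegrable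
  refine h.congr (ae_of_all _ fun x => ?_)
  exact inv_smul_smul₀ (hpos x).ne' _

/-- Fatou's lemma for variances. The centre `m` is the limit of the means and need not be known to
be the mean of `Y`, so `Y` need not be integrable. -/
theorem lintegral_sq_sub_le_of_tendsto {π : Measure (Space d)} {X : ℕ → Space d → ℝ}
    {Y : Space d → ℝ} {m : ℝ} {b : ℕ → ℝ≥0∞} {b₀ : ℝ≥0∞}
    (hX : ∀ k, AEMeasurable (X k) π)
    (hXY : ∀ᵐ x ∂π, Tendsto (fun k => X k x) atTop (𝓝 (Y x)))
    (hm : Tendsto (fun k => ∫ x, X k x ∂π) atTop (𝓝 m)) (hb : Tendsto b atTop (𝓝 b₀))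
    (hle : ∀ k, evariance (X k) π ≤ b k) : ∫⁻ x, ‖Y x - m‖ₑ ^ 2 ∂π ≤ b₀ := by
  calc ∫⁻ x, ‖Y x - m‖ₑ ^ 2 ∂π
      = ∫⁻ x, liminf (fun k => ‖X k x - ∫ y, X k y ∂π‖ₑ ^ 2) atTop ∂π := by
        refine lintegral_congr_ae ?_
        filter_upwards [hXY] with x hx
        have h1 := ((hx.sub hm).enorm)
        exact (((ENNReal.continuous_pow 2).tendsto _).comp h1).liminf_eq.symm
    _ ≤ liminf (fun k => ∫⁻ x, ‖X k x - ∫ y, X k y ∂π‖ₑ ^ 2 ∂π) atTop :=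
        lintegral_liminf_le' fun k => ((hX k).sub_const _).enorm.pow_const 2
    _ ≤ liminf b atTop := liminf_le_liminf (Eventually.of_forall hle)
    _ = b₀ := hb.liminf_eq

theorem enorm_sq_eq_ofReal {F : Type*} [NormedAddCommGroup F] (x : F) :
    ‖x‖ₑ ^ 2 = ENNReal.ofReal (‖x‖ ^ 2) := by
  rw [ENNReal.ofReal_pow (norm_nonneg _), ofReal_norm]

theorem lintegral_enorm_sq_weighted {F : Type*} [NormedAddCommGroup F]
    (hw : Continuous w) (hpos : ∀ x, 0 < w x) {G : Space d → F}
    (hi : Integrable (fun x => w x * ‖G x‖ ^ 2) volume) :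
    ∫⁻ x, ‖G x‖ₑ ^ 2 ∂(weighted w) = ENNReal.ofReal (∫ x, w x * ‖G x‖ ^ 2) := by
  rw [lintegral_weighted hw, ofReal_integral_eq_lintegral_ofReal hi
    (ae_of_all _ fun x => mul_nonneg (hpos x).le (sq_nonneg _))]
  refine lintegral_congr fun x => ?_
  rw [enorm_sq_eq_ofReal, ENNReal.ofReal_mul (hpos x).le]

theorem norm_add_sq_le_two {F : Type*} [NormedAddCommGroup F] (x y : F) :
    ‖x + y‖ ^ 2 ≤ 2 * ‖x‖ ^ 2 + 2 * ‖y‖ ^ 2 := by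
  nlinarith [norm_add_le x y, norm_nonneg (x + y), norm_nonneg x, norm_nonneg y,
    sq_nonneg (‖x‖ - ‖y‖)]

/-- The Poincaré inequality for a truncated and localised Sobolev function. -/
theorem PoincareInequality.lintegral_mul_comp_le {C : ℝ} (hw : Continuous w)
    (hpos : ∀ x, 0 < w x) [IsProbabilityMeasure (weighted w)]
    (hP : PoincareInequality (weighted w) C) {ρ : Space d → ℝ} {g : Space d → Space d}
    (hρ : HasWeakGradient ρ g) (hg2 : LocallyIntegrable (fun x => ‖g x‖ ^ 2) volume)
    {β : ℝ → ℝ} (hβ : ContDiff ℝ 1 β) {K B : ℝ} (hK : ∀ r, |deriv β r| ≤ K)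
    (hB : ∀ r, |β r| ≤ B) {φ : Space d → ℝ} (hφ : ContDiff ℝ 1 φ) (hφs : HasCompactSupport φ) :
    evariance (fun x => φ x * β (ρ x)) (weighted w) ≤ ENNReal.ofReal C *
      ∫⁻ x, ‖φ x • (deriv β (ρ x) • g x) + β (ρ x) • gradient φ x‖ₑ ^ 2 ∂(weighted w) := by
  have hβ' : Continuous (deriv β) := hβ.continuous_deriv le_rfl
  set G : ℕ → Space d → Space d := fun k x =>
    φ x • (deriv β (moll k ρ x) • moll k g x) + β (moll k ρ x) • gradient φ x with hG
  set f : ℕ → Space d → ℝ := fun k x => φ x * β (moll k ρ x) with hf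
  have hmc : ∀ k, Continuous (moll k ρ) := fun k => continuous_moll k hρ.locallyIntegrable_fun
  have hgc : ∀ k, Continuous (moll k g) := fun k => continuous_moll k hρ.locallyIntegrable_grad
  have hfd : ∀ k, ContDiff ℝ 1 (f k) := fun k =>
    hφ.mul (hβ.comp (contDiff_one_moll k hρ.locallyIntegrable_fun))
  have hfs : ∀ k, HasCompactSupport (f k) := fun k => hφs.mul_right
  have hgrad : ∀ k x, gradient (f k) x = G k x := fun k x => by
    have h1 := hasGradientAt_comp (hβ.differentiable one_ne_zero (moll k ρ x)).hasDerivAt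
      (hρ.hasGradientAt_moll k x)
    have h2 := hasGradientAt_mul (hasGradientAt_of_contDiff hφ x) h1
    exact h2.gradient
  have hGc : ∀ k, Continuous (G k) := fun k => by
    have h1 := continuous_gradient hφ
    have h2 := hβ'.comp (hmc k)
    have h3 := hβ.continuous.comp (hmc k)
    exact (hφ.continuous.smul (h2.smul (hgc k))).add (h3.smul h1)
  have hcs : HasCompactSupport (gradient φ) := hasCompactSupport_gradient hφs
  -- Since `‖x + y‖² ≤ 2‖x‖² + 2‖y‖²`, the product of `χ` and the mollification of `‖g‖² + 1`
  -- dominates `w ‖G k‖²` for every `k`. The limit needs no uniform bound on the mollified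
  -- gradients.
  set χ : Space d → ℝ := fun x => w x * (2 * K ^ 2 * φ x ^ 2 + 2 * B ^ 2 * ‖gradient φ x‖ ^ 2)
    with hχ
  have hχc : Continuous χ := by
    have := continuous_gradient hφ
    have := hφ.continuous
    fun_prop
  have hχs : HasCompactSupport χ := by
    obtain ⟨R, hR⟩ := exists_eq_zero_of_hasCompactSupport hφs
    obtain ⟨R', hR'⟩ := exists_eq_zero_of_hasCompactSupport hcs
    refine hasCompactSupport_of_eq_zero (R := max R R') fun x hx => ?_
    simp [hχ, hR x ((le_max_left _ _).trans_lt hx), hR' x ((le_max_right _ _).trans_lt hx)]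
  have hH : LocallyIntegrable (fun x => ‖g x‖ ^ 2 + 1) volume := hg2.add (locallyIntegrable_const 1)
  have hbound : ∀ (a b u : ℝ) (x : Space d) (v : Space d), |a| ≤ K → |b| ≤ B → ‖v‖ ^ 2 ≤ u →
      w x * ‖φ x • (a • v) + b • gradient φ x‖ ^ 2 ≤ χ x * (u + 1) := fun a b u x v ha hb hv => by
    have h1 := norm_add_sq_le_two (φ x • (a • v)) (b • gradient φ x)
    rw [norm_smul, norm_smul, norm_smul, Real.norm_eq_abs, Real.norm_eq_abs, Real.norm_eq_abs,
      mul_pow, mul_pow, mul_pow, sq_abs (φ x)] at h1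
    have h2 : |a| ^ 2 ≤ K ^ 2 := pow_le_pow_left₀ (abs_nonneg _) ha 2
    have h3 : |b| ^ 2 ≤ B ^ 2 := pow_le_pow_left₀ (abs_nonneg _) hb 2
    have h4 : |a| ^ 2 * ‖v‖ ^ 2 ≤ K ^ 2 * u :=
      mul_le_mul h2 hv (sq_nonneg _) (sq_nonneg _)
    have hu : 0 ≤ u := (sq_nonneg _).trans hv
    have h5 : φ x ^ 2 * (|a| ^ 2 * ‖v‖ ^ 2) ≤ φ x ^ 2 * (K ^ 2 * u) :=
      mul_le_mul_of_nonneg_left h4 (sq_nonneg _)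
    have h6 : |b| ^ 2 * ‖gradient φ x‖ ^ 2 ≤ B ^ 2 * ‖gradient φ x‖ ^ 2 :=
      mul_le_mul_of_nonneg_right h3 (sq_nonneg _)
    rw [hχ]
    dsimp only
    rw [mul_assoc]
    refine mul_le_mul_of_nonneg_left ?_ (hpos x).le
    have h7 : 0 ≤ K ^ 2 * φ x ^ 2 := by positivity
    have h8 : 0 ≤ B ^ 2 * ‖gradient φ x‖ ^ 2 * u := by positivity
    nlinarith
  have hone : ∀ k x, moll k (fun x => ‖g x‖ ^ 2 + 1) x = moll k (fun x => ‖g x‖ ^ 2) x + 1 :=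
    fun k x => by
      rw [moll_add k hg2 (locallyIntegrable_const 1)]
      simp [moll, integral_ker_sub]
  have hvol : (weighted w) ≪ volume := weighted_absolutelyContinuous
  have hρt := ae_tendsto_moll hρ.locallyIntegrable_fun
  have hgt := ae_tendsto_moll hρ.locallyIntegrable_grad
  have hlim : Tendsto (fun k => ∫ x, w x * ‖G k x‖ ^ 2) atTop
      (𝓝 (∫ x, w x * ‖φ x • (deriv β (ρ x) • g x) + β (ρ x) • gradient φ x‖ ^ 2)) := by
    refine tendsto_integral_of_le_moll hχc hχs hH
      (fun k => (hw.mul ((hGc k).norm.pow 2)).aestronglyMeasurable) (fun k x => ?_) ?_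
    · rw [abs_of_nonneg (mul_nonneg (hpos x).le (sq_nonneg _)), hone]
      exact hbound _ _ _ _ _ (hK _) (hB _) (sq_norm_moll_le k hρ.locallyIntegrable_grad hg2 x)
    · filter_upwards [hρt, hgt] with x h1 h2
      have h3 := ((hβ'.tendsto _).comp h1).smul h2
      have h4 := (hβ.continuous.tendsto _).comp h1
      exact (((h3.const_smul (φ x)).add (h4.smul_const _)).norm.pow 2).const_mul _
  have hfin : Integrable (fun x => w x * ‖φ x • (deriv β (ρ x) • g x)
      + β (ρ x) • gradient φ x‖ ^ 2) volume := by
    refine (hH.integrable_smul_left_of_hasCompactSupport hχc hχs).mono' ?_ (ae_of_all _ fun x => ?_)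
    · have h1 := hρ.locallyIntegrable_fun.aestronglyMeasurable
      have h2 := hρ.locallyIntegrable_grad.aestronglyMeasurable
      have h3 := hβ'.comp_aestronglyMeasurable h1
      have h4 := hβ.continuous.comp_aestronglyMeasurable h1
      exact hw.aestronglyMeasurable.mul (((hφ.continuous.aestronglyMeasurable.smul
        (h3.smul h2)).add (h4.smul (continuous_gradient hφ).aestronglyMeasurable)).norm.pow 2)
    · rw [Real.norm_of_nonneg (mul_nonneg (hpos x).le (sq_nonneg _))]
      exact hbound _ _ _ _ _ (hK _) (hB _) le_rfl
  have hci : ∀ k, Integrable (fun x => w x * ‖G k x‖ ^ 2) volume := fun k => by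
    refine (hw.mul ((hGc k).norm.pow 2)).integrable_of_hasCompactSupport ?_
    obtain ⟨R, hR⟩ := exists_eq_zero_of_hasCompactSupport hφs
    obtain ⟨R', hR'⟩ := exists_eq_zero_of_hasCompactSupport hcs
    refine hasCompactSupport_of_eq_zero (R := max R R') fun x hx => ?_
    simp [hG, hR x ((le_max_left _ _).trans_lt hx), hR' x ((le_max_right _ _).trans_lt hx)]
  obtain ⟨c, hc⟩ := hφ.continuous.bounded_above_of_compact_support hφs
  rw [evariance]
  refine lintegral_sq_sub_le_of_tendsto (X := f)
    (b := fun k => ENNReal.ofReal C * ∫⁻ x, ‖G k x‖ₑ ^ 2 ∂(weighted w))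
    (fun k => (hfd k).continuous.aemeasurable) ?_ ?_ ?_ (fun k => ?_)
  · refine hvol.ae_le ?_
    filter_upwards [hρt] with x h1
    exact ((hβ.continuous.tendsto _).comp h1).const_mul _
  · refine tendsto_integral_of_dominated_convergence (fun _ => c * B)
      (fun k => (hfd k).continuous.aestronglyMeasurable) (integrable_const _)
      (fun k => ae_of_all _ fun x => ?_) ?_
    · rw [norm_mul]
      exact mul_le_mul (hc x) (hB _) (norm_nonneg _) ((norm_nonneg _).trans (hc x))
    · refine hvol.ae_le ?_
      filter_upwards [hρt] with x h1
      exact ((hβ.continuous.tendsto _).comp h1).const_mul _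
  · rw [lintegral_enorm_sq_weighted hw hpos hfin]
    simp_rw [fun k => lintegral_enorm_sq_weighted hw hpos (hci k)]
    exact ENNReal.Tendsto.const_mul (ENNReal.tendsto_ofReal hlim) (Or.inr ENNReal.ofReal_ne_top)
  -- The hypothesis is applied only to `C¹` functions with compact support, which are locally
  -- Lipschitz and square integrable.
  · have := hP (f k) (hfd k).locallyLipschitz
      ((hfd k).continuous.memLp_of_hasCompactSupport (hfs k))
    simpa only [hgrad] using this

end

/-! ### Flat truncations and the Poincaré inequality with energy on `{ρ ≠ 0}`. -/

section

/-- A bounded smooth approximation of the identity function which is flat at the origin. -/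
noncomputable def flatTrunc (n : ℕ) (r : ℝ) : ℝ :=
  r ^ 3 / (r ^ 2 + 1 / (n + 1) + 1 / (n + 1) * r ^ 4)

theorem flatTrunc_den_pos (n : ℕ) (r : ℝ) :
    0 < r ^ 2 + 1 / ((n : ℝ) + 1) + 1 / (n + 1) * r ^ 4 := by positivity

theorem contDiff_flatTrunc (n : ℕ) : ContDiff ℝ 1 (flatTrunc n) :=
  ContDiff.div (by fun_prop) (by fun_prop) fun r => (flatTrunc_den_pos n r).ne'

theorem deriv_flatTrunc (n : ℕ) (r : ℝ) : deriv (flatTrunc n) r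
    = (r ^ 4 + 3 * (1 / ((n : ℝ) + 1)) * r ^ 2 - 1 / (n + 1) * r ^ 6)
      / (r ^ 2 + 1 / ((n : ℝ) + 1) + 1 / (n + 1) * r ^ 4) ^ 2 := by
  have h1 : HasDerivAt (fun r : ℝ => r ^ 3) (3 * r ^ 2) r := by simpa using hasDerivAt_pow 3 r
  have h2 : HasDerivAt (fun r : ℝ => r ^ 2 + 1 / ((n : ℝ) + 1) + 1 / (n + 1) * r ^ 4)
      (2 * r + 1 / (n + 1) * (4 * r ^ 3)) r := by
    have a := (hasDerivAt_pow 2 r).add_const (1 / ((n : ℝ) + 1))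
    have b := (hasDerivAt_pow 4 r).const_mul (1 / ((n : ℝ) + 1))
    exact (a.add b).congr_deriv (by norm_num)
  have h3 := (h1.div h2 (flatTrunc_den_pos n r).ne').deriv
  have e : flatTrunc n = (fun r : ℝ => r ^ 3) / fun r : ℝ =>
    r ^ 2 + 1 / ((n : ℝ) + 1) + 1 / (n + 1) * r ^ 4 := rfl
  rw [e, h3]
  congr 1
  ring

theorem abs_deriv_flatTrunc_le (n : ℕ) (r : ℝ) : |deriv (flatTrunc n) r| ≤ 3 := by
  rw [deriv_flatTrunc, abs_div, abs_of_pos (pow_pos (flatTrunc_den_pos n r) 2),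
    div_le_iff₀ (pow_pos (flatTrunc_den_pos n r) 2)]
  have he : (0 : ℝ) < 1 / (n + 1) := by positivity
  set e : ℝ := 1 / (n + 1)
  have h0 : 0 ≤ e * r ^ 6 := by positivity
  have h1 : 0 ≤ e * r ^ 2 := by positivity
  have h2 : 0 ≤ r ^ 4 := by positivity
  have h3 : 0 ≤ e * (e * r ^ 4) := by positivity
  have h4 : 0 ≤ (e * r ^ 4) ^ 2 := by positivity
  have key : (r ^ 2 + e + e * r ^ 4) ^ 2 = r ^ 4 + e ^ 2 + (e * r ^ 4) ^ 2 + 2 * (e * r ^ 2)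
      + 2 * (e * r ^ 6) + 2 * (e * (e * r ^ 4)) := by ring
  rw [key, abs_le]
  constructor <;> nlinarith [sq_nonneg e]

theorem abs_flatTrunc_le (n : ℕ) (r : ℝ) : |flatTrunc n r| ≤ |r| := by
  rw [flatTrunc, abs_div, abs_of_pos (flatTrunc_den_pos n r), div_le_iff₀ (flatTrunc_den_pos n r),
    abs_pow]
  have h : |r| ^ 3 = |r| * r ^ 2 := by rw [← sq_abs r]; ring
  rw [h]
  refine mul_le_mul_of_nonneg_left ?_ (abs_nonneg _)
  have : (0 : ℝ) ≤ 1 / (n + 1) + 1 / (n + 1) * r ^ 4 := by positivity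
  linarith

/-- With `s = √(n + 1)`, the arithmetic–geometric mean inequality gives `r² + r⁴ / s² ≥ 2 |r|³ / s`
for the denominator. The growth `√n` is slow enough to be beaten by cutoff gradients of order `1 /
n`. -/
theorem abs_flatTrunc_le_sqrt (n : ℕ) (r : ℝ) : |flatTrunc n r| ≤ √((n : ℝ) + 1) := by
  rw [flatTrunc, abs_div, abs_of_pos (flatTrunc_den_pos n r), div_le_iff₀ (flatTrunc_den_pos n r),
    abs_pow]
  have hs : 0 < √((n : ℝ) + 1) := by positivity
  have hs2 : √((n : ℝ) + 1) ^ 2 = n + 1 := Real.sq_sqrt (by positivity)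
  generalize √((n : ℝ) + 1) = s at hs hs2 ⊢
  rw [← hs2]
  have e : s * (r ^ 2 + 1 / s ^ 2 + 1 / s ^ 2 * r ^ 4) = s * r ^ 2 + 1 / s + r ^ 4 / s := by
    field_simp
  have h : 0 ≤ 1 / s := by positivity
  have h4 : r ^ 4 / s * s = r ^ 4 := div_mul_cancel₀ _ hs.ne'
  have ha : |r| ^ 2 = r ^ 2 := sq_abs r
  have h5 : 0 ≤ r ^ 4 / s := by positivity
  have h6 : 0 ≤ r ^ 2 * (s - |r|) ^ 2 / s := by positivity
  have h7 : r ^ 2 * (s - |r|) ^ 2 / s = s * r ^ 2 - 2 * |r| ^ 3 + r ^ 4 / s := by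
    have : |r| ^ 3 = |r| * r ^ 2 := by rw [← ha]; ring
    rw [this]
    field_simp
    rw [← ha]
    ring
  have h8 : 0 ≤ |r| ^ 3 := by positivity
  rw [e]
  linarith

theorem tendsto_flatTrunc (r : ℝ) : Tendsto (fun n => flatTrunc n r) atTop (𝓝 r) := by
  have h := tendsto_one_div_add_atTop_nhds_zero_nat (𝕜 := ℝ)
  by_cases hr : r = 0
  · simp [hr, flatTrunc]
  have h1 : Tendsto (fun n : ℕ => r ^ 2 + 1 / ((n : ℝ) + 1) + 1 / (n + 1) * r ^ 4) atTop
      (𝓝 (r ^ 2 + 0 + 0 * r ^ 4)) := (h.const_add _).add (h.mul_const _)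
  have h2 := (tendsto_const_nhds (x := r ^ 3)).div h1 (by simpa using hr)
  have e : r ^ 3 / (r ^ 2 + 0 + 0 * r ^ 4) = r := by field_simp; ring
  rwa [e] at h2

/-- The cubic numerator makes every truncation have derivative `0` at the origin. In the limit the
energy is taken over `{ρ ≠ 0}` without any claim on the gradient where `ρ = 0`. -/
theorem tendsto_deriv_flatTrunc (r : ℝ) :
    Tendsto (fun n => deriv (flatTrunc n) r) atTop (𝓝 (if r = 0 then 0 else 1)) := by
  have h := tendsto_one_div_add_atTop_nhds_zero_nat (𝕜 := ℝ)
  simp_rw [deriv_flatTrunc]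
  by_cases hr : r = 0
  · simp [hr]
  have h1 : Tendsto (fun n : ℕ => r ^ 2 + 1 / ((n : ℝ) + 1) + 1 / (n + 1) * r ^ 4) atTop
      (𝓝 (r ^ 2 + 0 + 0 * r ^ 4)) := (h.const_add _).add (h.mul_const _)
  have h2 : Tendsto (fun n : ℕ => r ^ 4 + 3 * (1 / ((n : ℝ) + 1)) * r ^ 2
      - 1 / ((n : ℝ) + 1) * r ^ 6) atTop (𝓝 (r ^ 4 + 3 * 0 * r ^ 2 - 0 * r ^ 6)) :=
    (((h.const_mul 3).mul_const _).const_add _).sub (h.mul_const _)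
  have h3 := h2.div (h1.pow 2) (by simpa using hr)
  have e : (r ^ 4 + 3 * 0 * r ^ 2 - 0 * r ^ 6) / (r ^ 2 + 0 + 0 * r ^ 4) ^ 2 = 1 := by
    field_simp; ring
  rw [e] at h3
  rw [if_neg hr]
  exact h3

variable {d : ℕ} {w : Space d → ℝ}

/-- The Poincaré inequality for a Sobolev probability density, where the energy is only taken
over the set on which the density does not vanish. -/
theorem PoincareInequality.lintegral_sub_one_sq_le {C : ℝ} (hw : Continuous w)
    (hpos : ∀ x, 0 < w x) [IsProbabilityMeasure (weighted w)]
    (hP : PoincareInequality (weighted w) C) {ρ : Space d → ℝ} {g : Space d → Space d}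
    (hρ : HasWeakGradient ρ g) (hρm : Measurable ρ) (hgm : Measurable g)
    (hρi : Integrable ρ (weighted w)) (hρ1 : ∫ x, ρ x ∂(weighted w) = 1)
    (hg2 : ∫⁻ x, ‖g x‖ₑ ^ 2 ∂(weighted w) < ⊤) :
    ∫⁻ x, ‖ρ x - 1‖ₑ ^ 2 ∂(weighted w) ≤ ENNReal.ofReal C *
      ∫⁻ x, (if ρ x = 0 then 0 else ‖g x‖ₑ ^ 2) ∂(weighted w) := by
  obtain ⟨φ, c, hφ, hφs, hφ0, hφ1, hφt, hφg⟩ := exists_cutoff d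
  have hφd : ∀ n, ContDiff ℝ 1 (φ n) := fun n => (hφ n).of_le (by simp)
  have hc0 : 0 ≤ c := by
    have := (norm_nonneg _).trans (hφg 0 0)
    simpa using this
  have hg2i : Integrable (fun x => ‖g x‖ ^ 2) (weighted w) := by
    refine ⟨(hgm.norm.pow_const 2).aestronglyMeasurable, ?_⟩
    rw [hasFiniteIntegral_iff_enorm]
    simpa using hg2
  have hg2l := locallyIntegrable_of_integrable_weighted hw hpos hg2i
  have hβm : ∀ n, Measurable (fun x => flatTrunc n (ρ x)) := fun n =>
    (contDiff_flatTrunc n).continuous.measurable.comp hρm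
  have hβ'm : ∀ n, Measurable (fun x => deriv (flatTrunc n) (ρ x)) := fun n =>
    (measurable_deriv _).comp hρm
  set G : ℕ → Space d → Space d := fun n x =>
    φ n x • (deriv (flatTrunc n) (ρ x) • g x) + flatTrunc n (ρ x) • gradient (φ n) x with hG
  have hGm : ∀ n, Measurable (G n) := fun n =>
    ((hφd n).continuous.measurable.smul ((hβ'm n).smul hgm)).add
      ((hβm n).smul (continuous_gradient (hφd n)).measurable)
  have hdecay : ∀ (n : ℕ) x, ‖flatTrunc n (ρ x) • gradient (φ n) x‖ ≤ c / √((n : ℝ) + 1) :=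
    fun n x => by
    rw [norm_smul, Real.norm_eq_abs]
    refine (mul_le_mul (abs_flatTrunc_le_sqrt n _) (hφg n x) (norm_nonneg _)
      (Real.sqrt_nonneg _)).trans (le_of_eq ?_)
    have hs : 0 < √((n : ℝ) + 1) := by positivity
    nth_rewrite 2 [← Real.sq_sqrt (by positivity : (0 : ℝ) ≤ n + 1)]
    field_simp
  have hsqrt : Tendsto (fun n : ℕ => c / √((n : ℝ) + 1)) atTop (𝓝 0) :=
    tendsto_const_nhds.div_atTop (Real.tendsto_sqrt_atTop.comp
      (tendsto_atTop_add_const_right _ _ tendsto_natCast_atTop_atTop))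
  -- The variables `φ_n · flatTrunc n (ρ)` are bounded and their means tend to `∫ ρ = 1` by
  -- domination by `|ρ|`. Square integrability of `ρ` is thus a conclusion and not an assumption.
  refine lintegral_sq_sub_le_of_tendsto (X := fun n x => φ n x * flatTrunc n (ρ x))
    (b := fun n => ENNReal.ofReal C * ∫⁻ x, ‖G n x‖ₑ ^ 2 ∂(weighted w))
    (fun n => ((hφd n).continuous.measurable.mul (hβm n)).aemeasurable)
    (ae_of_all _ fun x => ?_) ?_ ?_ (fun n => ?_)
  · simpa using (hφt x).mul (tendsto_flatTrunc (ρ x))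
  · rw [← hρ1]
    refine tendsto_integral_of_dominated_convergence (fun x => |ρ x|)
      (fun n => ((hφd n).continuous.measurable.mul (hβm n)).aestronglyMeasurable) hρi.abs
      (fun n => ae_of_all _ fun x => ?_) (ae_of_all _ fun x => ?_)
    · rw [norm_mul, Real.norm_of_nonneg (hφ0 n x), Real.norm_eq_abs]
      exact (mul_le_of_le_one_left (abs_nonneg _) (hφ1 n x)).trans (abs_flatTrunc_le n _)
    · simpa using (hφt x).mul (tendsto_flatTrunc (ρ x))
  · refine ENNReal.Tendsto.const_mul ?_ (Or.inr ENNReal.ofReal_ne_top)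
    -- Here `18 = 2 · 3²`, with `3` the bound on the derivative of the truncation.
    have hbi : Integrable (fun x => 18 * ‖g x‖ ^ 2 + 2 * c ^ 2) (weighted w) :=
      (hg2i.const_mul 18).add (integrable_const _)
    refine tendsto_lintegral_of_dominated_convergence
      (fun x => ENNReal.ofReal (18 * ‖g x‖ ^ 2 + 2 * c ^ 2))
      (fun n => (hGm n).enorm.pow_const 2) (fun n => ae_of_all _ fun x => ?_) ?_
      (ae_of_all _ fun x => ?_)
    · dsimp only
      rw [enorm_sq_eq_ofReal]
      refine ENNReal.ofReal_le_ofReal ?_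
      refine (norm_add_sq_le_two _ _).trans ?_
      have h1 : ‖φ n x • (deriv (flatTrunc n) (ρ x) • g x)‖ ≤ 3 * ‖g x‖ := by
        rw [norm_smul, norm_smul, Real.norm_of_nonneg (hφ0 n x), Real.norm_eq_abs]
        refine (mul_le_of_le_one_left (by positivity) (hφ1 n x)).trans ?_
        exact mul_le_mul_of_nonneg_right (abs_deriv_flatTrunc_le n _) (norm_nonneg _)
      have h2 : ‖flatTrunc n (ρ x) • gradient (φ n) x‖ ≤ c := by
        refine (hdecay n x).trans (div_le_self hc0 ?_)
        rw [Real.one_le_sqrt]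
        linarith [(Nat.cast_nonneg n : (0 : ℝ) ≤ n)]
      have h3 := pow_le_pow_left₀ (norm_nonneg _) h1 2
      have h4 := pow_le_pow_left₀ (norm_nonneg _) h2 2
      nlinarith
    · rw [← ofReal_integral_eq_lintegral_ofReal hbi (ae_of_all _ fun x => by positivity)]
      exact ENNReal.ofReal_ne_top
    · have h1 : Tendsto (fun n => G n x) atTop
          (𝓝 ((1 : ℝ) • ((if ρ x = 0 then (0 : ℝ) else 1) • g x) + 0)) := by
        refine ((hφt x).smul ((tendsto_deriv_flatTrunc (ρ x)).smul_const _)).add ?_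
        exact squeeze_zero_norm (fun n => hdecay n x) hsqrt
      have h2 := ((ENNReal.continuous_pow 2).tendsto _).comp h1.enorm
      have e : (if ρ x = 0 then 0 else ‖g x‖ₑ ^ 2)
          = ‖(1 : ℝ) • ((if ρ x = 0 then (0 : ℝ) else 1) • g x) + 0‖ₑ ^ 2 := by
        by_cases h : ρ x = 0 <;> simp [h]
      rw [e]
      exact h2
  · exact hP.lintegral_mul_comp_le hw hpos hρ hg2l (contDiff_flatTrunc n)
      (abs_deriv_flatTrunc_le n) (abs_flatTrunc_le_sqrt n) (hφd n) (hφs n)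

end

/-! ### Regularised entropies. -/

section

/-- A regularised entropy whose derivative `dent a` is bounded by `log a`. -/
noncomputable def ent (a r : ℝ) : ℝ :=
  (1 + 1 / a) * klFun ((a * r + 1) / (a + 1)) - (a + 1) * klFun ((r + a) / (a + 1))

/-- The derivative of `ent a`. -/
noncomputable def dent (a r : ℝ) : ℝ := Real.log ((a * r + 1) / (r + a))

/-- The second derivative of `ent a`. -/
noncomputable def ddent (a r : ℝ) : ℝ := a / (a * r + 1) - 1 / (r + a)

section

variable {a r : ℝ}

theorem hasDerivAt_ent (ha : 1 ≤ a) (hr : 0 ≤ r) : HasDerivAt (ent a) (dent a r) r := by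
  have h1 : 0 < a * r + 1 := by positivity
  have h2 : 0 < r + a := by positivity
  have h3 : 0 < a + 1 := by positivity
  have e1 : HasDerivAt (fun r => (a * r + 1) / (a + 1)) (a / (a + 1)) r := by
    simpa using (((hasDerivAt_id r).const_mul a).add_const 1).div_const (a + 1)
  have e2 : HasDerivAt (fun r => (r + a) / (a + 1)) (1 / (a + 1)) r := by
    simpa using ((hasDerivAt_id r).add_const a).div_const (a + 1)
  have k1 := (hasDerivAt_klFun (div_pos h1 h3).ne').comp r e1
  have k2 := (hasDerivAt_klFun (div_pos h2 h3).ne').comp r e2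
  refine ((k1.const_mul (1 + 1 / a)).sub (k2.const_mul (a + 1))).congr_deriv ?_
  rw [dent, Real.log_div h1.ne' h2.ne', Real.log_div h1.ne' h3.ne', Real.log_div h2.ne' h3.ne']
  have : a ≠ 0 := by positivity
  field_simp
  ring

theorem hasDerivAt_dent (ha : 1 ≤ a) (hr : 0 ≤ r) : HasDerivAt (dent a) (ddent a r) r := by
  have h1 : 0 < a * r + 1 := by positivity
  have h2 : 0 < r + a := by positivity
  have e1 : HasDerivAt (fun r => a * r + 1) a r := by
    simpa using ((hasDerivAt_id r).const_mul a).add_const 1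
  have e2 : HasDerivAt (fun r => r + a) 1 r := (hasDerivAt_id r).add_const a
  have := (e1.div e2 h2.ne').log (div_pos h1 h2).ne'
  refine this.congr_deriv ?_
  rw [ddent, Pi.div_apply]
  field_simp

theorem measurable_dent : Measurable (dent a) := by unfold dent; fun_prop

theorem measurable_ddent : Measurable (ddent a) := by unfold ddent; fun_prop

/-- The fraction inside the logarithm increases from `1 / a` at `0` to `a` at infinity. The
logarithmic size is what cutoff gradients of order `1 / n` can absorb when `a = n + 1`. -/
theorem abs_dent_le (ha : 1 ≤ a) (hr : 0 ≤ r) : |dent a r| ≤ Real.log a := by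
  have h1 : 0 < a * r + 1 := by positivity
  have h2 : 0 < r + a := by positivity
  have h3 : 0 < a := by positivity
  rw [dent, abs_le, ← Real.log_inv]
  constructor
  · refine Real.log_le_log (inv_pos.2 h3) ?_
    rw [inv_eq_one_div, div_le_div_iff₀ h3 h2]
    have : 0 ≤ r * (a ^ 2 - 1) := mul_nonneg hr (by nlinarith)
    linarith
  · refine Real.log_le_log (div_pos h1 h2) ?_
    rw [div_le_iff₀ h2]
    nlinarith

theorem ddent_nonneg (ha : 1 ≤ a) (hr : 0 ≤ r) : 0 ≤ ddent a r := by
  have h1 : 0 < a * r + 1 := by positivity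
  have h2 : 0 < r + a := by positivity
  rw [ddent, sub_nonneg, div_le_div_iff₀ h2 h1]
  nlinarith

theorem ddent_le (ha : 1 ≤ a) (hr : 0 ≤ r) : ddent a r ≤ a := by
  have h2 : 0 < 1 / (r + a) := by positivity
  have h3 : a / (a * r + 1) ≤ a := div_le_self (by positivity) (by nlinarith)
  rw [ddent]
  linarith

/-- Along the flow the dissipation density is `ρ U''(ρ) ‖∇ρ‖²`, so this bound puts it below the
Dirichlet energy uniformly in `a`. -/
theorem mul_ddent_le_one (ha : 1 ≤ a) (hr : 0 ≤ r) : r * ddent a r ≤ 1 := by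
  have h1 : 0 < a * r + 1 := by positivity
  have h2 : 0 ≤ r * (1 / (r + a)) := by positivity
  have h3 : r * (a / (a * r + 1)) ≤ 1 := by
    rw [← mul_div_assoc, div_le_one h1]; linarith
  rw [ddent, mul_sub]
  linarith

theorem continuousOn_ddent (ha : 1 ≤ a) : ContinuousOn (ddent a) (Ici 0) := by
  refine ContinuousOn.sub (ContinuousOn.div (by fun_prop) (by fun_prop) fun r hr => ?_)
    (ContinuousOn.div (by fun_prop) (by fun_prop) fun r hr => ?_)
  · have : (0 : ℝ) ≤ r := hr
    positivity
  · have : (0 : ℝ) ≤ r := hr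
    positivity

/-- Convexity between `s` and `1`, where `klFun` vanishes. -/
theorem klFun_combo_le {l s : ℝ} (hs : 0 ≤ s) (hl0 : 0 ≤ l) (hl1 : l ≤ 1) :
    klFun (l * s + (1 - l)) ≤ l * klFun s := by
  have := convexOn_klFun.2 (x := s) (y := 1) hs (mem_Ici.2 zero_le_one) hl0 (sub_nonneg.2 hl1)
    (by ring : l + (1 - l) = 1)
  simpa [klFun_one] using this

/-- The argument `(r + a) / (a + 1)` of the subtracted term is the convex combination of `(a r + 1)
/ (a + 1)` and `1` with weights `1 / a` and `1 - 1 / a`. -/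
theorem ent_nonneg (ha : 1 ≤ a) (hr : 0 ≤ r) : 0 ≤ ent a r := by
  have h3 : 0 < a + 1 := by positivity
  have h0 : 0 < a := by positivity
  have h := klFun_combo_le (l := 1 / a) (s := (a * r + 1) / (a + 1)) (by positivity)
    (by positivity) ((div_le_one h0).2 ha)
  have e : 1 / a * ((a * r + 1) / (a + 1)) + (1 - 1 / a) = (r + a) / (a + 1) := by
    field_simp; ring
  rw [e] at h
  have := mul_le_mul_of_nonneg_left h h3.le
  rw [ent, sub_nonneg]
  refine this.trans (le_of_eq ?_)
  field_simp

/-- The subtracted term is dropped, and `(a r + 1) / (a + 1)` is the convex combination of `r` and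
`1` with weight `a / (a + 1)` on `r`. The prefactor `1 + 1 / a` cancels this weight exactly. -/
theorem ent_le_klFun (ha : 1 ≤ a) (hr : 0 ≤ r) : ent a r ≤ klFun r := by
  have h3 : 0 < a + 1 := by positivity
  have h0 : 0 < a := by positivity
  have h := klFun_combo_le (l := a / (a + 1)) (s := r) hr
    (by positivity) ((div_le_one h3).2 (by linarith))
  have e : a / (a + 1) * r + (1 - a / (a + 1)) = (a * r + 1) / (a + 1) := by
    field_simp; ring
  rw [e] at h
  have h4 := mul_le_mul_of_nonneg_left h (by positivity : (0 : ℝ) ≤ 1 + 1 / a)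
  have e2 : (1 + 1 / a) * (a / (a + 1) * klFun r) = klFun r := by field_simp
  have h5 : 0 ≤ (a + 1) * klFun ((r + a) / (a + 1)) :=
    mul_nonneg h3.le (klFun_nonneg (by positivity))
  rw [ent]
  linarith

theorem klFun_le_sub_one_sq {s : ℝ} (hs : 0 ≤ s) : klFun s ≤ (s - 1) ^ 2 := by
  rw [klFun_apply]
  rcases hs.eq_or_lt with rfl | h
  · simp
  · nlinarith [Real.log_le_sub_one_of_pos h]

/-- The first term tends to `klFun r` by continuity. The second is at most `(r - 1)² / (a + 1)`,
because `klFun` is bounded by `(s - 1)²`. -/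
theorem tendsto_ent (hr : 0 ≤ r) :
    Tendsto (fun n : ℕ => ent ((n : ℝ) + 1) r) atTop (𝓝 (klFun r)) := by
  have h0 := tendsto_one_div_add_atTop_nhds_zero_nat (𝕜 := ℝ)
  have h0' : Tendsto (fun n : ℕ => 1 / ((n : ℝ) + 1 + 1)) atTop (𝓝 0) := by
    have := (tendsto_add_atTop_iff_nat 1).2 h0
    simpa using this
  have h1 : Tendsto (fun n : ℕ => (1 + 1 / ((n : ℝ) + 1))
      * klFun ((((n : ℝ) + 1) * r + 1) / ((n : ℝ) + 1 + 1))) atTop (𝓝 ((1 + 0) * klFun r)) := by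
    refine (h0.const_add 1).mul ((continuous_klFun.tendsto r).comp ?_)
    have h2 : Tendsto (fun n : ℕ => r + (1 - r) * (1 / ((n : ℝ) + 1 + 1))) atTop
        (𝓝 (r + (1 - r) * 0)) := (h0'.const_mul _).const_add _
    simp only [mul_zero, add_zero] at h2
    refine h2.congr fun n => ?_
    have : (n : ℝ) + 1 + 1 ≠ 0 := by positivity
    field_simp
    ring
  have h2 : Tendsto (fun n : ℕ => ((n : ℝ) + 1 + 1)
      * klFun ((r + ((n : ℝ) + 1)) / ((n : ℝ) + 1 + 1))) atTop (𝓝 0) := by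
    have h3 : Tendsto (fun n : ℕ => (r - 1) ^ 2 * (1 / ((n : ℝ) + 1 + 1))) atTop
        (𝓝 ((r - 1) ^ 2 * 0)) := h0'.const_mul _
    rw [mul_zero] at h3
    refine squeeze_zero (fun n => mul_nonneg (by positivity) (klFun_nonneg (by positivity)))
      (fun n => ?_) h3
    have h4 := klFun_le_sub_one_sq (s := (r + ((n : ℝ) + 1)) / ((n : ℝ) + 1 + 1)) (by positivity)
    have h5 : (0 : ℝ) < (n : ℝ) + 1 + 1 := by positivity
    refine (mul_le_mul_of_nonneg_left h4 h5.le).trans (le_of_eq ?_)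
    field_simp
    ring
  simpa [ent] using h1.sub h2

/-- The limit is the indicator of `{r ≠ 0}`, which matches the energy in the Poincaré inequality for
flat truncations. -/
theorem tendsto_mul_ddent (hr : 0 ≤ r) : Tendsto (fun n : ℕ => r * ddent ((n : ℝ) + 1) r) atTop
    (𝓝 (if r = 0 then 0 else 1)) := by
  by_cases h : r = 0
  · simp [h]
  rw [if_neg h]
  have hn : Tendsto (fun n : ℕ => (n : ℝ) + 1) atTop atTop :=
    tendsto_atTop_add_const_right _ _ tendsto_natCast_atTop_atTop
  have h0 := tendsto_one_div_add_atTop_nhds_zero_nat (𝕜 := ℝ)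
  have h1 : Tendsto (fun n : ℕ => r / (r + ((n : ℝ) + 1))) atTop (𝓝 0) :=
    tendsto_const_nhds.div_atTop (tendsto_atTop_add_const_left _ _ hn)
  have h2 : Tendsto (fun n : ℕ => r / (r + 1 / ((n : ℝ) + 1))) atTop (𝓝 (r / (r + 0))) :=
    tendsto_const_nhds.div (h0.const_add r) (by simpa using h)
  rw [add_zero, div_self h] at h2
  have h3 := h2.sub h1
  rw [sub_zero] at h3
  refine h3.congr fun n => ?_
  rw [ddent]
  have : (0 : ℝ) < n + 1 := by positivity
  have h4 : r + 1 / ((n : ℝ) + 1) ≠ 0 := by positivity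
  have h5 : ((n : ℝ) + 1) * r + 1 ≠ 0 := by positivity
  have h6 : r + ((n : ℝ) + 1) ≠ 0 := by positivity
  have e : r / (r + 1 / ((n : ℝ) + 1)) = r * (((n : ℝ) + 1) / (((n : ℝ) + 1) * r + 1)) := by
    rw [← mul_div_assoc, div_eq_div_iff h4 h5]
    field_simp
  rw [e]
  ring

end

end

/-! ### Entropy functions and mollified densities. -/

section

variable {d : ℕ}

/-- Integration by parts against a mollified vector field. -/
theorem integral_mul_integral_inner_gradient_ker (k : ℕ) {ψ : Space d → ℝ} (hψ : ContDiff ℝ 1 ψ)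
    (hψs : HasCompactSupport ψ) {j : Space d → Space d} (hj : Integrable j volume) :
    ∫ x, ψ x * ∫ y, inner ℝ (j y) (gradient (ker d k) (x - y))
      = -∫ x, inner ℝ (gradient ψ x) (moll k j x) := by
  have hker := contDiff_ker (d := d) (n := 1) k
  have hgk := continuous_gradient hker
  obtain ⟨c, hc⟩ := hgk.bounded_above_of_compact_support
    (hasCompactSupport_gradient (hasCompactSupport_ker k))
  obtain ⟨c', hc'⟩ := hker.continuous.bounded_above_of_compact_support (hasCompactSupport_ker k)
  have hψi : Integrable ψ volume := hψ.continuous.integrable_of_hasCompactSupport hψs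
  have hgi : Integrable (gradient ψ) volume :=
    (continuous_gradient hψ).integrable_of_hasCompactSupport (hasCompactSupport_gradient hψs)
  have m1 : AEStronglyMeasurable (fun p : Space d × Space d => gradient (ker d k) (p.1 - p.2))
      (volume.prod volume) := (hgk.comp (by fun_prop)).aestronglyMeasurable
  have m2 : AEStronglyMeasurable (fun p : Space d × Space d => ker d k (p.1 - p.2))
      (volume.prod volume) := (hker.continuous.comp (by fun_prop)).aestronglyMeasurable
  have I1 : Integrable (fun p : Space d × Space d =>
      ψ p.1 * inner ℝ (j p.2) (gradient (ker d k) (p.1 - p.2))) (volume.prod volume) := by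
    refine ((hψi.norm.mul_prod hj.norm).mul_const c).mono'
      ((hψi.aestronglyMeasurable.comp_fst).mul
        ((hj.aestronglyMeasurable.comp_snd).inner m1)) (ae_of_all _ fun p => ?_)
    rw [norm_mul, mul_assoc]
    refine mul_le_mul_of_nonneg_left ?_ (norm_nonneg _)
    exact (norm_inner_le_norm _ _).trans (mul_le_mul_of_nonneg_left (hc _) (norm_nonneg _))
  have I2 : Integrable (fun p : Space d × Space d =>
      ker d k (p.1 - p.2) * inner ℝ (gradient ψ p.1) (j p.2)) (volume.prod volume) := by
    refine ((hgi.norm.mul_prod hj.norm).const_mul c').mono'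
      (m2.mul ((hgi.aestronglyMeasurable.comp_fst).inner (hj.aestronglyMeasurable.comp_snd)))
      (ae_of_all _ fun p => ?_)
    rw [norm_mul]
    exact mul_le_mul (hc' _) (norm_inner_le_norm _ _) (norm_nonneg _)
      ((norm_nonneg _).trans (hc' 0))
  have s1 := integral_integral_swap
    (f := fun x y => ψ x * inner ℝ (j y) (gradient (ker d k) (x - y))) I1
  have s2 := integral_integral_swap
    (f := fun x y => ker d k (x - y) * inner ℝ (gradient ψ x) (j y)) I2
  simp only [integral_const_mul] at s1
  have e2 : ∀ x, ∫ y, ker d k (x - y) * inner ℝ (gradient ψ x) (j y)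
      = inner ℝ (gradient ψ x) (moll k j x) := fun x => by
    rw [moll, ← integral_inner (integrable_ker_smul k hj.locallyIntegrable x)]
    simp only [inner_smul_right]
  simp only [e2] at s2
  rw [s1, s2, ← integral_neg]
  refine integral_congr_ae (ae_of_all _ fun y => ?_)
  dsimp only
  have hshift : ContDiff ℝ 1 (fun x : Space d => ker d k (x - y)) := hker.comp (by fun_prop)
  have hshifts : HasCompactSupport (fun x : Space d => ker d k (x - y)) :=
    (hasCompactSupport_ker k).comp_homeomorph (Homeomorph.subRight y)
  have hgrad : ∀ x, gradient (fun x : Space d => ker d k (x - y)) x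
      = gradient (ker d k) (x - y) := fun x => by
    have h := hasGradientAt_of_contDiff hker (x - y)
    have h2 : HasGradientAt (fun x : Space d => ker d k (x - y))
        (gradient (ker d k) (x - y)) x := by
      rw [hasGradientAt_iff_hasFDerivAt] at h ⊢
      exact (h.comp x ((hasFDerivAt_id x).sub_const y)).congr_fderiv (by ext v; simp)
    exact h2.gradient
  -- After Fubini, `j y` is constant in the inner integral, and the derivative moves from the
  -- translated kernel to `ψ`.
  have key := integral_smul_gradient hψ hshift hshifts
  simp only [hgrad] at key
  have i1 : Integrable (fun x => ψ x • gradient (ker d k) (x - y)) volume :=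
    (hψ.continuous.smul (hgk.comp (by fun_prop))).integrable_of_hasCompactSupport hψs.smul_right
  have i2 : Integrable (fun x => ker d k (x - y) • gradient ψ x) volume :=
    (hshift.continuous.smul (continuous_gradient hψ)).integrable_of_hasCompactSupport
      hshifts.smul_right
  have := congrArg (fun v => inner ℝ (j y) v) key
  rw [inner_neg_right, ← integral_inner i1, ← integral_inner i2] at this
  simp only [inner_smul_right] at this
  rw [this]
  simp only [real_inner_comm]

/-- The functions of the density that enter the entropy computation: `U` is differentiable twice
on `[0, ∞)` with bounded first derivative and `r (U'')²` is bounded. -/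
structure EntropyFunction (U U' U'' : ℝ → ℝ) (K L : ℝ) : Prop where
  hasDerivAt : ∀ r, 0 ≤ r → HasDerivAt U (U' r) r
  hasDerivAt' : ∀ r, 0 ≤ r → HasDerivAt U' (U'' r) r
  abs_le : ∀ r, 0 ≤ r → |U' r| ≤ K
  mul_sq_le : ∀ r, 0 ≤ r → r * U'' r ^ 2 ≤ L
  continuousOn : ContinuousOn U'' (Ici 0)
  measurable' : Measurable U'

theorem entropyFunction_ent {a : ℝ} (ha : 1 ≤ a) :
    EntropyFunction (ent a) (dent a) (ddent a) (Real.log a) a := by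
  refine ⟨fun r hr => hasDerivAt_ent ha hr, fun r hr => hasDerivAt_dent ha hr,
    fun r hr => abs_dent_le ha hr, fun r hr => ?_, continuousOn_ddent ha, measurable_dent⟩
  -- The constant `a` comes from `r U''² = (r U'') U''` with factors at most `1` and `a`.
  have h1 := mul_le_mul (mul_ddent_le_one ha hr) (ddent_le ha hr) (ddent_nonneg ha hr) zero_le_one
  linarith [sq (ddent a r), mul_assoc r (ddent a r) (ddent a r)]

variable {w : Space d → ℝ} {U U' U'' : ℝ → ℝ} {K L : ℝ}

namespace EntropyFunction

theorem nonneg_left (hU : EntropyFunction U U' U'' K L) : 0 ≤ K :=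
  (abs_nonneg _).trans (hU.abs_le 0 le_rfl)

theorem nonneg_right (hU : EntropyFunction U U' U'' K L) : 0 ≤ L := by
  simpa using hU.mul_sq_le 0 le_rfl

theorem abs_sub_le (hU : EntropyFunction U U' U'' K L) {r s : ℝ} (hr : 0 ≤ r) (hs : 0 ≤ s) :
    |U r - U s| ≤ K * |r - s| := by
  simpa [Real.norm_eq_abs] using Convex.norm_image_sub_le_of_norm_hasDerivWithin_le
    (fun r hr => (hU.hasDerivAt r hr).hasDerivWithinAt)
    (fun r hr => by simpa using hU.abs_le r hr) (convex_Ici 0) (mem_Ici.2 hs) (mem_Ici.2 hr)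

theorem continuous_comp (hU : EntropyFunction U U' U'' K L) {f : Space d → ℝ} (hf : Continuous f)
    (hf0 : ∀ x, 0 ≤ f x) : Continuous (fun x => U (f x)) :=
  continuous_iff_continuousAt.2 fun x =>
    (hU.hasDerivAt _ (hf0 x)).continuousAt.comp hf.continuousAt

theorem continuous_second_deriv_comp (hU : EntropyFunction U U' U'' K L) {f : Space d → ℝ}
    (hf : Continuous f) (hf0 : ∀ x, 0 ≤ f x) : Continuous (fun x => U'' (f x)) :=
  hU.continuousOn.comp_continuous hf hf0

end EntropyFunction

/-- The density of the mollified measure `(w ρ) * ker` with respect to `w`. -/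
noncomputable def smoothDensity (w : Space d → ℝ) (k : ℕ) (ρ : Space d → ℝ) (x : Space d) : ℝ :=
  (w x)⁻¹ * moll k (fun y => w y * ρ y) x

theorem smoothDensity_nonneg (hpos : ∀ x, 0 < w x) (k : ℕ) {ρ : Space d → ℝ}
    (hρ0 : ∀ x, 0 ≤ ρ x) (x : Space d) : 0 ≤ smoothDensity w k ρ x :=
  mul_nonneg (inv_nonneg.2 (hpos x).le)
    (moll_nonneg k (fun y => mul_nonneg (hpos y).le (hρ0 y)) x)

theorem contDiff_smoothDensity (hw : ContDiff ℝ 1 w) (hpos : ∀ x, 0 < w x) (k : ℕ)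
    {ρ : Space d → ℝ} (hρ : LocallyIntegrable ρ volume) : ContDiff ℝ 1 (smoothDensity w k ρ) :=
  (hw.inv fun x => (hpos x).ne').mul
    (contDiff_one_moll k (locallyIntegrable_continuous_smul hw.continuous hρ))

theorem ae_tendsto_smoothDensity (hw : Continuous w) (hpos : ∀ x, 0 < w x)
    {ρ : Space d → ℝ} (hρ : LocallyIntegrable ρ volume) :
    ∀ᵐ x, Tendsto (fun k => smoothDensity w k ρ x) atTop (𝓝 (ρ x)) := by
  filter_upwards [ae_tendsto_moll (locallyIntegrable_continuous_smul hw hρ)] with x hx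
  have := hx.const_mul (w x)⁻¹
  rwa [smul_eq_mul, inv_mul_cancel_left₀ (hpos x).ne'] at this

/-- The entropy of the mollified measure converges to the entropy of the measure. -/
theorem tendsto_integral_entropy_smoothDensity (hw : ContDiff ℝ 1 w) (hpos : ∀ x, 0 < w x)
    (hU : EntropyFunction U U' U'' K L) {φ : Space d → ℝ} (hφ : Continuous φ)
    (hφs : HasCompactSupport φ) {ρ : Space d → ℝ} (hρ0 : ∀ x, 0 ≤ ρ x)
    (hρ : LocallyIntegrable ρ volume) :
    Tendsto (fun k => ∫ x, φ x * w x * U (smoothDensity w k ρ x)) atTop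
      (𝓝 (∫ x, φ x * w x * U (ρ x))) := by
  have hwρ : LocallyIntegrable (fun x => w x * ρ x) volume :=
    locallyIntegrable_continuous_smul hw.continuous hρ
  -- `U` grows at most linearly, and `w` times the mollified density is exactly the mollification of
  -- `w ρ`; this fixes the dominating pair.
  refine tendsto_integral_of_le_moll (χ := fun x => |φ x| * (w x * |U 0| + K))
    (H := fun x => 1 + w x * ρ x) ?_ ?_ ((locallyIntegrable_const 1).add hwρ)
    (fun k => ?_) (fun k x => ?_) ?_
  · have := hw.continuous
    fun_prop
  · exact hφs.abs.mul_right
  · exact ((hφ.mul hw.continuous).mul (hU.continuous_comp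
      (contDiff_smoothDensity hw hpos k hρ).continuous
      (smoothDensity_nonneg hpos k hρ0))).aestronglyMeasurable
  · have e : moll k (fun x => 1 + w x * ρ x) x = 1 + moll k (fun x => w x * ρ x) x := by
      rw [moll_add k (locallyIntegrable_const 1) hwρ]
      simp [moll, integral_ker_sub]
    have h0 := smoothDensity_nonneg hpos k hρ0 x
    have h1 := hU.abs_sub_le h0 le_rfl
    rw [sub_zero, abs_of_nonneg h0] at h1
    have h2 : |U (smoothDensity w k ρ x)| ≤ |U 0| + K * smoothDensity w k ρ x := by
      have := abs_sub_abs_le_abs_sub (U (smoothDensity w k ρ x)) (U 0)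
      linarith
    have h3 : w x * smoothDensity w k ρ x = moll k (fun x => w x * ρ x) x := by
      rw [smoothDensity, mul_inv_cancel_left₀ (hpos x).ne']
    have h4 : 0 ≤ moll k (fun x => w x * ρ x) x :=
      moll_nonneg k (fun y => mul_nonneg (hpos y).le (hρ0 y)) x
    rw [e, abs_mul, abs_mul, abs_of_pos (hpos x), mul_assoc, mul_assoc]
    refine mul_le_mul_of_nonneg_left ?_ (abs_nonneg _)
    refine (mul_le_mul_of_nonneg_left h2 (hpos x).le).trans ?_
    have h5 : w x * (|U 0| + K * smoothDensity w k ρ x)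
        = w x * |U 0| + K * moll k (fun x => w x * ρ x) x := by rw [← h3]; ring
    rw [h5]
    have h6 : 0 ≤ w x * |U 0| := mul_nonneg (hpos x).le (abs_nonneg _)
    nlinarith [hU.nonneg_left, mul_nonneg h6 h4]
  · filter_upwards [ae_tendsto_smoothDensity hw.continuous hpos hρ] with x hx
    exact (((hU.hasDerivAt _ (hρ0 x)).continuousAt.tendsto).comp hx).const_mul _

end

/-! ### Domination and limit of the entropy production at a fixed time. -/

section

variable {d : ℕ} {w : Space d → ℝ} {U U' U'' : ℝ → ℝ} {K L : ℝ}

/-- The local energy density that dominates the entropy production of mollifications. -/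
noncomputable def energyDensity (w ρ : Space d → ℝ) (g : Space d → Space d) (x : Space d) : ℝ :=
  ‖w x • g x + ρ x • gradient w x‖ ^ 2 + (w x * ρ x) ^ 2 + w x * ρ x * ‖g x‖ ^ 2 + w x * ρ x

/-- The weight with which `energyDensity` dominates the entropy production. -/
noncomputable def energyWeight (w φ : Space d → ℝ) (K L : ℝ) (x : Space d) : ℝ :=
  |φ x| * ((w x)⁻¹ ^ 2 + ‖gradient (fun y => (w y)⁻¹) x‖ ^ 2 + w x * L) + K * ‖gradient φ x‖

theorem gradient_inv (hw : ContDiff ℝ 1 w) (hpos : ∀ x, 0 < w x) (x : Space d) :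
    gradient (fun y => (w y)⁻¹) x = (-(w x ^ 2)⁻¹) • gradient w x :=
  (hasGradientAt_comp (hasDerivAt_inv (hpos x).ne') (hasGradientAt_of_contDiff hw x)).gradient

theorem contDiff_inv (hw : ContDiff ℝ 1 w) (hpos : ∀ x, 0 < w x) :
    ContDiff ℝ 1 (fun x => (w x)⁻¹) := hw.inv fun x => (hpos x).ne'

theorem continuous_energyWeight (hw : ContDiff ℝ 1 w) (hpos : ∀ x, 0 < w x) {φ : Space d → ℝ}
    (hφ : ContDiff ℝ 1 φ) : Continuous (energyWeight w φ K L) := by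
  have h1 := continuous_gradient (contDiff_inv hw hpos)
  have h2 := continuous_gradient hφ
  have h3 := (contDiff_inv hw hpos).continuous
  have h4 := hφ.continuous
  have h5 := hw.continuous
  unfold energyWeight
  fun_prop

theorem hasCompactSupport_energyWeight {φ : Space d → ℝ} (hφs : HasCompactSupport φ) :
    HasCompactSupport (energyWeight w φ K L) := by
  obtain ⟨R, hR⟩ := exists_eq_zero_of_hasCompactSupport hφs
  obtain ⟨R', hR'⟩ := exists_eq_zero_of_hasCompactSupport (hasCompactSupport_gradient hφs)
  refine hasCompactSupport_of_eq_zero (R := max R R') fun x hx => ?_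
  simp [energyWeight, hR x ((le_max_left _ _).trans_lt hx), hR' x ((le_max_right _ _).trans_lt hx)]

/-- The hypotheses on a weakly differentiable density under which its mollifications have
locally dominated entropy production. -/
structure LocalEnergy (ρ : Space d → ℝ) (g : Space d → Space d) : Prop where
  hasWeakGradient : HasWeakGradient ρ g
  nonneg : ∀ x, 0 ≤ ρ x
  sq : LocallyIntegrable (fun x => ρ x ^ 2) volume
  grad_sq : LocallyIntegrable (fun x => ‖g x‖ ^ 2) volume
  action : LocallyIntegrable (fun x => ρ x * ‖g x‖ ^ 2) volume

theorem locallyIntegrable_of_le {F : Type*} [NormedAddCommGroup F] {f : Space d → F}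
    {h : Space d → ℝ} (hh : LocallyIntegrable h volume) (hf : AEStronglyMeasurable f volume)
    (hle : ∀ x, ‖f x‖ ≤ h x) : LocallyIntegrable f volume :=
  hh.mono hf (ae_of_all _ fun x => (hle x).trans (le_abs_self _))

namespace LocalEnergy

variable {ρ : Space d → ℝ} {g : Space d → Space d}

theorem locallyIntegrable_grad_weighted (h : LocalEnergy ρ g) (hw : ContDiff ℝ 1 w) :
    LocallyIntegrable (fun x => ‖w x • g x + ρ x • gradient w x‖ ^ 2) volume := by
  have h1 : LocallyIntegrable (fun x => (2 * w x ^ 2) • ‖g x‖ ^ 2) volume :=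
    locallyIntegrable_continuous_smul (by have := hw.continuous; fun_prop) h.grad_sq
  have h2 : LocallyIntegrable (fun x => (2 * ‖gradient w x‖ ^ 2) • ρ x ^ 2) volume :=
    locallyIntegrable_continuous_smul (by have := continuous_gradient hw; fun_prop) h.sq
  refine locallyIntegrable_of_le (h1.add h2) ?_ fun x => ?_
  · exact (h.hasWeakGradient.mul_contDiff_one hw).locallyIntegrable_grad.aestronglyMeasurable.norm.pow 2
  · rw [Real.norm_of_nonneg (sq_nonneg _)]
    refine (norm_add_sq_le_two _ _).trans (le_of_eq ?_)
    rw [norm_smul, norm_smul, mul_pow, mul_pow, Real.norm_eq_abs, Real.norm_eq_abs, sq_abs,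
      sq_abs]
    simp only [Pi.add_apply, smul_eq_mul]
    ring

theorem locallyIntegrable_sq_weighted (h : LocalEnergy ρ g) (hw : ContDiff ℝ 1 w) :
    LocallyIntegrable (fun x => (w x * ρ x) ^ 2) volume := by
  have := locallyIntegrable_continuous_smul (hw.continuous.pow 2) h.sq
  simpa only [smul_eq_mul, Pi.pow_apply, ← mul_pow] using this

theorem locallyIntegrable_action_weighted (h : LocalEnergy ρ g) (hw : ContDiff ℝ 1 w) :
    LocallyIntegrable (fun x => w x * ρ x * ‖g x‖ ^ 2) volume := by
  have := locallyIntegrable_continuous_smul hw.continuous h.action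
  simpa only [smul_eq_mul, ← mul_assoc] using this

theorem locallyIntegrable_weighted (h : LocalEnergy ρ g) (hw : ContDiff ℝ 1 w) :
    LocallyIntegrable (fun x => w x * ρ x) volume :=
  locallyIntegrable_continuous_smul hw.continuous h.hasWeakGradient.locallyIntegrable_fun

theorem locallyIntegrable_energyDensity (h : LocalEnergy ρ g) (hw : ContDiff ℝ 1 w) :
    LocallyIntegrable (energyDensity w ρ g) volume :=
  (((h.locallyIntegrable_grad_weighted hw).add (h.locallyIntegrable_sq_weighted hw)).add
    (h.locallyIntegrable_action_weighted hw)).add (h.locallyIntegrable_weighted hw)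

/-- Follows from `s ≤ 1 + s²` with `s = ‖g x‖`: mass and action together control the flux. -/
theorem norm_flux_le (h : LocalEnergy ρ g) (hpos : ∀ x, 0 < w x) (x : Space d) :
    ‖(w x * ρ x) • g x‖ ≤ w x * ρ x + w x * ρ x * ‖g x‖ ^ 2 := by
  have h0 : 0 ≤ w x * ρ x := mul_nonneg (hpos x).le (h.nonneg x)
  rw [norm_smul, Real.norm_of_nonneg h0]
  nlinarith [sq_nonneg (‖g x‖ - 1), norm_nonneg (g x), mul_nonneg h0 (sq_nonneg (‖g x‖ - 1)),
    mul_nonneg h0 (sq_nonneg ‖g x‖)]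

theorem locallyIntegrable_flux (h : LocalEnergy ρ g) (hw : ContDiff ℝ 1 w) (hpos : ∀ x, 0 < w x) :
    LocallyIntegrable (fun x => (w x * ρ x) • g x) volume :=
  locallyIntegrable_of_le
    ((h.locallyIntegrable_weighted hw).add (h.locallyIntegrable_action_weighted hw))
    ((h.locallyIntegrable_weighted hw).aestronglyMeasurable.smul
      h.hasWeakGradient.locallyIntegrable_grad.aestronglyMeasurable)
    (h.norm_flux_le hpos)

theorem hasGradientAt_smoothDensity (h : LocalEnergy ρ g) (hw : ContDiff ℝ 1 w)
    (hpos : ∀ x, 0 < w x) (k : ℕ) (x : Space d) :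
    HasGradientAt (smoothDensity w k ρ)
      ((w x)⁻¹ • moll k (fun y => w y • g y + ρ y • gradient w y) x
        + moll k (fun y => w y * ρ y) x • gradient (fun y => (w y)⁻¹) x) x :=
  hasGradientAt_mul (hasGradientAt_of_contDiff (contDiff_inv hw hpos) x)
    ((h.hasWeakGradient.mul_contDiff_one hw).hasGradientAt_moll k x)

theorem gradient_mul_entropy (h : LocalEnergy ρ g) (hw : ContDiff ℝ 1 w) (hpos : ∀ x, 0 < w x)
    (hU : EntropyFunction U U' U'' K L) {φ : Space d → ℝ} (hφ : ContDiff ℝ 1 φ) (k : ℕ)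
    (x : Space d) :
    gradient (fun y => φ y * U' (smoothDensity w k ρ y)) x
      = φ x • (U'' (smoothDensity w k ρ x) •
          ((w x)⁻¹ • moll k (fun y => w y • g y + ρ y • gradient w y) x
          + moll k (fun y => w y * ρ y) x • gradient (fun y => (w y)⁻¹) x))
        + U' (smoothDensity w k ρ x) • gradient φ x :=
  (hasGradientAt_mul (hasGradientAt_of_contDiff hφ x)
    (hasGradientAt_comp (hU.hasDerivAt' _ (smoothDensity_nonneg hpos k h.nonneg x))
      (h.hasGradientAt_smoothDensity hw hpos k x))).gradient

theorem moll_le_moll_energyDensity (h : LocalEnergy ρ g) (hw : ContDiff ℝ 1 w)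
    (hpos : ∀ x, 0 < w x) (k : ℕ) (x : Space d) :
    moll k (fun y => ‖w y • g y + ρ y • gradient w y‖ ^ 2) x ≤ moll k (energyDensity w ρ g) x ∧
    moll k (fun y => (w y * ρ y) ^ 2) x ≤ moll k (energyDensity w ρ g) x ∧
    moll k (fun y => w y * ρ y * ‖g y‖ ^ 2) x ≤ moll k (energyDensity w ρ g) x ∧
    ‖moll k (fun y => (w y * ρ y) • g y) x‖ ≤ moll k (energyDensity w ρ g) x := by
  have hE := h.locallyIntegrable_energyDensity hw
  have hm : ∀ y, 0 ≤ w y * ρ y := fun y => mul_nonneg (hpos y).le (h.nonneg y)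
  have h1 : ∀ y, 0 ≤ ‖w y • g y + ρ y • gradient w y‖ ^ 2 := fun y => sq_nonneg _
  have h2 : ∀ y, 0 ≤ (w y * ρ y) ^ 2 := fun y => sq_nonneg _
  have h3 : ∀ y, 0 ≤ w y * ρ y * ‖g y‖ ^ 2 := fun y => mul_nonneg (hm y) (sq_nonneg _)
  refine ⟨moll_mono k (h.locallyIntegrable_grad_weighted hw) hE (fun y => ?_) x,
    moll_mono k (h.locallyIntegrable_sq_weighted hw) hE (fun y => ?_) x,
    moll_mono k (h.locallyIntegrable_action_weighted hw) hE (fun y => ?_) x,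
    (norm_moll_le k _ x).trans (moll_mono k (locallyIntegrable_norm
      (h.locallyIntegrable_flux hw hpos)) hE (fun y => ?_) x)⟩
  · rw [energyDensity]; linarith [hm y, h1 y, h2 y, h3 y]
  · rw [energyDensity]; linarith [hm y, h1 y, h2 y, h3 y]
  · rw [energyDensity]; linarith [hm y, h1 y, h2 y, h3 y]
  · refine (h.norm_flux_le hpos y).trans ?_
    rw [energyDensity]; linarith [hm y, h1 y, h2 y, h3 y]

/-- Pointwise bound of the entropy production of a mollification. -/
theorem abs_inner_gradient_le (h : LocalEnergy ρ g) (hw : ContDiff ℝ 1 w) (hpos : ∀ x, 0 < w x)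
    (hU : EntropyFunction U U' U'' K L) {φ : Space d → ℝ} (hφ : ContDiff ℝ 1 φ) (k : ℕ)
    (x : Space d) :
    |inner ℝ (gradient (fun y => φ y * U' (smoothDensity w k ρ y)) x)
        (moll k (fun y => (w y * ρ y) • g y) x)|
      ≤ energyWeight w φ K L x * moll k (energyDensity w ρ g) x := by
  rw [h.gradient_mul_entropy hw hpos hU hφ]
  obtain ⟨b1, b2, b3, b4⟩ := h.moll_le_moll_energyDensity hw hpos k x
  have s0 := smoothDensity_nonneg hpos k h.nonneg x
  have hm : ∀ y, 0 ≤ w y * ρ y := fun y => mul_nonneg (hpos y).le (h.nonneg y)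
  have cs := sq_norm_moll_smul_le k hm (h.locallyIntegrable_weighted hw)
    (h.locallyIntegrable_flux hw hpos) (h.locallyIntegrable_action_weighted hw) x
  have cp := sq_norm_moll_le k (h.hasWeakGradient.mul_contDiff_one hw).locallyIntegrable_grad
    (h.locallyIntegrable_grad_weighted hw) x
  have cm := sq_norm_moll_le k (h.locallyIntegrable_weighted hw)
    (by simpa only [Real.norm_eq_abs, sq_abs] using h.locallyIntegrable_sq_weighted hw) x
  simp only [Real.norm_eq_abs, sq_abs] at cm
  have e3 : moll k (fun x => w x * ρ x) x = w x * smoothDensity w k ρ x := by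
    rw [smoothDensity, mul_inv_cancel_left₀ (hpos x).ne']
  rw [e3] at cs
  have c3 : 0 ≤ moll k (fun y => w y * ρ y * ‖g y‖ ^ 2) x :=
    moll_nonneg k (fun y => mul_nonneg (hm y) (sq_nonneg _)) x
  set P := moll k (fun y => w y • g y + ρ y • gradient w y) x
  set M := moll k (fun y => w y * ρ y) x
  set J := moll k (fun y => (w y * ρ y) • g y) x
  set E := moll k (energyDensity w ρ g) x
  set r := smoothDensity w k ρ x
  set q := gradient (fun y => (w y)⁻¹) x
  set v := (w x)⁻¹ • P + M • q with hv
  have hE0 : 0 ≤ E := (norm_nonneg _).trans b4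
  have hv2 : ‖v‖ ^ 2 ≤ 2 * ((w x)⁻¹ ^ 2 + ‖q‖ ^ 2) * E := by
    refine (norm_add_sq_le_two _ _).trans ?_
    rw [norm_smul, norm_smul, mul_pow, mul_pow, Real.norm_eq_abs, Real.norm_eq_abs, sq_abs, sq_abs]
    have a1 := mul_le_mul_of_nonneg_left (cp.trans b1) (sq_nonneg (w x)⁻¹)
    have a2 := mul_le_mul_of_nonneg_right (cm.trans b2) (sq_nonneg ‖q‖)
    linarith
  -- Cauchy–Schwarz with weight `w ρ` gives `‖J‖² ≤ w r` times the mollified action. The factor `r`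
  -- compensates `U''²`, which is why an `EntropyFunction` bounds `r U''²`.
  have hj2 : U'' r ^ 2 * ‖J‖ ^ 2 ≤ 2 * (w x * L) * E := by
    have a1 := mul_le_mul_of_nonneg_left cs (sq_nonneg (U'' r))
    have a2 : U'' r ^ 2 * (w x * r * moll k (fun y => w y * ρ y * ‖g y‖ ^ 2) x)
        = w x * (r * U'' r ^ 2) * moll k (fun y => w y * ρ y * ‖g y‖ ^ 2) x := by ring
    have a3 : w x * (r * U'' r ^ 2) ≤ w x * L :=
      mul_le_mul_of_nonneg_left (hU.mul_sq_le r s0) (hpos x).le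
    have a4 : 0 ≤ w x * L := mul_nonneg (hpos x).le hU.nonneg_right
    have a5 := mul_le_mul a3 b3 c3 a4
    have a6 := mul_nonneg a4 hE0
    linarith
  have t1 : |inner ℝ (φ x • (U'' r • v)) J|
      ≤ |φ x| * (((w x)⁻¹ ^ 2 + ‖q‖ ^ 2 + w x * L) * E) := by
    rw [inner_smul_left, conj_trivial, abs_mul]
    refine mul_le_mul_of_nonneg_left ?_ (abs_nonneg _)
    have a1 := abs_real_inner_le_norm v (U'' r • J)
    rw [inner_smul_left, conj_trivial]
    rw [inner_smul_right, norm_smul, Real.norm_eq_abs] at a1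
    have a2 : (|U'' r| * ‖J‖) ^ 2 = U'' r ^ 2 * ‖J‖ ^ 2 := by rw [mul_pow, sq_abs]
    have a3 := sq_nonneg (‖v‖ - |U'' r| * ‖J‖)
    nlinarith
  have t2 : |inner ℝ (U' r • gradient φ x) J| ≤ K * ‖gradient φ x‖ * E := by
    refine (abs_real_inner_le_norm _ _).trans ?_
    rw [norm_smul, Real.norm_eq_abs]
    exact mul_le_mul (mul_le_mul_of_nonneg_right (hU.abs_le r s0) (norm_nonneg _)) b4
      (norm_nonneg _) (mul_nonneg hU.nonneg_left (norm_nonneg _))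
  rw [inner_add_left]
  refine (abs_add_le _ _).trans ((add_le_add t1 t2).trans (le_of_eq ?_))
  rw [energyWeight]
  ring

theorem contDiff_mul_entropy (h : LocalEnergy ρ g) (hw : ContDiff ℝ 1 w) (hpos : ∀ x, 0 < w x)
    (hU : EntropyFunction U U' U'' K L) {φ : Space d → ℝ} (hφ : ContDiff ℝ 1 φ) (k : ℕ) :
    ContDiff ℝ 1 (fun y => φ y * U' (smoothDensity w k ρ y)) := by
  have hr := contDiff_smoothDensity hw hpos k h.hasWeakGradient.locallyIntegrable_fun
  have hr0 := smoothDensity_nonneg hpos k h.nonneg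
  refine hφ.mul ?_
  have hd : ∀ x, HasFDerivAt (fun y => U' (smoothDensity w k ρ y))
      (U'' (smoothDensity w k ρ x) • fderiv ℝ (smoothDensity w k ρ) x) x := fun x =>
    (hU.hasDerivAt' _ (hr0 x)).comp_hasFDerivAt x (hr.differentiable one_ne_zero x).hasFDerivAt
  rw [contDiff_one_iff_hasFDerivAt]
  exact ⟨_, (hU.continuous_second_deriv_comp hr.continuous hr0).smul (hr.continuous_fderiv one_ne_zero), hd⟩

theorem continuous_inner_gradient (h : LocalEnergy ρ g) (hw : ContDiff ℝ 1 w)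
    (hpos : ∀ x, 0 < w x) (hU : EntropyFunction U U' U'' K L) {φ : Space d → ℝ}
    (hφ : ContDiff ℝ 1 φ) (k : ℕ) :
    Continuous fun x => inner ℝ (gradient (fun y => φ y * U' (smoothDensity w k ρ y)) x)
        (moll k (fun y => (w y * ρ y) • g y) x) :=
  (continuous_gradient (h.contDiff_mul_entropy hw hpos hU hφ k)).inner
    (continuous_moll k (h.locallyIntegrable_flux hw hpos))

/-- Convergence of the entropy production of mollifications, at a fixed time. -/
theorem tendsto_integral_inner_gradient (h : LocalEnergy ρ g) (hw : ContDiff ℝ 1 w)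
    (hpos : ∀ x, 0 < w x) (hU : EntropyFunction U U' U'' K L) {φ : Space d → ℝ}
    (hφ : ContDiff ℝ 1 φ) (hφs : HasCompactSupport φ) :
    Tendsto (fun k => ∫ x, inner ℝ (gradient (fun y => φ y * U' (smoothDensity w k ρ y)) x)
        (moll k (fun y => (w y * ρ y) • g y) x)) atTop
      (𝓝 (∫ x, inner ℝ (φ x • (U'' (ρ x) • g x) + U' (ρ x) • gradient φ x)
        ((w x * ρ x) • g x))) := by
  refine tendsto_integral_of_le_moll (continuous_energyWeight hw hpos hφ)
    (hasCompactSupport_energyWeight hφs) (h.locallyIntegrable_energyDensity hw)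
    (fun k => (h.continuous_inner_gradient hw hpos hU hφ k).aestronglyMeasurable)
    (fun k x => h.abs_inner_gradient_le hw hpos hU hφ k x) ?_
  filter_upwards [ae_tendsto_smoothDensity hw.continuous hpos
      h.hasWeakGradient.locallyIntegrable_fun,
    ae_tendsto_moll (h.hasWeakGradient.mul_contDiff_one hw).locallyIntegrable_grad,
    ae_tendsto_moll (h.locallyIntegrable_weighted hw),
    ae_tendsto_moll (h.locallyIntegrable_flux hw hpos)] with x h1 h2 h3 h4
  simp_rw [h.gradient_mul_entropy hw hpos hU hφ]
  have hv := (h2.const_smul (w x)⁻¹).add (h3.smul_const (gradient (fun y => (w y)⁻¹) x))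
  -- The two limits recombine by the product rule for `w⁻¹ (w ρ)`: the terms with the gradient of
  -- `w` cancel and `g` remains.
  have e : (w x)⁻¹ • (w x • g x + ρ x • gradient w x)
      + (w x * ρ x) • gradient (fun y => (w y)⁻¹) x = g x := by
    have hne := (hpos x).ne'
    rw [gradient_inv hw hpos, smul_add, inv_smul_smul₀ hne, smul_smul, smul_smul, add_assoc,
      ← add_smul]
    have : (w x)⁻¹ * ρ x + w x * ρ x * -(w x ^ 2)⁻¹ = 0 := by field_simp; ring
    rw [this, zero_smul, add_zero]
  rw [e] at hv
  have hr0 := fun k => smoothDensity_nonneg hpos k h.nonneg x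
  have hU2 : Tendsto (fun k => U'' (smoothDensity w k ρ x)) atTop (𝓝 (U'' (ρ x))) :=
    (hU.continuousOn (ρ x) (h.nonneg x)).tendsto.comp
      (tendsto_nhdsWithin_iff.2 ⟨h1, Eventually.of_forall hr0⟩)
  have hU1 := ((hU.hasDerivAt' _ (h.nonneg x)).continuousAt.tendsto).comp h1
  exact (((hU2.smul hv).const_smul (φ x)).add (hU1.smul_const (gradient φ x))).inner h4

end LocalEnergy

end

/-! ### The localised entropy balance along the flow. -/

section

variable {d : ℕ} {w : Space d → ℝ} {U U' U'' : ℝ → ℝ} {K L T : ℝ}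

/-- A weak solution on `[0, T]`, with square-integrable density. -/
structure SquareIntegrableFlow (w : Space d → ℝ) (T : ℝ) (ρ : ℝ → Space d → ℝ)
    (g : ℝ → Space d → Space d) : Prop where
  time_nonneg : 0 ≤ T
  measurable_density : Measurable (fun p : ℝ × Space d => ρ p.1 p.2)
  measurable_grad : Measurable (fun p : ℝ × Space d => g p.1 p.2)
  nonneg : ∀ t x, 0 ≤ ρ t x
  integrable : ∀ t ∈ Icc 0 T, Integrable (ρ t) (weighted w)
  hasWeakGradient : ∀ᵐ t ∂(volume.restrict (Ioc 0 T)), HasWeakGradient (ρ t) (g t)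
  sq : Integrable (fun p : ℝ × Space d => ρ p.1 p.2 ^ 2)
    ((volume.restrict (Ioc 0 T)).prod (weighted w))
  grad_sq : Integrable (fun p : ℝ × Space d => ‖g p.1 p.2‖ ^ 2)
    ((volume.restrict (Ioc 0 T)).prod (weighted w))
  action : Integrable (fun p : ℝ × Space d => ρ p.1 p.2 * ‖g p.1 p.2‖ ^ 2)
    ((volume.restrict (Ioc 0 T)).prod (weighted w))
  integral_eq : ∀ φ : Space d → ℝ, ContDiff ℝ ∞ φ → HasCompactSupport φ → ∀ t ∈ Icc 0 T,
    ∫ x, φ x * (w x * ρ t x) = (∫ x, φ x * (w x * ρ 0 x))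
      + ∫ s in (0 : ℝ)..t, -2 * ∫ x, inner ℝ ((w x * ρ s x) • g s x) (gradient φ x)

theorem integrable_prod_weighted_iff {ν : Measure ℝ} [SFinite ν] {F : Type*}
    [NormedAddCommGroup F] [NormedSpace ℝ F] (hw : Continuous w) (hpos : ∀ x, 0 < w x)
    (f : ℝ × Space d → F) : Integrable f (ν.prod (weighted w))
      ↔ Integrable (fun p => w p.2 • f p) (ν.prod volume) := by
  have hm : Measurable fun x => (w x).toNNReal := hw.measurable.real_toNNReal
  have hm2 : Measurable fun p : ℝ × Space d => (w p.2).toNNReal := hm.comp measurable_snd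
  rw [weighted_eq_withDensity_toNNReal, prod_withDensity_right hm.coe_nnreal_ennreal,
    integrable_withDensity_iff_integrable_smul hm2]
  simp only [NNReal.smul_def, Real.coe_toNNReal _ (hpos _).le]

namespace SquareIntegrableFlow

variable {ρ : ℝ → Space d → ℝ} {g : ℝ → Space d → Space d}

theorem measurable_slice (h : SquareIntegrableFlow w T ρ g) (t : ℝ) : Measurable (ρ t) :=
  h.measurable_density.comp measurable_prodMk_left

theorem measurable_flux (h : SquareIntegrableFlow w T ρ g) (hw : Continuous w) :
    Measurable (fun p : ℝ × Space d => (w p.2 * ρ p.1 p.2) • g p.1 p.2) :=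
  ((hw.measurable.comp measurable_snd).mul h.measurable_density).smul h.measurable_grad

/-- Uses `ρ ‖g‖ ≤ ρ² + ‖g‖²`. -/
theorem integrable_flux (h : SquareIntegrableFlow w T ρ g) (hw : Continuous w)
    (hpos : ∀ x, 0 < w x) :
    Integrable (fun p : ℝ × Space d => (w p.2 * ρ p.1 p.2) • g p.1 p.2)
      ((volume.restrict (Ioc 0 T)).prod volume) := by
  have h1 : Integrable (fun p : ℝ × Space d => ρ p.1 p.2 • g p.1 p.2)
      ((volume.restrict (Ioc 0 T)).prod (weighted w)) := by
    refine (h.sq.add h.grad_sq).mono'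
      (h.measurable_density.smul h.measurable_grad).aestronglyMeasurable (ae_of_all _ fun p => ?_)
    rw [norm_smul, Real.norm_of_nonneg (h.nonneg _ _)]
    simp only [Pi.add_apply]
    nlinarith [sq_nonneg (ρ p.1 p.2 - ‖g p.1 p.2‖), sq_nonneg (ρ p.1 p.2), sq_nonneg ‖g p.1 p.2‖]
  rw [integrable_prod_weighted_iff hw hpos] at h1
  simpa only [smul_smul] using h1

theorem ae_localEnergy (h : SquareIntegrableFlow w T ρ g) (hw : Continuous w)
    (hpos : ∀ x, 0 < w x) [IsProbabilityMeasure (weighted w)] :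
    ∀ᵐ t ∂(volume.restrict (Ioc 0 T)), LocalEnergy (ρ t) (g t) := by
  filter_upwards [h.hasWeakGradient, h.sq.prod_right_ae, h.grad_sq.prod_right_ae,
    h.action.prod_right_ae] with t h1 h2 h3 h4
  exact ⟨h1, h.nonneg t, locallyIntegrable_of_integrable_weighted hw hpos h2,
    locallyIntegrable_of_integrable_weighted hw hpos h3,
    locallyIntegrable_of_integrable_weighted hw hpos h4⟩

/-- The time derivative of the mollified measure. -/
noncomputable def rate (w : Space d → ℝ) (ρ : ℝ → Space d → ℝ) (g : ℝ → Space d → Space d)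
    (k : ℕ) (t : ℝ) (x : Space d) : ℝ :=
  2 * ∫ y, inner ℝ ((w y * ρ t y) • g t y) (gradient (ker d k) (x - y))

/-- The weak equation tested with the kernel centred at `x`: at each point the mollified measure is
a primitive in time of `rate`. -/
theorem moll_eq_add_integral_rate (h : SquareIntegrableFlow w T ρ g) (k : ℕ) (x : Space d)
    {t : ℝ} (ht : t ∈ Icc 0 T) :
    moll k (fun y => w y * ρ t y) x = moll k (fun y => w y * ρ 0 y) x
      + ∫ s in (0 : ℝ)..t, rate w ρ g k s x := by
  have h1 := h.integral_eq (fun y => ker d k (x - y))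
    ((contDiff_ker (n := ⊤) k).comp (by fun_prop))
    (hasCompactSupport_comp_sub (hasCompactSupport_ker k) x) t ht
  have e : ∀ y, gradient (fun y => ker d k (x - y)) y = -gradient (ker d k) (x - y) := fun y =>
    (hasGradientAt_comp_sub (contDiff_ker (n := 1) k) x y).gradient
  simp only [e, inner_neg_right, integral_neg, mul_neg, neg_mul, neg_neg] at h1
  exact h1

theorem exists_gradient_ker_bound (d k : ℕ) : ∃ c, ∀ x, ‖gradient (ker d k) x‖ ≤ c :=
  (continuous_gradient (contDiff_ker (n := 1) k)).bounded_above_of_compact_support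
    (hasCompactSupport_gradient (hasCompactSupport_ker k))

theorem measurable_rate (h : SquareIntegrableFlow w T ρ g) (hw : Continuous w) (k : ℕ) :
    Measurable (fun p : ℝ × Space d => rate w ρ g k p.1 p.2) := by
  have hgk : Measurable (gradient (ker d k)) :=
    (continuous_gradient (contDiff_ker (n := 1) k)).measurable
  have h1 : Measurable (fun q : (ℝ × Space d) × Space d =>
      (inner ℝ ((w q.2 * ρ q.1.1 q.2) • g q.1.1 q.2)
        (gradient (ker d k) (q.1.2 - q.2)) : ℝ)) :=
    ((h.measurable_flux hw).comp (g := fun p : ℝ × Space d => (w p.2 * ρ p.1 p.2) • g p.1 p.2)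
      (f := fun q : (ℝ × Space d) × Space d => (q.1.1, q.2)) (by fun_prop)).inner
      (hgk.comp (by fun_prop))
  exact (h1.stronglyMeasurable.integral_prod_right').measurable.const_mul 2

theorem measurable_smoothDensity (h : SquareIntegrableFlow w T ρ g) (hw : Continuous w) (k : ℕ) :
    Measurable (fun p : ℝ × Space d => smoothDensity w k (ρ p.1) p.2) := by
  have h1 : Measurable (fun q : (ℝ × Space d) × Space d =>
      ker d k (q.1.2 - q.2) • (w q.2 * ρ q.1.1 q.2)) := by
    refine Measurable.smul ((continuous_ker k).measurable.comp (by fun_prop)) ?_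
    exact (hw.measurable.comp measurable_snd).mul (h.measurable_density.comp
      (f := fun q : (ℝ × Space d) × Space d => (q.1.1, q.2)) (by fun_prop))
  exact ((hw.measurable.comp measurable_snd).inv).mul
    (h1.stronglyMeasurable.integral_prod_right').measurable

/-- The bound is uniform in `x` and, as a function of `t`, integrable; this justifies exchanging the
time and space integrals. -/
theorem ae_abs_rate_le (h : SquareIntegrableFlow w T ρ g) (hw : Continuous w)
    (hpos : ∀ x, 0 < w x) (k : ℕ) {c : ℝ} (hc : ∀ x, ‖gradient (ker d k) x‖ ≤ c) :
    ∀ᵐ t ∂(volume.restrict (Ioc 0 T)), ∀ x, |rate w ρ g k t x|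
      ≤ 2 * c * ∫ y, ‖(w y * ρ t y) • g t y‖ := by
  filter_upwards [(h.integrable_flux hw hpos).prod_right_ae] with t ht x
  have h1 := norm_integral_le_of_norm_le (ht.norm.mul_const c)
    (f := fun y => (inner ℝ ((w y * ρ t y) • g t y) (gradient (ker d k) (x - y)) : ℝ))
    (ae_of_all _ fun y => (norm_inner_le_norm _ _).trans
      (mul_le_mul_of_nonneg_left (hc _) (norm_nonneg _)))
  rw [integral_mul_const, Real.norm_eq_abs] at h1
  rw [rate, abs_mul, abs_two]
  linarith

theorem integrable_rate (h : SquareIntegrableFlow w T ρ g) (hw : Continuous w)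
    (hpos : ∀ x, 0 < w x) (k : ℕ) (x : Space d) :
    IntervalIntegrable (fun t => rate w ρ g k t x) volume 0 T := by
  rw [intervalIntegrable_iff_integrableOn_Ioc_of_le h.time_nonneg]
  obtain ⟨c, hc⟩ := exists_gradient_ker_bound d k
  have h1 : Integrable (fun t => ∫ y, ‖(w y * ρ t y) • g t y‖) (volume.restrict (Ioc 0 T)) :=
    (h.integrable_flux hw hpos).norm.integral_prod_left
  refine (h1.const_mul (2 * c)).mono'
    ((h.measurable_rate hw k).comp (f := fun t => (t, x)) (by fun_prop)).aestronglyMeasurable ?_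
  filter_upwards [h.ae_abs_rate_le hw hpos k hc] with t ht using ht x

theorem integrable_entropy_rate (h : SquareIntegrableFlow w T ρ g) (hw : Continuous w)
    (hpos : ∀ x, 0 < w x) (hU : EntropyFunction U U' U'' K L) {φ : Space d → ℝ}
    (hφ : Continuous φ) (hφs : HasCompactSupport φ) (k : ℕ) :
    Integrable (fun p : ℝ × Space d =>
      φ p.2 * U' (smoothDensity w k (ρ p.1) p.2) * rate w ρ g k p.1 p.2)
      ((volume.restrict (Ioc 0 T)).prod volume) := by
  obtain ⟨c, hc⟩ := exists_gradient_ker_bound d k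
  have h1 : Integrable (fun t => ∫ y, ‖(w y * ρ t y) • g t y‖) (volume.restrict (Ioc 0 T)) :=
    (h.integrable_flux hw hpos).norm.integral_prod_left
  have h2 : Integrable φ volume := hφ.integrable_of_hasCompactSupport hφs
  refine (((h1.const_mul (2 * c)).mul_prod h2.norm).const_mul K).mono'
    (((hφ.measurable.comp measurable_snd).mul (hU.measurable'.comp
      (h.measurable_smoothDensity hw k))).mul (h.measurable_rate hw k)).aestronglyMeasurable ?_
  have h3 : ∀ᵐ p ∂((volume.restrict (Ioc 0 T)).prod (volume : Measure (Space d))),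
      ∀ x, |rate w ρ g k p.1 x| ≤ 2 * c * ∫ y, ‖(w y * ρ p.1 y) • g p.1 y‖ :=
    Measure.quasiMeasurePreserving_fst.ae (h.ae_abs_rate_le hw hpos k hc)
  filter_upwards [h3] with p hp
  have h4 := hU.abs_le _ (smoothDensity_nonneg hpos k (h.nonneg p.1) p.2)
  rw [norm_mul, norm_mul, Real.norm_eq_abs (U' _), Real.norm_eq_abs (rate _ _ _ _ _ _)]
  calc ‖φ p.2‖ * |U' (smoothDensity w k (ρ p.1) p.2)| * |rate w ρ g k p.1 p.2|
      ≤ ‖φ p.2‖ * K * (2 * c * ∫ y, ‖(w y * ρ p.1 y) • g p.1 y‖) :=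
        mul_le_mul (mul_le_mul_of_nonneg_left h4 (norm_nonneg _)) (hp p.2) (abs_nonneg _)
          (mul_nonneg (norm_nonneg _) hU.nonneg_left)
    _ = _ := by ring

/-- Entropy balance for the mollified flow. -/
theorem entropy_smoothDensity_sub (h : SquareIntegrableFlow w T ρ g) (hw : ContDiff ℝ 1 w)
    (hpos : ∀ x, 0 < w x) [IsProbabilityMeasure (weighted w)]
    (hU : EntropyFunction U U' U'' K L) {φ : Space d → ℝ}
    (hφ : ContDiff ℝ 1 φ) (hφs : HasCompactSupport φ) (k : ℕ) :
    (∫ x, φ x * w x * U (smoothDensity w k (ρ T) x))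
        - ∫ x, φ x * w x * U (smoothDensity w k (ρ 0) x)
      = ∫ t in Ioc 0 T, ∫ x, φ x * U' (smoothDensity w k (ρ t) x) * rate w ρ g k t x := by
  have hwc := hw.continuous
  have hT := h.time_nonneg
  have hpt : ∀ x, φ x * w x * U (smoothDensity w k (ρ T) x)
      - φ x * w x * U (smoothDensity w k (ρ 0) x)
      = ∫ t in Ioc 0 T, φ x * U' (smoothDensity w k (ρ t) x) * rate w ρ g k t x := fun x => by
    -- Chain rule in time at a fixed point `x`. The factor `w x` in front of `U` cancels the `(w
    -- x)⁻¹` in the time derivative of the density.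
    have h1 := integral_deriv_comp_primitive hT (convex_Ici 0)
      (b := fun t => (w x)⁻¹ * rate w ρ g k t x) (h := fun t => smoothDensity w k (ρ t) x)
      ((h.integrable_rate hwc hpos k x).const_mul _)
      (fun t ht => by
        simp only [smoothDensity]
        rw [h.moll_eq_add_integral_rate k x ht, mul_add, intervalIntegral.integral_const_mul])
      (fun t ht => smoothDensity_nonneg hpos k (h.nonneg t) x) hU.hasDerivAt hU.abs_le
    rw [← mul_sub, h1, intervalIntegral.integral_of_le hT, ← integral_const_mul]
    refine integral_congr_ae (ae_of_all _ fun t => ?_)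
    have := (hpos x).ne'
    dsimp only
    field_simp
  have hli : ∀ t ∈ Icc 0 T, LocallyIntegrable (ρ t) volume := fun t ht =>
    locallyIntegrable_of_integrable_weighted hwc hpos (h.integrable t ht)
  have hi : ∀ t ∈ Icc 0 T, Integrable (fun x => φ x * w x * U (smoothDensity w k (ρ t) x))
      volume := fun t ht => by
    refine Continuous.integrable_of_hasCompactSupport ?_ (hφs.mul_right.mul_right)
    exact (hφ.continuous.mul hwc).mul (hU.continuous_comp
      (contDiff_smoothDensity hw hpos k (hli t ht)).continuous
      (smoothDensity_nonneg hpos k (h.nonneg t)))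
  rw [← integral_sub (hi T ⟨hT, le_rfl⟩) (hi 0 ⟨le_rfl, hT⟩)]
  simp_rw [hpt]
  exact (integral_integral_swap (f := fun t x =>
    φ x * U' (smoothDensity w k (ρ t) x) * rate w ρ g k t x)
    (h.integrable_entropy_rate hwc hpos hU hφ.continuous hφs k)).symm

theorem ae_integral_rate_eq (h : SquareIntegrableFlow w T ρ g) (hw : ContDiff ℝ 1 w)
    (hpos : ∀ x, 0 < w x) [IsProbabilityMeasure (weighted w)]
    (hU : EntropyFunction U U' U'' K L) {φ : Space d → ℝ}
    (hφ : ContDiff ℝ 1 φ) (hφs : HasCompactSupport φ) (k : ℕ) :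
    ∀ᵐ t ∂(volume.restrict (Ioc 0 T)),
      ∫ x, φ x * U' (smoothDensity w k (ρ t) x) * rate w ρ g k t x
        = -2 * ∫ x, inner ℝ (gradient (fun y => φ y * U' (smoothDensity w k (ρ t) y)) x)
          (moll k (fun y => (w y * ρ t y) • g t y) x) := by
  filter_upwards [h.ae_localEnergy hw.continuous hpos,
    (h.integrable_flux hw.continuous hpos).prod_right_ae] with t h1 h2
  have h3 := integral_mul_integral_inner_gradient_ker k
    (h1.contDiff_mul_entropy hw hpos hU hφ k) hφs.mul_right h2
  rw [neg_mul, ← mul_neg, ← h3, ← integral_const_mul]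
  refine integral_congr_ae (ae_of_all _ fun x => ?_)
  dsimp only
  rw [rate]
  ring

/-- The constant depends on `w` and `R` alone, through bounds of `w` and of `‖∇w‖² / w` on the ball.
Hence it serves all times at once and gives an integrable bound in time. -/
theorem exists_integral_energyDensity_le (hw : ContDiff ℝ 1 w) (hpos : ∀ x, 0 < w x) (R : ℝ) :
    ∃ D : ℝ, 0 ≤ D ∧ ∀ (ρ : Space d → ℝ) (g : Space d → Space d), (∀ x, 0 ≤ ρ x) →
      ∀ x ∈ Metric.closedBall (0 : Space d) R,
      energyDensity w ρ g x ≤ D * (w x * (ρ x ^ 2 + ‖g x‖ ^ 2 + ρ x * ‖g x‖ ^ 2 + 1)) := by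
  obtain ⟨c1, h1⟩ := (isCompact_closedBall (0 : Space d) R).exists_bound_of_continuousOn
    hw.continuous.continuousOn
  have hq : Continuous fun x => ‖gradient w x‖ ^ 2 * (w x)⁻¹ :=
    ((continuous_gradient hw).norm.pow 2).mul (contDiff_inv hw hpos).continuous
  obtain ⟨c2, h2⟩ := (isCompact_closedBall (0 : Space d) R).exists_bound_of_continuousOn
    hq.continuousOn
  refine ⟨2 * |c1| + 2 * |c2| + 1, by positivity, fun ρ g hρ x hx => ?_⟩
  have a1 : w x ≤ |c1| := (le_abs_self _).trans ((h1 x hx).trans (le_abs_self _))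
  have a2 : ‖gradient w x‖ ^ 2 ≤ |c2| * w x := by
    have := (le_abs_self _).trans ((h2 x hx).trans (le_abs_self _))
    rwa [← div_eq_mul_inv, div_le_iff₀ (hpos x)] at this
  have b1 := norm_add_sq_le_two (w x • g x) (ρ x • gradient w x)
  rw [norm_smul, norm_smul, mul_pow, mul_pow, Real.norm_eq_abs, Real.norm_eq_abs, sq_abs,
    sq_abs] at b1
  have p0 := hpos x
  have p1 : 0 ≤ w x * ρ x ^ 2 := by positivity
  have p2 : 0 ≤ w x * ‖g x‖ ^ 2 := by positivity
  have p3 : 0 ≤ w x * (ρ x * ‖g x‖ ^ 2) := mul_nonneg p0.le (mul_nonneg (hρ x) (sq_nonneg _))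
  have d1 : w x ^ 2 * ‖g x‖ ^ 2 ≤ |c1| * (w x * ‖g x‖ ^ 2) := by
    have := mul_le_mul_of_nonneg_right a1 p2
    linarith
  have d2 : ρ x ^ 2 * ‖gradient w x‖ ^ 2 ≤ |c2| * (w x * ρ x ^ 2) := by
    have := mul_le_mul_of_nonneg_left a2 (sq_nonneg (ρ x))
    linarith
  have d3 : (w x * ρ x) ^ 2 ≤ |c1| * (w x * ρ x ^ 2) := by
    have := mul_le_mul_of_nonneg_right a1 p1
    linarith
  have d4 : w x * ρ x ≤ w x * ρ x ^ 2 + w x := by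
    have : ρ x ≤ ρ x ^ 2 + 1 := by nlinarith [sq_nonneg (ρ x - 1), sq_nonneg (ρ x)]
    have := mul_le_mul_of_nonneg_left this p0.le
    linarith
  rw [energyDensity]
  have q1 := abs_nonneg c1
  have q2 := abs_nonneg c2
  have r1 := mul_nonneg q1 p1
  have r2 := mul_nonneg q2 p2
  have r3 := mul_nonneg q1 p3
  have r4 := mul_nonneg q2 p3
  have r5 := mul_nonneg q1 p0.le
  have r6 := mul_nonneg q2 p0.le
  have r7 := mul_nonneg q2 p1
  linarith

/-- Entropy balance, localised by a cutoff function. -/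
theorem entropy_sub (h : SquareIntegrableFlow w T ρ g) (hw : ContDiff ℝ 1 w)
    (hpos : ∀ x, 0 < w x) [IsProbabilityMeasure (weighted w)]
    (hU : EntropyFunction U U' U'' K L) {φ : Space d → ℝ}
    (hφ : ContDiff ℝ 1 φ) (hφs : HasCompactSupport φ) :
    (∫ x, φ x * w x * U (ρ T x)) - ∫ x, φ x * w x * U (ρ 0 x)
      = -2 * ∫ t in Ioc 0 T, ∫ x, inner ℝ
          (φ x • (U'' (ρ t x) • g t x) + U' (ρ t x) • gradient φ x) ((w x * ρ t x) • g t x) := by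
  have hwc := hw.continuous
  have hT := h.time_nonneg
  have hli : ∀ t ∈ Icc 0 T, LocallyIntegrable (ρ t) volume := fun t ht =>
    locallyIntegrable_of_integrable_weighted hwc hpos (h.integrable t ht)
  have l1 := (tendsto_integral_entropy_smoothDensity hw hpos hU hφ.continuous hφs (h.nonneg T)
    (hli T ⟨hT, le_rfl⟩)).sub (tendsto_integral_entropy_smoothDensity hw hpos hU hφ.continuous hφs
      (h.nonneg 0) (hli 0 ⟨le_rfl, hT⟩))
  simp_rw [fun k => h.entropy_smoothDensity_sub hw hpos hU hφ hφs k] at l1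
  refine tendsto_nhds_unique l1 ?_
  obtain ⟨R, hR⟩ := exists_eq_zero_of_hasCompactSupport
    (hasCompactSupport_energyWeight (w := w) (K := K) (L := L) hφs)
  obtain ⟨c, hc⟩ := (continuous_energyWeight (K := K) (L := L) hw hpos
    hφ).bounded_above_of_compact_support (hasCompactSupport_energyWeight hφs)
  have hc0 : 0 ≤ c := (norm_nonneg _).trans (hc 0)
  obtain ⟨D, hD0, hD⟩ := exists_integral_energyDensity_le hw hpos (R + 1)
  have hQ : Integrable (fun p : ℝ × Space d => w p.2 * (ρ p.1 p.2 ^ 2 + ‖g p.1 p.2‖ ^ 2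
      + ρ p.1 p.2 * ‖g p.1 p.2‖ ^ 2 + 1)) ((volume.restrict (Ioc 0 T)).prod volume) := by
    have := ((h.sq.add h.grad_sq).add h.action).add (integrable_const (1 : ℝ))
    rw [integrable_prod_weighted_iff hwc hpos] at this
    exact this
  rw [← integral_const_mul]
  -- The dominating function is independent of `k`: by self-adjointness the mollification of the
  -- energy density falls on the weight, whose mollification is bounded by `c` on a ball of radius
  -- `R + 1`.
  refine tendsto_integral_of_dominated_convergence (fun t => 2 * (c * (D * ∫ x, w x *
    (ρ t x ^ 2 + ‖g t x‖ ^ 2 + ρ t x * ‖g t x‖ ^ 2 + 1))))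
    (fun k => (h.integrable_entropy_rate hwc hpos hU hφ.continuous hφs
      k).integral_prod_left.aestronglyMeasurable)
    (((hQ.integral_prod_left.const_mul D).const_mul c).const_mul 2) (fun k => ?_) ?_
  · filter_upwards [h.ae_integral_rate_eq hw hpos hU hφ hφs k, h.ae_localEnergy hwc hpos,
      hQ.prod_right_ae] with t h1 h2 h3
    rw [h1, norm_mul, norm_neg, Real.norm_eq_abs, Real.norm_eq_abs, abs_two]
    refine mul_le_mul_of_nonneg_left ?_ zero_le_two
    have hE := h2.locallyIntegrable_energyDensity hw
    have hm : ∀ x, 0 ≤ w x * ρ t x := fun x => mul_nonneg (hpos x).le (h.nonneg t x)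
    have hE0 : ∀ x, 0 ≤ energyDensity w (ρ t) (g t) x := fun x => by
      have := hm x
      rw [energyDensity]
      positivity
    have hi := integrable_mul_moll k (continuous_energyWeight (K := K) (L := L) hw hpos hφ)
      (hasCompactSupport_energyWeight hφs) hE
    refine (abs_integral_le_integral_abs).trans ((integral_mono_of_nonneg
      (ae_of_all _ fun x => abs_nonneg _) hi (ae_of_all _ fun x =>
        h2.abs_inner_gradient_le hw hpos hU hφ k x)).trans ?_)
    refine (integral_mul_moll_le k (continuous_energyWeight hw hpos hφ) hR hc hE hE0).trans ?_
    refine mul_le_mul_of_nonneg_left ?_ hc0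
    rw [← integral_const_mul]
    refine (setIntegral_mono_on (hE.integrableOn_isCompact (isCompact_closedBall _ _))
      (h3.const_mul D).integrableOn measurableSet_closedBall
      (fun x hx => hD (ρ t) (g t) (h.nonneg t) x hx)).trans ?_
    refine setIntegral_le_integral (h3.const_mul D) (ae_of_all _ fun x => ?_)
    have := hpos x
    have := h.nonneg t x
    dsimp only [Pi.zero_apply]
    positivity
  · have h1 : ∀ᵐ t ∂(volume.restrict (Ioc 0 T)), ∀ k,
      ∫ x, φ x * U' (smoothDensity w k (ρ t) x) * rate w ρ g k t x
        = -2 * ∫ x, inner ℝ (gradient (fun y => φ y * U' (smoothDensity w k (ρ t) y)) x)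
          (moll k (fun y => (w y * ρ t y) • g t y) x) :=
      ae_all_iff.2 fun k => h.ae_integral_rate_eq hw hpos hU hφ hφs k
    filter_upwards [h1, h.ae_localEnergy hwc hpos] with t h1 h2
    simp_rw [h1]
    exact (h2.tendsto_integral_inner_gradient hw hpos hU hφ hφs).const_mul _

end SquareIntegrableFlow

end

/-! ### The global entropy balance. -/

section

variable {d : ℕ} {w : Space d → ℝ} {T : ℝ}

/-- The relative entropy of the measure with density `ρ` with respect to `weighted w`. -/
noncomputable def relEntropy (w ρ : Space d → ℝ) : ℝ≥0∞ :=
  ∫⁻ x, ENNReal.ofReal (klFun (ρ x)) ∂(weighted w)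

/-- Half the dissipation of the relative entropy along the flow. -/
noncomputable def dissipation (w ρ : Space d → ℝ) (g : Space d → Space d) : ℝ≥0∞ :=
  ∫⁻ x, (if ρ x = 0 then 0 else ‖g x‖ₑ ^ 2) ∂(weighted w)

theorem tendsto_ofReal_integral_ent {φ : ℕ → Space d → ℝ} (hw : Continuous w)
    (hpos : ∀ x, 0 < w x) (hφ : ∀ n, Continuous (φ n)) (hφ0 : ∀ n x, 0 ≤ φ n x)
    (hφ1 : ∀ n x, φ n x ≤ 1) (hφt : ∀ x, Tendsto (fun n => φ n x) atTop (𝓝 1))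
    {ρ : Space d → ℝ} (hρ : Measurable ρ) (hρ0 : ∀ x, 0 ≤ ρ x)
    (hi : ∀ n : ℕ, Integrable (fun x => φ n x * w x * ent ((n : ℝ) + 1) (ρ x)) volume) :
    Tendsto (fun n : ℕ => ENNReal.ofReal (∫ x, φ n x * w x * ent ((n : ℝ) + 1) (ρ x))) atTop
      (𝓝 (relEntropy w ρ)) := by
  have h1 : ∀ n : ℕ, (1 : ℝ) ≤ n + 1 := fun n => by
    linarith [(Nat.cast_nonneg n : (0 : ℝ) ≤ n)]
  have e : ∀ n : ℕ, ENNReal.ofReal (∫ x, φ n x * w x * ent ((n : ℝ) + 1) (ρ x))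
      = ∫⁻ x, ENNReal.ofReal (φ n x * ent ((n : ℝ) + 1) (ρ x)) ∂(weighted w) := fun n => by
    rw [ofReal_integral_eq_lintegral_ofReal (hi n) (ae_of_all _ fun x =>
      mul_nonneg (mul_nonneg (hφ0 n x) (hpos x).le) (ent_nonneg (h1 n) (hρ0 x))),
      lintegral_weighted hw]
    refine lintegral_congr fun x => ?_
    rw [← ENNReal.ofReal_mul (hpos x).le]
    congr 1
    ring
  have hm : ∀ n : ℕ, Measurable (ent ((n : ℝ) + 1)) := fun n => by
    have := continuous_klFun
    unfold ent
    exact Continuous.measurable (by fun_prop)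
  simp_rw [e]
  refine tendsto_lintegral_of_le_of_tendsto
    (fun n => ((hφ n).measurable.mul ((hm n).comp hρ)).ennreal_ofReal.aemeasurable)
    (fun n => ae_of_all _ fun x => ENNReal.ofReal_le_ofReal ?_)
    (ae_of_all _ fun x => ENNReal.tendsto_ofReal ?_)
  · exact (mul_le_of_le_one_left (ent_nonneg (h1 n) (hρ0 x)) (hφ1 n x)).trans
      (ent_le_klFun (h1 n) (hρ0 x))
  · simpa using (hφt x).mul (tendsto_ent (hρ0 x))

namespace SquareIntegrableFlow

variable {ρ : ℝ → Space d → ℝ} {g : ℝ → Space d → Space d}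

/-- Entropy balance: the relative entropy decreases at the rate of twice its dissipation. -/
theorem relEntropy_add (h : SquareIntegrableFlow w T ρ g) (hw : ContDiff ℝ 1 w)
    (hpos : ∀ x, 0 < w x) [IsProbabilityMeasure (weighted w)]
    (h0 : relEntropy w (ρ 0) ≠ ⊤) :
    relEntropy w (ρ T) + 2 * ∫⁻ t in Ioc 0 T, dissipation w (ρ t) (g t)
      = relEntropy w (ρ 0) := by
  have hwc := hw.continuous
  have hT := h.time_nonneg
  obtain ⟨φ, c, hφ, hφs, hφ0, hφ1, hφt, hφg⟩ := exists_cutoff d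
  have hφd : ∀ n, ContDiff ℝ 1 (φ n) := fun n => (hφ n).of_le (by simp)
  have h1 : ∀ n : ℕ, (1 : ℝ) ≤ n + 1 := fun n => by
    linarith [(Nat.cast_nonneg n : (0 : ℝ) ≤ n)]
  have hli : ∀ t ∈ Icc 0 T, LocallyIntegrable (ρ t) volume := fun t ht =>
    locallyIntegrable_of_integrable_weighted hwc hpos (h.integrable t ht)
  have hi : ∀ t ∈ Icc 0 T, ∀ n : ℕ,
      Integrable (fun x => φ n x * w x * ent ((n : ℝ) + 1) (ρ t x)) volume := fun t ht n => by
    have hU := entropyFunction_ent (h1 n)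
    have a1 : Integrable (fun x => φ n x • (w x • ρ t x)) volume :=
      (locallyIntegrable_continuous_smul hwc (hli t ht)).integrable_smul_left_of_hasCompactSupport
        (hφd n).continuous (hφs n)
    have a2 : Integrable (fun x => φ n x * w x) volume :=
      ((hφd n).continuous.mul hwc).integrable_of_hasCompactSupport (hφs n).mul_right
    have hm : Measurable (ent ((n : ℝ) + 1)) := by
      have := continuous_klFun
      unfold ent
      exact Continuous.measurable (by fun_prop)
    refine ((a2.norm.mul_const |ent ((n : ℝ) + 1) 0|).add
      (a1.norm.mul_const (Real.log ((n : ℝ) + 1)))).mono'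
      (((hφd n).continuous.mul hwc).measurable.mul
        (hm.comp (h.measurable_slice t))).aestronglyMeasurable (ae_of_all _ fun x => ?_)
    have b1 := hU.abs_sub_le (h.nonneg t x) le_rfl
    rw [sub_zero, abs_of_nonneg (h.nonneg t x)] at b1
    have b2 := abs_sub_abs_le_abs_sub (ent ((n : ℝ) + 1) (ρ t x)) (ent ((n : ℝ) + 1) 0)
    have b3 : |ent ((n : ℝ) + 1) (ρ t x)| ≤ |ent ((n : ℝ) + 1) 0|
      + Real.log ((n : ℝ) + 1) * ρ t x := by linarith
    have b4 : ‖φ n x • (w x • ρ t x)‖ = ‖φ n x * w x‖ * ρ t x := by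
      rw [norm_smul, norm_smul, norm_mul, Real.norm_of_nonneg (h.nonneg t x), mul_assoc]
    simp only [Pi.add_apply]
    rw [norm_mul, b4, Real.norm_eq_abs (ent _ _)]
    refine (mul_le_mul_of_nonneg_left b3 (norm_nonneg _)).trans (le_of_eq ?_)
    ring
  have hTm : T ∈ Icc 0 T := ⟨hT, le_rfl⟩
  have h0m : (0 : ℝ) ∈ Icc 0 T := ⟨le_rfl, hT⟩
  set A : ℝ → ℕ → ℝ := fun t n => ∫ x, φ n x * w x * ent ((n : ℝ) + 1) (ρ t x) with hA
  have hA0 : ∀ t n, 0 ≤ A t n := fun t n => integral_nonneg fun x =>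
    mul_nonneg (mul_nonneg (hφ0 n x) (hpos x).le) (ent_nonneg (h1 n) (h.nonneg t x))
  have hAlim : ∀ t ∈ Icc 0 T, Tendsto (fun n => ENNReal.ofReal (A t n)) atTop
      (𝓝 (relEntropy w (ρ t))) := fun t ht =>
    tendsto_ofReal_integral_ent hwc hpos (fun n => (hφd n).continuous) hφ0 hφ1 hφt
      (h.measurable_slice t) (h.nonneg t) (hi t ht)
  set P : Measure (ℝ × Space d) := (volume.restrict (Ioc 0 T)).prod volume with hP
  have hflux := h.integrable_flux hwc hpos
  have hgw : Integrable (fun p : ℝ × Space d => w p.2 * ‖g p.1 p.2‖ ^ 2) P := by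
    have := h.grad_sq
    rw [integrable_prod_weighted_iff hwc hpos] at this
    exact this
  have m1 : ∀ n, Measurable fun p : ℝ × Space d => φ n p.2 := fun n =>
    (hφd n).continuous.measurable.comp measurable_snd
  have mw : Measurable fun p : ℝ × Space d => w p.2 := hwc.measurable.comp measurable_snd
  -- `f` is the dissipation of the regularised entropy; `e`, introduced after it, is the error due
  -- to the gradient of the cutoff.
  set f : ℕ → ℝ × Space d → ℝ := fun n p =>
    φ n p.2 * (ρ p.1 p.2 * ddent ((n : ℝ) + 1) (ρ p.1 p.2)) * (w p.2 * ‖g p.1 p.2‖ ^ 2) with hf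
  have hθ0 : ∀ (n : ℕ) t x, 0 ≤ ρ t x * ddent ((n : ℝ) + 1) (ρ t x) := fun n t x =>
    mul_nonneg (h.nonneg t x) (ddent_nonneg (h1 n) (h.nonneg t x))
  have hf0 : ∀ n p, 0 ≤ f n p := fun n p => mul_nonneg (mul_nonneg (hφ0 n _) (hθ0 n _ _))
    (mul_nonneg (hpos _).le (sq_nonneg _))
  have hfle : ∀ n p, f n p ≤ w p.2 * ‖g p.1 p.2‖ ^ 2 := fun n p =>
    mul_le_of_le_one_left (mul_nonneg (hpos _).le (sq_nonneg _))
      (mul_le_one₀ (hφ1 n _) (hθ0 n _ _) (mul_ddent_le_one (h1 n) (h.nonneg _ _)))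
  have hfm : ∀ n, Measurable (f n) := fun n =>
    ((m1 n).mul (h.measurable_density.mul (measurable_ddent.comp h.measurable_density))).mul
      (mw.mul (h.measurable_grad.norm.pow_const 2))
  have hfi : ∀ n, Integrable (f n) P := fun n =>
    hgw.mono' (hfm n).aestronglyMeasurable (ae_of_all _ fun p => by
      rw [Real.norm_of_nonneg (hf0 n p)]; exact hfle n p)
  set e : ℕ → ℝ × Space d → ℝ := fun n p =>
    dent ((n : ℝ) + 1) (ρ p.1 p.2) * inner ℝ (gradient (φ n) p.2)
      ((w p.2 * ρ p.1 p.2) • g p.1 p.2) with he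
  have hele : ∀ n p, ‖e n p‖ ≤ Real.log ((n : ℝ) + 1) / (n + 1) * c
      * ‖(w p.2 * ρ p.1 p.2) • g p.1 p.2‖ := fun n p => by
    rw [he]
    dsimp only
    rw [norm_mul, Real.norm_eq_abs]
    have b1 := abs_dent_le (h1 n) (h.nonneg p.1 p.2)
    have b2 := (norm_inner_le_norm (𝕜 := ℝ) (gradient (φ n) p.2)
      ((w p.2 * ρ p.1 p.2) • g p.1 p.2)).trans
      (mul_le_mul_of_nonneg_right (hφg n p.2) (norm_nonneg _))
    refine (mul_le_mul b1 b2 (norm_nonneg _) ((abs_nonneg _).trans b1)).trans (le_of_eq ?_)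
    ring
  have hem : ∀ n, Measurable (e n) := fun n =>
    (measurable_dent.comp h.measurable_density).mul
      (((continuous_gradient (hφd n)).measurable.comp measurable_snd).inner
        (h.measurable_flux hwc))
  have hei : ∀ n, Integrable (e n) P := fun n =>
    (hflux.norm.const_mul _).mono' (hem n).aestronglyMeasurable (ae_of_all _ (hele n))
  -- Cutoff index and entropy parameter are tied by `a = n + 1`, so a single limit removes both.
  have hbal : ∀ n, A T n + 2 * ∫ p, f n p ∂P = A 0 n - 2 * ∫ p, e n p ∂P := fun n => by
    have hs := h.entropy_sub hw hpos (entropyFunction_ent (h1 n)) (hφd n) (hφs n)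
    have hpt : ∀ t x, inner ℝ (φ n x • (ddent ((n : ℝ) + 1) (ρ t x) • g t x)
        + dent ((n : ℝ) + 1) (ρ t x) • gradient (φ n) x) ((w x * ρ t x) • g t x)
        = (f n + e n) (t, x) := fun t x => by
      simp only [hf, he, Pi.add_apply, inner_add_left, inner_smul_left, inner_smul_right,
        conj_trivial, real_inner_self_eq_norm_sq]
      ring
    simp_rw [hpt] at hs
    have hpr : ∫ t in Ioc 0 T, ∫ x, (f n + e n) (t, x) = ∫ p, (f n + e n) p ∂P :=
      (integral_prod _ ((hfi n).add (hei n))).symm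
    rw [hpr, integral_add' (hfi n) (hei n)] at hs
    simp only [hA]
    linarith
  -- The error is at most `log (n + 1) / (n + 1)` times `c` times the total flux.
  have helim : Tendsto (fun n => ∫ p, e n p ∂P) atTop (𝓝 0) := by
    have b0 : Tendsto (fun n : ℕ => Real.log ((n : ℝ) + 1) / (n + 1)) atTop (𝓝 0) :=
      (Real.isLittleO_log_id_atTop.tendsto_div_nhds_zero).comp
        (tendsto_atTop_add_const_right _ _ tendsto_natCast_atTop_atTop)
    have b1 := (b0.mul_const c).mul_const (∫ p, ‖(w p.2 * ρ p.1 p.2) • g p.1 p.2‖ ∂P)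
    rw [zero_mul, zero_mul] at b1
    refine squeeze_zero_norm (fun n => ?_) b1
    have := norm_integral_le_of_norm_le (hflux.norm.const_mul _) (ae_of_all _ (hele n))
    rwa [integral_const_mul] at this
  have hflim : Tendsto (fun n => ENNReal.ofReal (∫ p, f n p ∂P)) atTop
      (𝓝 (∫⁻ t in Ioc 0 T, dissipation w (ρ t) (g t))) := by
    have b0 : ∫⁻ t in Ioc 0 T, dissipation w (ρ t) (g t)
        = ∫⁻ p, ENNReal.ofReal (w p.2) * (if ρ p.1 p.2 = 0 then 0 else ‖g p.1 p.2‖ₑ ^ 2) ∂P := by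
      have mm : Measurable fun p : ℝ × Space d =>
          ENNReal.ofReal (w p.2) * (if ρ p.1 p.2 = 0 then 0 else ‖g p.1 p.2‖ₑ ^ 2) :=
        mw.ennreal_ofReal.mul (Measurable.ite
          (measurableSet_eq_fun h.measurable_density measurable_const) measurable_const
          (h.measurable_grad.enorm.pow_const 2))
      rw [hP, lintegral_prod _ mm.aemeasurable]
      refine lintegral_congr fun t => ?_
      rw [dissipation, lintegral_weighted hwc]
    rw [b0]
    simp_rw [fun n => ofReal_integral_eq_lintegral_ofReal (hfi n) (ae_of_all _ (hf0 n))]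
    refine tendsto_lintegral_of_le_of_tendsto (fun n => (hfm n).ennreal_ofReal.aemeasurable)
      (fun n => ae_of_all _ fun p => ?_) (ae_of_all _ fun p => ?_)
    · by_cases hz : ρ p.1 p.2 = 0
      · simp [hf, hz]
      · rw [if_neg hz, enorm_sq_eq_ofReal, ← ENNReal.ofReal_mul (hpos _).le]
        exact ENNReal.ofReal_le_ofReal (hfle n p)
    · have b1 := ((hφt p.2).mul (tendsto_mul_ddent (h.nonneg p.1 p.2))).mul_const
        (w p.2 * ‖g p.1 p.2‖ ^ 2)
      have b2 := ENNReal.tendsto_ofReal b1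
      have b3 : ENNReal.ofReal (1 * (if ρ p.1 p.2 = 0 then 0 else 1) * (w p.2 * ‖g p.1 p.2‖ ^ 2))
          = ENNReal.ofReal (w p.2) * (if ρ p.1 p.2 = 0 then 0 else ‖g p.1 p.2‖ₑ ^ 2) := by
        by_cases hz : ρ p.1 p.2 = 0
        · simp [hz]
        · rw [if_neg hz, if_neg hz, one_mul, one_mul, ENNReal.ofReal_mul (hpos _).le,
            enorm_sq_eq_ofReal]
      rw [b3] at b2
      exact b2
  have hl1 : Tendsto (fun n => ENNReal.ofReal (A T n) + 2 * ENNReal.ofReal (∫ p, f n p ∂P)) atTop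
      (𝓝 (relEntropy w (ρ T) + 2 * ∫⁻ t in Ioc 0 T, dissipation w (ρ t) (g t))) :=
    (hAlim T hTm).add (ENNReal.Tendsto.const_mul hflim (Or.inr (by simp)))
  refine tendsto_nhds_unique hl1 ?_
  -- A finite initial entropy allows the limit to be taken in the reals, where the signed error can
  -- be subtracted.
  have hl2 : Tendsto (fun n => A 0 n) atTop (𝓝 (relEntropy w (ρ 0)).toReal) := by
    have := (ENNReal.tendsto_toReal h0).comp (hAlim 0 h0m)
    refine this.congr fun n => ?_
    exact ENNReal.toReal_ofReal (hA0 0 n)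
  have hl3 := ENNReal.tendsto_ofReal (hl2.sub (helim.const_mul 2))
  rw [mul_zero, sub_zero, ENNReal.ofReal_toReal h0] at hl3
  refine hl3.congr fun n => ?_
  rw [← hbal n, ENNReal.ofReal_add (hA0 T n) (mul_nonneg zero_le_two
    (integral_nonneg (hf0 n))), ENNReal.ofReal_mul zero_le_two]
  simp

end SquareIntegrableFlow

end

/-! ### Exponential decay and scalar inequalities. -/

/-- A function losing at least the rate `c` of its final value decays exponentially. -/
theorem le_mul_exp_of_mul_one_add_le {y : ℝ → ℝ} {c : ℝ} (hc : 0 ≤ c)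
    (hy : ∀ s t, 0 ≤ s → s ≤ t → y t * (1 + c * (t - s)) ≤ y s) {t : ℝ} (ht : 0 ≤ t) :
    y t ≤ y 0 * Real.exp (-(c * t)) := by
  -- The hypothesis is an implicit Euler step. Iterating it over `n` steps of length `t / n` gives a
  -- product that tends to `exp (c t)`.
  have hpow : ∀ n : ℕ, 0 < n → y t * (1 + c * t / n) ^ n ≤ y 0 := by
    intro n hn
    have hn' : (0 : ℝ) < n := Nat.cast_pos.2 hn
    have hstep : ∀ k : ℕ, y (k * (t / n)) * (1 + c * t / n) ^ k ≤ y 0 := by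
      intro k
      induction k with
      | zero => simp
      | succ k ih =>
        have h1 := hy (k * (t / n)) ((k + 1 : ℕ) * (t / n)) (by positivity)
          (by push_cast; nlinarith [div_nonneg ht hn'.le])
        have h2 : c * (((k + 1 : ℕ) : ℝ) * (t / n) - k * (t / n)) = c * t / n := by
          push_cast; ring
        rw [h2] at h1
        refine le_trans (le_of_eq_of_le ?_ (mul_le_mul_of_nonneg_right h1
          (pow_nonneg (by positivity : 0 ≤ 1 + c * t / n) k))) ih
        ring
    have := hstep n
    rwa [mul_div_cancel₀ _ hn'.ne'] at this
  have hlim := (Real.tendsto_one_add_div_pow_exp (c * t)).const_mul (y t)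
  have hle : y t * Real.exp (c * t) ≤ y 0 :=
    le_of_tendsto hlim ((eventually_gt_atTop 0).mono hpow)
  rwa [Real.exp_neg, ← div_eq_mul_inv, le_div_iff₀ (Real.exp_pos _)]

/-- Gronwall's inequality for the primitive of a function that dominates `c` times it. -/
theorem le_mul_exp_of_forall_eq_sub_integral {y b : ℝ → ℝ} {c : ℝ} (hc : 0 ≤ c)
    (hy0 : ∀ t, 0 ≤ t → 0 ≤ y t)
    (hb : ∀ t, 0 ≤ t → IntervalIntegrable b volume 0 t)
    (hy : ∀ t, 0 ≤ t → y t = y 0 - ∫ r in (0 : ℝ)..t, b r)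
    (hle : ∀ᵐ r ∂(volume.restrict (Ioi (0 : ℝ))), c * y r ≤ b r) {t : ℝ} (ht : 0 ≤ t) :
    y t ≤ y 0 * Real.exp (-(c * t)) := by
  have hsub : ∀ s t, 0 ≤ s → s ≤ t → y s = y t + ∫ r in s..t, b r := by
    intro s t hs hst
    rw [hy s hs, hy t (hs.trans hst),
      ← intervalIntegral.integral_add_adjacent_intervals (hb s hs)
        ((hb s hs).symm.trans (hb t (hs.trans hst)))]
    ring
  have hint : ∀ s t, 0 ≤ s → s ≤ t → IntervalIntegrable b volume s t := fun s t hs hst =>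
    (hb s hs).symm.trans (hb t (hs.trans hst))
  have hae : ∀ s t, 0 ≤ s → ∀ᵐ r ∂(volume.restrict (Ioc s t)), c * y r ≤ b r := fun s t hs =>
    ae_restrict_of_ae_restrict_of_subset (fun _ hr => hs.trans_lt hr.1) hle
  have hanti : ∀ s t, 0 ≤ s → s ≤ t → y t ≤ y s := by
    intro s t hs hst
    have : 0 ≤ ∫ r in s..t, b r := by
      rw [intervalIntegral.integral_of_le hst]
      refine setIntegral_nonneg_of_ae_restrict ?_
      filter_upwards [hae s t hs, ae_restrict_mem measurableSet_Ioc] with r h1 h2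
      exact (mul_nonneg hc (hy0 r (hs.trans h2.1.le))).trans h1
    linarith [hsub s t hs hst]
  refine le_mul_exp_of_mul_one_add_le hc (fun s t hs hst => ?_) ht
  -- As `y` is nonincreasing, `b r ≥ c y r ≥ c y t` for almost every `r` in the interval.
  have : c * y t * (t - s) ≤ ∫ r in s..t, b r := by
    rw [intervalIntegral.integral_of_le hst]
    have h1 : ∫ _ in Ioc s t, c * y t = c * y t * (t - s) := by
      rw [setIntegral_const, smul_eq_mul, measureReal_def, Real.volume_Ioc,
        ENNReal.toReal_ofReal (by linarith), mul_comm]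
    rw [← h1]
    refine integral_mono_ae (integrable_const _)
      ((intervalIntegrable_iff_integrableOn_Ioc_of_le hst).1 (hint s t hs hst)) ?_
    filter_upwards [hae s t hs, ae_restrict_mem measurableSet_Ioc] with r h2 h3
    exact (mul_le_mul_of_nonneg_left (hanti r t (hs.trans h3.1.le) h3.2) hc).trans h2
  linarith [hsub s t hs hst]

/-- The decay of an entropy `e` and of `1 - exp (-e)` under a dissipation `D` that controls
`exp e - 1`. -/
theorem entropy_decay {e D : ℝ → ℝ} {C : ℝ} (hC : 0 < C) (he : ∀ t, 0 ≤ t → 0 ≤ e t)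
    (hD : ∀ t, 0 ≤ t → IntervalIntegrable D volume 0 t)
    (heq : ∀ t, 0 ≤ t → e t = e 0 - ∫ r in (0 : ℝ)..t, 2 * D r)
    (hle : ∀ᵐ r ∂(volume.restrict (Ioi (0 : ℝ))), Real.exp (e r) - 1 ≤ C * D r)
    {t : ℝ} (ht : 0 ≤ t) :
    e t ≤ e 0 * Real.exp (-(2 * t / C)) ∧
      1 - Real.exp (-e t) ≤ (1 - Real.exp (-e 0)) * Real.exp (-(2 * t / C)) := by
  have hc : 2 * t / C = 2 / C * t := by ring
  have h2D : ∀ t, 0 ≤ t → IntervalIntegrable (fun r => 2 * D r) volume 0 t := fun t ht =>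
    (hD t ht).const_mul 2
  rw [hc]
  constructor
  · refine le_mul_exp_of_forall_eq_sub_integral (by positivity) he h2D heq ?_ ht
    filter_upwards [hle] with r hr
    have := Real.add_one_le_exp (e r)
    rw [div_mul_eq_mul_div, div_le_iff₀ hC]
    linarith
  · have hcont : ∀ t, 0 ≤ t → ContinuousOn e (uIcc 0 t) := by
      intro t ht
      refine ContinuousOn.congr (f := fun t => e 0 - ∫ r in (0 : ℝ)..t, 2 * D r) ?_
        fun r hr => heq r ?_
      · exact continuousOn_const.sub (intervalIntegral.continuousOn_primitive_interval
          ((intervalIntegrable_iff' enorm_ne_top).1 (h2D t ht)))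
      · rw [uIcc_of_le ht] at hr
        exact hr.1
    -- The derivative of `1 - exp (-e)` is `-exp (-e) · 2D`, and multiplying `exp e - 1 ≤ C D` by
    -- `exp (-e)` gives `1 - exp (-e) ≤ C exp (-e) D`.
    refine le_mul_exp_of_forall_eq_sub_integral (y := fun t => 1 - Real.exp (-e t))
      (b := fun r => Real.exp (-e r) * (2 * D r)) (by positivity)
      (fun t ht => ?_) (fun t ht => ?_) (fun t ht => ?_) ?_ ht
    · simpa using he t ht
    · exact (h2D t ht).continuousOn_mul (hcont t ht).neg.rexp
    · have := integral_deriv_comp_primitive (T := t) (b := fun r => -(2 * D r)) (h := e)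
        (U := fun x => Real.exp (-x)) (U' := fun x => -Real.exp (-x)) (K := 1) (S := Ici 0) ht
        (convex_Ici 0) (h2D t ht).neg
        (fun r hr => by rw [intervalIntegral.integral_neg, heq r hr.1, sub_eq_add_neg])
        (fun r hr => he r hr.1)
        (fun r _ => by simpa using (hasDerivAt_neg r).exp)
        (fun r hr => by simpa using hr)
      simp only [neg_mul_neg] at this
      linarith
    · filter_upwards [hle] with r hr
      have h1 : Real.exp (-e r) * (Real.exp (e r) - 1) = 1 - Real.exp (-e r) := by
        rw [mul_sub, ← Real.exp_add]
        simp
      have h2 := mul_le_mul_of_nonneg_left hr (Real.exp_pos (-e r)).le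
      rw [div_mul_eq_mul_div, div_le_iff₀ hC]
      linarith

/-- If `1 - exp (-e)` is at most `z ≤ 1 / 2`, then `e` is at most `2 z`. -/
theorem le_two_mul_of_one_sub_exp_neg_le {e z : ℝ} (hz0 : 0 ≤ z) (hz : z ≤ 1 / 2)
    (h : 1 - Real.exp (-e) ≤ z) : e ≤ 2 * z := by
  by_contra! hcon
  have h1 : Real.exp (-e) < Real.exp (-(2 * z)) := Real.exp_lt_exp.2 (by linarith)
  have h2 := Real.add_one_le_exp (2 * z)
  have h3 : Real.exp (-(2 * z)) * Real.exp (2 * z) = 1 := by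
    rw [← Real.exp_add]
    simp
  -- The contradiction is with `(1 - z)(1 + 2z) = 1 + z (1 - 2z) ≥ 1` for `0 ≤ z ≤ 1/2`.
  nlinarith [Real.exp_pos (-(2 * z))]

/-- The relative entropy is at most the logarithm of the second moment of the density. -/
theorem lintegral_klFun_le_ofReal_log {α : Type*} [MeasurableSpace α] {π : Measure α}
    [IsProbabilityMeasure π] {f : α → ℝ} (hf0 : ∀ x, 0 ≤ f x) (hf : Integrable f π)
    (hf1 : ∫ x, f x ∂π = 1) (hf2 : Integrable (fun x => f x ^ 2) π)
    (ha : 0 < ∫ x, f x ^ 2 ∂π) :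
    ∫⁻ x, ENNReal.ofReal (klFun (f x)) ∂π ≤ ENNReal.ofReal (Real.log (∫ x, f x ^ 2 ∂π)) := by
  set a := ∫ x, f x ^ 2 ∂π with ha'
  -- Jensen's inequality in tangent form: `log (f / a) ≤ f / a - 1`, multiplied by `f`. With `∫ f =
  -- 1` and `∫ f² = a` the right side integrates to exactly `log a`.
  have hle : ∀ x, klFun (f x) ≤ f x * (Real.log a - 2) + f x ^ 2 * a⁻¹ + 1 := by
    intro x
    rcases eq_or_lt_of_le (hf0 x) with h | h
    · simp [← h, klFun]
    · have h1 := Real.log_le_sub_one_of_pos (div_pos h ha)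
      rw [Real.log_div h.ne' ha.ne'] at h1
      have h2 := mul_le_mul_of_nonneg_left h1 h.le
      have h3 : f x * (f x / a - 1) = f x ^ 2 * a⁻¹ - f x := by
        rw [div_eq_mul_inv]
        ring
      rw [klFun]
      linarith
  have i1 : Integrable (fun x => f x * (Real.log a - 2)) π := hf.mul_const _
  have i2 : Integrable (fun x => f x ^ 2 * a⁻¹) π := hf2.mul_const _
  have i3 : Integrable (fun x => f x * (Real.log a - 2) + f x ^ 2 * a⁻¹) π := i1.add i2
  have i4 : Integrable (fun x => f x * (Real.log a - 2) + f x ^ 2 * a⁻¹ + 1) π :=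
    i3.add (integrable_const _)
  have hI : ∫ x, (f x * (Real.log a - 2) + f x ^ 2 * a⁻¹ + 1) ∂π = Real.log a := by
    rw [integral_add i3 (integrable_const _), integral_add i1 i2, integral_mul_const,
      integral_mul_const, hf1, ← ha', mul_inv_cancel₀ ha.ne', integral_const]
    simp
    ring
  rw [← hI, ofReal_integral_eq_lintegral_ofReal i4
    (ae_of_all _ fun x => (klFun_nonneg (hf0 x)).trans (hle x))]
  exact lintegral_mono fun x => ENNReal.ofReal_le_ofReal (hle x)

/-! ### From weak solutions to square-integrable flows. -/

section

variable {d : ℕ} {w : Space d → ℝ}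

theorem gibbs_eq_weighted (V : Space d → ℝ) :
    gibbs V = weighted fun x => Real.exp (-V x) / ∫ y, Real.exp (-V y) := rfl

namespace IsWeakSolution

variable {μ : ℝ → Measure (Space d)} {ρ : ℝ → Space d → ℝ} {g : ℝ → Space d → Space d}

section Slices

variable {π : Measure (Space d)}

theorem measurable_slice (h : IsWeakSolution π μ ρ g) (t : ℝ) : Measurable (ρ t) :=
  h.measurable_density.comp measurable_prodMk_left

theorem measurable_grad_slice (h : IsWeakSolution π μ ρ g) (t : ℝ) : Measurable (g t) :=
  h.measurable_grad.comp measurable_prodMk_left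

theorem lintegral_eq (h : IsWeakSolution π μ ρ g) {t : ℝ} (ht : 0 ≤ t) (f : Space d → ℝ≥0∞) :
    ∫⁻ x, f x ∂(μ t) = ∫⁻ x, ENNReal.ofReal (ρ t x) * f x ∂π := by
  rw [h.density_eq t ht, lintegral_withDensity_eq_lintegral_mul_non_measurable _
    (h.measurable_slice t).ennreal_ofReal (ae_of_all _ fun x => ENNReal.ofReal_lt_top)]
  rfl

theorem integral_eq_integral_mul (h : IsWeakSolution π μ ρ g) {t : ℝ} (ht : 0 ≤ t)
    (f : Space d → ℝ) : ∫ x, f x ∂(μ t) = ∫ x, ρ t x * f x ∂π := by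
  rw [h.density_eq t ht, integral_withDensity_eq_integral_toReal_smul
    (h.measurable_slice t).ennreal_ofReal (ae_of_all _ fun x => ENNReal.ofReal_lt_top)]
  simp only [smul_eq_mul, ENNReal.toReal_ofReal (h.density_nonneg t _)]

theorem lintegral_density (h : IsWeakSolution π μ ρ g) {t : ℝ} (ht : 0 ≤ t) :
    ∫⁻ x, ENNReal.ofReal (ρ t x) ∂π = 1 := by
  have := h.isProbabilityMeasure t ht
  have h1 := h.lintegral_eq ht fun _ => 1
  simpa using h1.symm

theorem integrable_density (h : IsWeakSolution π μ ρ g) {t : ℝ} (ht : 0 ≤ t) :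
    Integrable (ρ t) π := by
  refine ⟨(h.measurable_slice t).aestronglyMeasurable, ?_⟩
  rw [hasFiniteIntegral_iff_ofReal (ae_of_all _ (h.density_nonneg t)), h.lintegral_density ht]
  exact ENNReal.one_lt_top

theorem integral_density (h : IsWeakSolution π μ ρ g) {t : ℝ} (ht : 0 ≤ t) :
    ∫ x, ρ t x ∂π = 1 := by
  rw [integral_eq_lintegral_of_nonneg_ae (ae_of_all _ (h.density_nonneg t))
    (h.measurable_slice t).aestronglyMeasurable, h.lintegral_density ht, ENNReal.toReal_one]

theorem rnDeriv_toReal [SigmaFinite π] (h : IsWeakSolution π μ ρ g) {t : ℝ} (ht : 0 ≤ t) :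
    ∀ᵐ x ∂π, ((μ t).rnDeriv π x).toReal = ρ t x := by
  rw [h.density_eq t ht]
  filter_upwards [Measure.rnDeriv_withDensity π (h.measurable_slice t).ennreal_ofReal] with x hx
  rw [hx, ENNReal.toReal_ofReal (h.density_nonneg t x)]

theorem absolutelyContinuous (h : IsWeakSolution π μ ρ g) {t : ℝ} (ht : 0 ≤ t) : μ t ≪ π := by
  rw [h.density_eq t ht]
  exact withDensity_absolutelyContinuous _ _

end Slices

theorem klDiv_eq_relEntropy [IsProbabilityMeasure (weighted w)]
    (h : IsWeakSolution (weighted w) μ ρ g) {t : ℝ} (ht : 0 ≤ t) :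
    klDiv (μ t) (weighted w) = relEntropy w (ρ t) := by
  have := h.isProbabilityMeasure t ht
  rw [klDiv_eq_lintegral_klFun_of_ac (h.absolutelyContinuous ht), relEntropy]
  refine lintegral_congr_ae ?_
  filter_upwards [h.rnDeriv_toReal ht] with x hx
  rw [hx]

/-- Pointwise, `klFun s ≤ (s - 1)²`. -/
theorem relEntropy_le_chiSqDiv [IsProbabilityMeasure (weighted w)]
    (h : IsWeakSolution (weighted w) μ ρ g) {t : ℝ} (ht : 0 ≤ t) :
    relEntropy w (ρ t) ≤ chiSqDiv (μ t) (weighted w) := by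
  rw [chiSqDiv, if_pos (h.absolutelyContinuous ht), relEntropy]
  refine lintegral_mono_ae ?_
  filter_upwards [h.rnDeriv_toReal ht] with x hx
  rw [hx]
  exact ENNReal.ofReal_le_ofReal (klFun_le_sub_one_sq (h.density_nonneg t x))

theorem lintegral_grad_sq_lt_top {π : Measure (Space d)} [SFinite π]
    (h : IsWeakSolution π μ ρ g) :
    ∀ᵐ t ∂(volume.restrict (Ioi (0 : ℝ))), ∫⁻ x, ‖g t x‖ₑ ^ 2 ∂π < ⊤ := by
  have hm : Measurable fun t => ∫⁻ x, ‖g t x‖ₑ ^ 2 ∂π :=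
    (h.measurable_grad.enorm.pow_const 2).lintegral_prod_right'
  have hU : Ioi (0 : ℝ) = ⋃ n : ℕ, Ioc (0 : ℝ) n := by
    ext t
    simp only [mem_Ioi, mem_iUnion, mem_Ioc, exists_and_left]
    exact ⟨fun ht => ⟨ht, exists_nat_ge t⟩, fun ht => ht.1⟩
  rw [hU, ae_restrict_iUnion_iff]
  exact fun n => ae_lt_top hm (h.dirichlet_energy_lt_top n).ne

theorem dissipation_le_lintegral (ρ : Space d → ℝ) (g : Space d → Space d) :
    dissipation w ρ g ≤ ∫⁻ x, ‖g x‖ₑ ^ 2 ∂(weighted w) := by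
  refine lintegral_mono fun x => ?_
  dsimp only
  split_ifs
  · exact zero_le
  · exact le_rfl

theorem lintegral_sub_one_sq_le [IsProbabilityMeasure (weighted w)] {C : ℝ}
    (hw : Continuous w) (hpos : ∀ x, 0 < w x) (hP : PoincareInequality (weighted w) C)
    (h : IsWeakSolution (weighted w) μ ρ g) :
    ∀ᵐ t ∂(volume.restrict (Ioi (0 : ℝ))), ∫⁻ x, ‖ρ t x - 1‖ₑ ^ 2 ∂(weighted w)
      ≤ ENNReal.ofReal C * dissipation w (ρ t) (g t) := by
  filter_upwards [h.hasWeakGradient, h.lintegral_grad_sq_lt_top,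
    ae_restrict_mem measurableSet_Ioi] with t h1 h2 h3
  exact hP.lintegral_sub_one_sq_le hw hpos h1 (h.measurable_slice t) (h.measurable_grad_slice t)
    (h.integrable_density (mem_Ioi.1 h3).le) (h.integral_density (mem_Ioi.1 h3).le) h2

/-- Square integrability of `ρ` in space and time is not part of a weak solution: it comes from the
Poincaré inequality and the finite Dirichlet energy, through `ρ² ≤ 2 (ρ - 1)² + 2`. -/
theorem squareIntegrableFlow [IsProbabilityMeasure (weighted w)] {C : ℝ}
    (hw : Continuous w) (hpos : ∀ x, 0 < w x) (hP : PoincareInequality (weighted w) C)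
    (h : IsWeakSolution (weighted w) μ ρ g) {T : ℝ} (hT : 0 ≤ T) :
    SquareIntegrableFlow w T ρ g where
  time_nonneg := hT
  measurable_density := h.measurable_density
  measurable_grad := h.measurable_grad
  nonneg := h.density_nonneg
  integrable t ht := h.integrable_density ht.1
  hasWeakGradient := ae_restrict_of_ae_restrict_of_subset Ioc_subset_Ioi_self h.hasWeakGradient
  sq := by
    have hm : Measurable fun p : ℝ × Space d => ρ p.1 p.2 ^ 2 :=
      h.measurable_density.pow_const 2
    refine ⟨hm.aestronglyMeasurable, ?_⟩
    rw [hasFiniteIntegral_iff_ofReal (ae_of_all _ fun p => sq_nonneg _),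
      lintegral_prod _ hm.ennreal_ofReal.aemeasurable]
    have hle : ∀ᵐ t ∂(volume.restrict (Ioc 0 T)),
        ∫⁻ x, ENNReal.ofReal (ρ t x ^ 2) ∂(weighted w)
          ≤ 2 * (ENNReal.ofReal C * ∫⁻ x, ‖g t x‖ₑ ^ 2 ∂(weighted w)) + 2 := by
      filter_upwards [ae_restrict_of_ae_restrict_of_subset Ioc_subset_Ioi_self
        (h.lintegral_sub_one_sq_le hw hpos hP)] with t ht
      calc ∫⁻ x, ENNReal.ofReal (ρ t x ^ 2) ∂(weighted w)
          ≤ ∫⁻ x, (2 * ‖ρ t x - 1‖ₑ ^ 2 + 2) ∂(weighted w) := by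
            refine lintegral_mono fun x => ?_
            have h2 : (2 : ℝ≥0∞) = ENNReal.ofReal 2 := by simp
            rw [enorm_sq_eq_ofReal, h2, ← ENNReal.ofReal_mul zero_le_two,
              ← ENNReal.ofReal_add (by positivity) zero_le_two, Real.norm_eq_abs, sq_abs]
            exact ENNReal.ofReal_le_ofReal (by nlinarith [sq_nonneg (ρ t x - 2)])
        _ = 2 * ∫⁻ x, ‖ρ t x - 1‖ₑ ^ 2 ∂(weighted w) + 2 := by
            rw [lintegral_add_right _ measurable_const, lintegral_const, measure_univ, mul_one,
              lintegral_const_mul' _ _ (by simp)]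
        _ ≤ _ := by
            gcongr
            exact ht.trans (mul_le_mul_right (dissipation_le_lintegral _ _) _)
    refine (lintegral_mono_ae hle).trans_lt ?_
    rw [lintegral_add_right _ measurable_const, lintegral_const_mul' _ _ (by simp),
      lintegral_const_mul' _ _ ENNReal.ofReal_ne_top, lintegral_const]
    have := h.dirichlet_energy_lt_top T
    refine ENNReal.add_lt_top.2 ⟨ENNReal.mul_lt_top (by simp)
      (ENNReal.mul_lt_top ENNReal.ofReal_lt_top this), ?_⟩
    simp [ENNReal.mul_lt_top_iff]
  grad_sq := by
    have hm : Measurable fun p : ℝ × Space d => ‖g p.1 p.2‖ ^ 2 :=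
      h.measurable_grad.norm.pow_const 2
    refine ⟨hm.aestronglyMeasurable, ?_⟩
    rw [hasFiniteIntegral_iff_ofReal (ae_of_all _ fun p => sq_nonneg _),
      lintegral_prod _ hm.ennreal_ofReal.aemeasurable]
    simpa only [enorm_sq_eq_ofReal] using h.dirichlet_energy_lt_top T
  action := by
    have hm : Measurable fun p : ℝ × Space d => ρ p.1 p.2 * ‖g p.1 p.2‖ ^ 2 :=
      h.measurable_density.mul (h.measurable_grad.norm.pow_const 2)
    refine ⟨hm.aestronglyMeasurable, ?_⟩
    rw [hasFiniteIntegral_iff_ofReal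
      (ae_of_all _ fun p => mul_nonneg (h.density_nonneg _ _) (sq_nonneg _)),
      lintegral_prod _ hm.ennreal_ofReal.aemeasurable]
    refine lt_of_eq_of_lt (setLIntegral_congr_fun measurableSet_Ioc fun t ht => ?_)
      (h.action_lt_top T)
    rw [h.lintegral_eq ht.1.le]
    refine lintegral_congr fun x => ?_
    rw [enorm_sq_eq_ofReal, ENNReal.ofReal_mul (h.density_nonneg _ _)]
  integral_eq φ hφ hφc t ht := by
    have h1 := h.integral_eq φ hφ hφc t ht.1
    have h2 : ∀ s, 0 ≤ s → ∫ x, φ x ∂(μ s) = ∫ x, φ x * (w x * ρ s x) := fun s hs => by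
      rw [h.integral_eq_integral_mul hs, integral_weighted hw hpos]
      refine integral_congr_ae (ae_of_all _ fun x => ?_)
      simp only [smul_eq_mul]
      ring
    have h3 : ∫ s in (0 : ℝ)..t, ∫ x, inner ℝ (g s x) (gradient φ x) ∂(μ s)
        = ∫ s in (0 : ℝ)..t, ∫ x, inner ℝ ((w x * ρ s x) • g s x) (gradient φ x) := by
      refine intervalIntegral.integral_congr fun s hs => ?_
      rw [uIcc_of_le ht.1] at hs
      simp only [h.integral_eq_integral_mul hs.1, integral_weighted hw hpos]
      refine integral_congr_ae (ae_of_all _ fun x => ?_)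
      simp only [smul_eq_mul, real_inner_smul_left, mul_assoc]
    rw [intervalIntegral.integral_const_mul, ← h3, ← h1, h2 t ht.1, h2 0 le_rfl]
    ring

end IsWeakSolution

end

/-! ### Decay of the relative entropy. -/

section

variable {d : ℕ} {w : Space d → ℝ}

namespace IsWeakSolution

variable {μ : ℝ → Measure (Space d)} {ρ : ℝ → Space d → ℝ} {g : ℝ → Space d → Space d} {C : ℝ}

theorem measurable_dissipation [SFinite (weighted w)] (h : IsWeakSolution (weighted w) μ ρ g) :
    Measurable fun t => dissipation w (ρ t) (g t) :=
  (Measurable.ite (measurableSet_eq_fun h.measurable_density measurable_const) measurable_const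
    (h.measurable_grad.enorm.pow_const 2)).lintegral_prod_right'

/-- The chi-squared divergence controls the exponential of the relative entropy. -/
theorem exp_relEntropy_sub_one_le [IsProbabilityMeasure (weighted w)] {t : ℝ}
    (h : IsWeakSolution (weighted w) μ ρ g) (ht : 0 ≤ t)
    (hfin : ∫⁻ x, ‖ρ t x - 1‖ₑ ^ 2 ∂(weighted w) < ⊤) :
    Real.exp (relEntropy w (ρ t)).toReal - 1
      ≤ (∫⁻ x, ‖ρ t x - 1‖ₑ ^ 2 ∂(weighted w)).toReal := by
  have hm := h.measurable_slice t
  have hi := h.integrable_density ht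
  have h1 := h.integral_density ht
  have i1 : Integrable (fun x => (ρ t x - 1) ^ 2) (weighted w) := by
    refine ⟨((hm.sub_const 1).pow_const 2).aestronglyMeasurable, ?_⟩
    rw [hasFiniteIntegral_iff_ofReal (ae_of_all _ fun p => sq_nonneg _)]
    simpa only [enorm_sq_eq_ofReal, Real.norm_eq_abs, sq_abs] using hfin
  have i2 : Integrable (fun x => 2 * ρ t x - 1) (weighted w) :=
    (hi.const_mul 2).sub (integrable_const 1)
  have heq : (fun x => ρ t x ^ 2) = fun x => (ρ t x - 1) ^ 2 + (2 * ρ t x - 1) := by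
    funext x
    ring
  have i3 : Integrable (fun x => ρ t x ^ 2) (weighted w) := by
    rw [heq]
    exact i1.add i2
  have hX : (∫⁻ x, ‖ρ t x - 1‖ₑ ^ 2 ∂(weighted w)).toReal
      = ∫ x, (ρ t x - 1) ^ 2 ∂(weighted w) := by
    rw [integral_eq_lintegral_of_nonneg_ae (ae_of_all _ fun x => sq_nonneg _)
      i1.aestronglyMeasurable]
    simp only [enorm_sq_eq_ofReal, Real.norm_eq_abs, sq_abs]
  have hsq : ∫ x, ρ t x ^ 2 ∂(weighted w) = (∫ x, (ρ t x - 1) ^ 2 ∂(weighted w)) + 1 := by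
    rw [heq, integral_add i1 i2, integral_sub (hi.const_mul 2) (integrable_const 1),
      integral_const_mul, h1]
    simp
    norm_num
  have hX0 : 0 ≤ ∫ x, (ρ t x - 1) ^ 2 ∂(weighted w) := integral_nonneg fun x => sq_nonneg _
  have ha : 1 ≤ ∫ x, ρ t x ^ 2 ∂(weighted w) := by linarith
  have hlog := ENNReal.toReal_le_of_le_ofReal (Real.log_nonneg ha)
    (lintegral_klFun_le_ofReal_log (h.density_nonneg t) hi h1 i3 (by linarith))
  rw [hX]
  have := Real.exp_le_exp.2 hlog
  rw [Real.exp_log (by linarith)] at this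
  rw [relEntropy]
  linarith

/-- Decay of the relative entropy, and its regularization after a positive time. -/
theorem relEntropy_decay [IsProbabilityMeasure (weighted w)] (hw : ContDiff ℝ 1 w)
    (hpos : ∀ x, 0 < w x) (hC : 0 < C) (hP : PoincareInequality (weighted w) C)
    (h : IsWeakSolution (weighted w) μ ρ g) (h0 : relEntropy w (ρ 0) ≠ ⊤) {t : ℝ} (ht : 0 ≤ t) :
    relEntropy w (ρ t) ≠ ⊤ ∧
      (relEntropy w (ρ t)).toReal
        ≤ (relEntropy w (ρ 0)).toReal * Real.exp (-(2 * t / C)) ∧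
      1 - Real.exp (-(relEntropy w (ρ t)).toReal) ≤ Real.exp (-(2 * t / C)) := by
  have hbal : ∀ t, 0 ≤ t → relEntropy w (ρ t)
      + 2 * ∫⁻ r in Ioc 0 t, dissipation w (ρ r) (g r) = relEntropy w (ρ 0) := fun t ht =>
    (h.squareIntegrableFlow hw.continuous hpos hP ht).relEntropy_add hw hpos h0
  have hfin : ∀ t, 0 ≤ t → relEntropy w (ρ t) ≠ ⊤ := fun t ht =>
    ne_top_of_le_ne_top h0 (le_self_add.trans_eq (hbal t ht))
  have hDfin : ∀ t, 0 ≤ t → ∫⁻ r in Ioc 0 t, dissipation w (ρ r) (g r) ≠ ⊤ := by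
    intro t ht htop
    have h1 := hbal t ht
    rw [htop, ENNReal.mul_top two_ne_zero, add_top] at h1
    exact h0 h1.symm
  have hm := h.measurable_dissipation
  have hD : ∀ t, 0 ≤ t → IntervalIntegrable (fun r => (dissipation w (ρ r) (g r)).toReal)
      volume 0 t := fun t ht =>
    (intervalIntegrable_iff_integrableOn_Ioc_of_le ht).2
      (integrable_toReal_of_lintegral_ne_top hm.aemeasurable (hDfin t ht))
  have heq : ∀ t, 0 ≤ t → (relEntropy w (ρ t)).toReal = (relEntropy w (ρ 0)).toReal
      - ∫ r in (0 : ℝ)..t, 2 * (dissipation w (ρ r) (g r)).toReal := by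
    intro t ht
    rw [intervalIntegral.integral_const_mul, intervalIntegral.integral_of_le ht,
      integral_toReal hm.aemeasurable (ae_lt_top hm (hDfin t ht)), ← hbal t ht,
      ENNReal.toReal_add (hfin t ht) (ENNReal.mul_ne_top (by simp) (hDfin t ht)),
      ENNReal.toReal_mul]
    simp
  -- The differential inequality: `exp KL - 1 ≤ χ²` by Jensen and `χ² ≤ C ·` dissipation by
  -- Poincaré, for almost every time.
  have hle : ∀ᵐ r ∂(volume.restrict (Ioi (0 : ℝ))),
      Real.exp (relEntropy w (ρ r)).toReal - 1 ≤ C * (dissipation w (ρ r) (g r)).toReal := by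
    filter_upwards [h.lintegral_sub_one_sq_le hw.continuous hpos hP, h.lintegral_grad_sq_lt_top,
      ae_restrict_mem measurableSet_Ioi] with r h1 h2 h3
    have h4 : ENNReal.ofReal C * dissipation w (ρ r) (g r) < ⊤ := ENNReal.mul_lt_top
      ENNReal.ofReal_lt_top ((dissipation_le_lintegral _ _).trans_lt h2)
    have h5 := ENNReal.toReal_mono h4.ne h1
    rw [ENNReal.toReal_mul, ENNReal.toReal_ofReal hC.le] at h5
    exact (h.exp_relEntropy_sub_one_le (mem_Ioi.1 h3).le (h1.trans_lt h4)).trans h5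
  obtain ⟨h1, h2⟩ := entropy_decay hC (fun t _ => ENNReal.toReal_nonneg) hD heq hle ht
  refine ⟨hfin t ht, h1, h2.trans ?_⟩
  -- The factor `1 - exp (-KL)` at time `0` is at most `1`; discarding it makes the bound
  -- independent of the initial entropy.
  refine mul_le_of_le_one_left (Real.exp_pos _).le ?_
  linarith [Real.exp_pos (-(relEntropy w (ρ 0)).toReal)]

end IsWeakSolution

end

end ChiSquaredFlow

/-! ### The main theorem. -/

theorem theorem1 (d : ℕ) (V : EuclideanSpace ℝ (Fin d) → ℝ) (hV : ContDiff ℝ 1 V)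
    (hVint : Integrable (fun x => Real.exp (-V x)) volume)
    (C : ℝ) (hC : 0 < C)
    (hP : ChiSquaredFlow.PoincareInequality (ChiSquaredFlow.gibbs V) C)
    (μ : ℝ → Measure (EuclideanSpace ℝ (Fin d)))
    (hμ : ChiSquaredFlow.IsChiSquaredFlow (ChiSquaredFlow.gibbs V) μ)
    (hchi : ChiSquaredFlow.chiSqDiv (μ 0) (ChiSquaredFlow.gibbs V) < ⊤) :
    (∀ t : ℝ, 0 ≤ t →
      klDiv (μ t) (ChiSquaredFlow.gibbs V)
        ≤ klDiv (μ 0) (ChiSquaredFlow.gibbs V) * ENNReal.ofReal (Real.exp (-(2 * t / C)))) ∧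
    (∀ t : ℝ, C / 2 ≤ t →
      klDiv (μ t) (ChiSquaredFlow.gibbs V)
        ≤ min (klDiv (μ 0) (ChiSquaredFlow.gibbs V)) 2
          * ENNReal.ofReal (Real.exp (-(2 * t / C)))) := by
  obtain ⟨ρ, g, h⟩ := hμ
  have hprob : IsProbabilityMeasure (ChiSquaredFlow.gibbs V) := isProbabilityMeasure_tilted hVint
  have hZ := integral_exp_pos hVint
  rw [ChiSquaredFlow.gibbs_eq_weighted] at *
  set w : ChiSquaredFlow.Space d → ℝ := fun x => Real.exp (-V x) / ∫ y, Real.exp (-V y) with hw_def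
  have hw : ContDiff ℝ 1 w := hV.neg.exp.div_const _
  have hpos : ∀ x, 0 < w x := fun x => div_pos (Real.exp_pos _) hZ
  -- Finite initial `χ²` enters through finiteness of the initial relative entropy.
  have h0 : ChiSquaredFlow.relEntropy w (ρ 0) ≠ ⊤ := ((h.relEntropy_le_chiSqDiv le_rfl).trans_lt hchi).ne
  have hdecay := fun t (ht : 0 ≤ t) => h.relEntropy_decay hw hpos hC hP h0 ht
  have hfirst : ∀ t : ℝ, 0 ≤ t → klDiv (μ t) (ChiSquaredFlow.weighted w)
      ≤ klDiv (μ 0) (ChiSquaredFlow.weighted w) * ENNReal.ofReal (Real.exp (-(2 * t / C))) := by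
    intro t ht
    obtain ⟨h1, h2, -⟩ := hdecay t ht
    rw [h.klDiv_eq_relEntropy ht, h.klDiv_eq_relEntropy le_rfl, ← ENNReal.ofReal_toReal h1,
      ← ENNReal.ofReal_toReal h0, ← ENNReal.ofReal_mul ENNReal.toReal_nonneg]
    exact ENNReal.ofReal_le_ofReal h2
  refine ⟨hfirst, fun t ht => ?_⟩
  have ht0 : 0 ≤ t := by linarith
  rcases min_choice (klDiv (μ 0) (ChiSquaredFlow.weighted w)) 2 with hmin | hmin
  · rw [hmin]
    exact hfirst t ht0
  · rw [hmin, h.klDiv_eq_relEntropy ht0]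
    obtain ⟨h1, -, h2⟩ := hdecay t ht0
    -- For `t ≥ C / 2` the exponent `2t / C` is at least `1`, so its exponential is at least `1 + 1
    -- = 2`.
    have hz : Real.exp (-(2 * t / C)) ≤ 1 / 2 := by
      have h3 : 1 ≤ 2 * t / C := by
        rw [le_div_iff₀ hC]
        linarith
      have h4 := Real.add_one_le_exp (2 * t / C)
      rw [Real.exp_neg, inv_eq_one_div]
      exact one_div_le_one_div_of_le two_pos (by linarith)
    have h3 := ChiSquaredFlow.le_two_mul_of_one_sub_exp_neg_le (Real.exp_pos _).le hz h2
    have h4 : (2 : ℝ≥0∞) = ENNReal.ofReal 2 := by simp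
    rw [← ENNReal.ofReal_toReal h1, h4, ← ENNReal.ofReal_mul zero_le_two]
    exact ENNReal.ofReal_le_ofReal h3
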